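/- Let $n\ge 1$, $m\ge 2$, $N\ge 1$ be integers with $\gcd(m,N)=1$, and work over $\mathbb{C}$. A \emph{twisted $N$-gon} in $\mathrm{Gr}(n,mn)$ is a map $\phi:\mathbb{Z}\to \mathrm{Gr}(n,\mathbb{C}^{mn})$ with $\phi(k+N)=M\cdot\phi(k)$ for all $k$ and some $M\in \mathrm{SL}(mn)$, called a monodromy of $\phi$. A \emph{lift} is a sequence $V=(V_k)_{k\in\mathbb Z}$ of $mn\times n$ matrices such that the columns of $V_k$ form a basis of $\phi(k)$; it is twisted with monodromy $M$ if $V_{k+N}=MV_k$ for all $k$. The polygon is \emph{regular} if $\det(V_k,V_{k+1},\dots,V_{k+m-1})\neq 0$ for all $k$ and every lift $V$. For a twisted lift $V$ of a regular polygon, let $a_k^i$ ($0\le i\le m-1$, $k\in\mathbb{Z}/N$) be the $n\times n$ matrices with $$V_{k+m}=V_{k+m-1}a_k^{m-1}+\dots+V_{k+1}a_k^1+V_ka_k^0 .$$ Let $\mathcal{P}_N$ be the set of regular twisted $N$-gons modulo $\mathrm{SL}(mn)$, with the quotient topology from the space of pairs $(V,M)$ consisting of a twisted lift of a regular polygon and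 its monodromy. \textbf{(1)} For every regular twisted $N$-gon and each of its monodromies $M$ there is a lift $V$, twisted with monodromy $M$, such that $\det(V_k,\dots,V_{k+m-1})=1$ for all $k$, and such that every $a_k^0$ is block diagonal, $a_k^0=\mathrm{diagonal}(r_k^1,\dots,r_k^s)$, with upper triangular Toeplitz blocks whose number and sizes do not depend on $k$, and $\det a_k^0=(-1)^{n(m-1)}$. \textbf{(2)} There is an open dense subset $U\subset\mathcal{P}_N$ such that for every regular twisted $N$-gon $\phi$ with class $[\phi]\in U$ and each of its monodromies $M$ the following holds. There is a lift $V$ of $\phi$, twisted with monodromy $M$, such that $\det(V_k,\dots,V_{k+m-1})=1$ for all $k$, every $a_k^0$ is diagonal with $\det a_k^0=(-1)^{n(m-1)}$, and for every $k$ the product of $N$ matrices $b^k=a_{k-m+1}^{m-1}a_{k-m+2}^{m-1}\cdots a_{k-m+N}^{m-1}$ satisfies the $n-1$ syzygies $$b^k_{i,i+1}=b^k_{2,1},\qquad i=1,\dots,n-1 .$$ Moreover, the following entries of the $a_k^i$ are holomorphic local coordinates on $\mathcal{P}_N$ near $[\phi]$: the first $n-1$ diagonal entries of each $a_k^0$;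 $N(n^2-n+1)$ suitably chosen entries of the matrices $a_0^{m-1},\dots,a_{N-1}^{m-1}$; and all the $N(m-2)n^2$ entries of the $a_k^i$ with $i\ne 0,m-1$. That is, there is a homeomorphism $e$ from an open neighbourhood of $[\phi]$ onto an open subset of $\mathbb{C}^{N(m-1)n^2}$, and coefficients $\alpha(y)=(a_k^i)$ depending holomorphically on $y$ in the image of $e$, such that: $\alpha(e([\phi]))$ is the family of coefficients of $V$; for every $y$ the class $e^{-1}(y)$ contains a polygon having a twisted lift normalized as above (all determinants $1$, $a_k^0$ diagonal, syzygies) with coefficients $\alpha(y)$, and the chosen entries of $\alpha(y)$ are the components of $y$; the entries of all the $a_k^{m-1}$ are functions of the $N(n^2-n+1)$ chosen ones among them; and $e$ is holomorphic along every family of twisted lifts of regular polygons depending holomorphically on finitely many complex parameters, as long as their classes lie in the domain of $e$. -/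

import Mathlib

open scoped Matrix

/-! Throughout, `ℂ^{mn}` is written `Fin m × Fin n → ℂ`, the coordinates being ordered
lexicographically (as are the columns of the `mn × mn` frames below), and a lift of an
`n`-dimensional subspace of `ℂ^{mn}` is a matrix whose `n` columns form a basis of it. -/

/-- The group `SL(mn)` over `ℂ`. -/
abbrev SLmn (m n : ℕ) : Type := Matrix.SpecialLinearGroup (Fin m × Fin n) ℂ

/-- The action of `SL(mn)` on subspaces of `ℂ^{mn}`. -/
noncomputable def actSubspace {m n : ℕ} (g : SLmn m n)
    (W : Submodule ℂ (Fin m × Fin n → ℂ)) : Submodule ℂ (Fin m × Fin n → ℂ) :=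
  W.map (Matrix.toLin' (g : Matrix (Fin m × Fin n) (Fin m × Fin n) ℂ))

/-- The subspace generated by the columns of an `mn × n` matrix. -/
def colSpan {m n : ℕ} (X : Matrix (Fin m × Fin n) (Fin n) ℂ) :
    Submodule ℂ (Fin m × Fin n → ℂ) :=
  Submodule.span ℂ (Set.range X.col)

/-- The frame `ρ_k = (X_k X_{k+1} … X_{k+m-1})`, an `mn × mn` matrix. -/
def frame {m n : ℕ} (X : ℤ → Matrix (Fin m × Fin n) (Fin n) ℂ) (k : ℤ) :
    Matrix (Fin m × Fin n) (Fin m × Fin n) ℂ :=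
  Matrix.of fun r c => X (k + (c.1 : ℕ)) r c.2

/-- A twisted `N`-gon in `Gr(n, mn)`. -/
@[ext]
structure TwistedPolygon (m n N : ℕ) where
  /-- the vertices, points of `Gr(n, mn)` -/
  vertex : ℤ → Submodule ℂ (Fin m × Fin n → ℂ)
  finrank_vertex : ∀ k, Module.finrank ℂ (vertex k) = n
  exists_monodromy : ∃ M : SLmn m n, ∀ k, vertex (k + N) = actSubspace M (vertex k)

/-- `M` is a monodromy of the twisted polygon `φ`. -/
def TwistedPolygon.IsMonodromy {m n N : ℕ} (φ : TwistedPolygon m n N) (M : SLmn m n) : Prop :=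
  ∀ k, φ.vertex (k + N) = actSubspace M (φ.vertex k)

/-- `X` is a lift of `φ`. Since the vertices have dimension `n`, the `n` columns of `X k` are
then a basis of the vertex `k`. -/
def TwistedPolygon.IsLift {m n N : ℕ} (φ : TwistedPolygon m n N)
    (X : ℤ → Matrix (Fin m × Fin n) (Fin n) ℂ) : Prop :=
  ∀ k, colSpan (X k) = φ.vertex k

/-- `φ` is regular: the frames of every lift are invertible. -/
def TwistedPolygon.IsRegular {m n N : ℕ} (φ : TwistedPolygon m n N) : Prop :=
  ∀ X, φ.IsLift X → ∀ k, (frame X k).det ≠ 0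

/-- `X` is a lift of `φ` which is twisted with monodromy `M`. -/
structure TwistedPolygon.IsTwistedLift {m n N : ℕ} (φ : TwistedPolygon m n N) (M : SLmn m n)
    (X : ℤ → Matrix (Fin m × Fin n) (Fin n) ℂ) : Prop where
  isLift : φ.IsLift X
  twisted : ∀ k, X (k + N) = (M : Matrix (Fin m × Fin n) (Fin m × Fin n) ℂ) * X k

/-- The regular twisted `N`-gons in `Gr(n, mn)`. -/
abbrev RegularPolygon (m n N : ℕ) : Type := {φ : TwistedPolygon m n N // φ.IsRegular}

theorem actSubspace_one {m n : ℕ} (W : Submodule ℂ (Fin m × Fin n → ℂ)) :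
    actSubspace 1 W = W := by
  simp [actSubspace]

theorem actSubspace_mul {m n : ℕ} (g h : SLmn m n) (W : Submodule ℂ (Fin m × Fin n → ℂ)) :
    actSubspace (g * h) W = actSubspace g (actSubspace h W) := by
  simp [actSubspace, Matrix.toLin'_mul, Submodule.map_comp]

/-- Two regular twisted polygons are equivalent when an element of `SL(mn)` maps one to the
other. -/
def polygonSetoid (m n N : ℕ) : Setoid (RegularPolygon m n N) where
  r φ ψ := ∃ g : SLmn m n, ∀ k, ψ.1.vertex k = actSubspace g (φ.1.vertex k)
  iseqv :=
    { refl := fun _ => ⟨1, fun _ => (actSubspace_one _).symm⟩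
      symm := by
        rintro φ ψ ⟨g, hg⟩
        refine ⟨g⁻¹, fun k => ?_⟩
        rw [hg, ← actSubspace_mul, inv_mul_cancel, actSubspace_one]
      trans := by
        rintro φ ψ χ ⟨g, hg⟩ ⟨h, hh⟩
        refine ⟨h * g, fun k => ?_⟩
        rw [hh, hg, ← actSubspace_mul] }

/-- The moduli space of regular twisted `N`-gons in `Gr(n, mn)` modulo `SL(mn)`. -/
def ModuliSpace (m n N : ℕ) : Type := Quotient (polygonSetoid m n N)

/-- The class of a regular twisted polygon. -/
def ModuliSpace.mk {m n N : ℕ} (φ : RegularPolygon m n N) : ModuliSpace m n N :=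
  Quotient.mk (polygonSetoid m n N) φ

/-- The space of twisted lifts of regular twisted polygons: the pairs `(X, M)` where the columns
of each `X_k` are independent, `X_{k+N} = M X_k` and all the frames are invertible. It carries the
subspace topology. -/
abbrev TwistedLiftSpace (m n N : ℕ) : Type :=
  {p : (ℤ → Matrix (Fin m × Fin n) (Fin n) ℂ) × SLmn m n //
    (∀ k, LinearIndependent ℂ (p.1 k).col) ∧
    (∀ k, p.1 (k + N) = (p.2 : Matrix (Fin m × Fin n) (Fin m × Fin n) ℂ) * p.1 k) ∧
    (∀ k, (frame p.1 k).det ≠ 0)}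

theorem colSpan_mul {m n : ℕ} (g : SLmn m n) (X : Matrix (Fin m × Fin n) (Fin n) ℂ) :
    colSpan ((g : Matrix (Fin m × Fin n) (Fin m × Fin n) ℂ) * X) = actSubspace g (colSpan X) := by
  unfold colSpan actSubspace
  rw [Submodule.map_span, ← Set.range_comp]
  congr 2

theorem span_frame {m n : ℕ} (X : ℤ → Matrix (Fin m × Fin n) (Fin n) ℂ) (k : ℤ) :
    Submodule.span ℂ (Set.range (frame X k).col) = ⨆ i : Fin m, colSpan (X (k + (i : ℕ))) := by
  unfold colSpan
  rw [← Submodule.span_iUnion]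
  congr 1
  ext v
  simp only [Set.mem_range, Set.mem_iUnion, Prod.exists]
  rfl

theorem det_ne_zero_iff_span {ι : Type} [Fintype ι] [DecidableEq ι] (A : Matrix ι ι ℂ) :
    A.det ≠ 0 ↔ Submodule.span ℂ (Set.range A.col) = ⊤ := by
  rw [← isUnit_iff_ne_zero, ← Matrix.isUnit_iff_isUnit_det,
    ← Matrix.linearIndependent_cols_iff_isUnit]
  constructor
  · intro h
    exact h.span_eq_top_of_card_eq_finrank' (by simp)
  · intro h
    exact linearIndependent_of_top_le_span_of_card_eq_finrank h.ge (by simp)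

/-- The regular twisted polygon whose vertices are spanned by a twisted lift. -/
def TwistedLiftSpace.toPolygon {m n N : ℕ} (p : TwistedLiftSpace m n N) :
    RegularPolygon m n N :=
  ⟨{ vertex := fun k => colSpan (p.1.1 k)
     finrank_vertex := fun k => by
       unfold colSpan
       rw [finrank_span_eq_card (p.2.1 k), Fintype.card_fin]
     exists_monodromy := ⟨p.1.2, fun k => by rw [p.2.2.1 k, colSpan_mul]⟩ },
   fun Y hY k => by
     have h := p.2.2.2 k
     rw [det_ne_zero_iff_span, span_frame] at h ⊢
     rw [← h]
     exact iSup_congr fun i => hY _⟩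

/-- The class in the moduli space of the polygon spanned by a twisted lift. -/
def TwistedLiftSpace.toModuli {m n N : ℕ} (p : TwistedLiftSpace m n N) : ModuliSpace m n N :=
  ModuliSpace.mk (TwistedLiftSpace.toPolygon p)

/-- The quotient topology from the space of twisted lifts. -/
noncomputable instance (m n N : ℕ) : TopologicalSpace (ModuliSpace m n N) :=
  TopologicalSpace.coinduced (TwistedLiftSpace.toModuli (m := m) (n := n) (N := N)) inferInstance

/-- `N`-periodic families `a_k^i` (`k` modulo `N`, `i = 0, …, m - 1`) of `n × n` matrices. -/
abbrev Coefficients (m n N : ℕ) : Type := ZMod N → Fin m → Matrix (Fin n) (Fin n) ℂ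

/-- The recursion `V_{k+m} = V_{k+m-1} a_k^{m-1} + … + V_{k+1} a_k^1 + V_k a_k^0`. -/
def SatisfiesRecursion {m n N : ℕ} (V : ℤ → Matrix (Fin m × Fin n) (Fin n) ℂ)
    (a : Coefficients m n N) : Prop :=
  ∀ k : ℤ, V (k + m) = ∑ i : Fin m, V (k + (i : ℕ)) * a (k : ZMod N) i

/-- `R` is an upper triangular Toeplitz matrix. -/
def IsUpperToeplitz {l : ℕ} (R : Matrix (Fin l) (Fin l) ℂ) : Prop :=
  ∃ t : ℕ → ℂ, ∀ p q : Fin l, R p q = if p ≤ q then t ((q : ℕ) - (p : ℕ)) else 0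

/-- `A = diagonal(r^1, …, r^s)` with upper triangular Toeplitz blocks `r^1, …, r^s`, whose sizes
are those of the composition `c` of `n`. -/
def IsBlockToeplitz {n : ℕ} (c : Composition n) (A : Matrix (Fin n) (Fin n) ℂ) : Prop :=
  ∃ r : (i : Fin c.length) → Matrix (Fin (c.blocksFun i)) (Fin (c.blocksFun i)) ℂ,
    (∀ i, IsUpperToeplitz (r i)) ∧
    A = Matrix.reindex c.blocksFinEquiv c.blocksFinEquiv (Matrix.blockDiagonal' r)

/-- The ordered product `b^k = a_{k-m+1}^{m-1} a_{k-m+2}^{m-1} ⋯ a_{k-m+N}^{m-1}`, where `c_k`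
stands for `a_k^{m-1}`. -/
def cyclicProduct (m : ℕ) {n N : ℕ} (c : ZMod N → Matrix (Fin n) (Fin n) ℂ) (k : ZMod N) :
    Matrix (Fin n) (Fin n) ℂ :=
  (List.ofFn fun j : Fin N => c (k - (m : ZMod N) + 1 + ((j : ℕ) : ZMod N))).prod

/-- The syzygies: for every `k`, the entries of `b^k` in the places
`(1,2), (2,3), …, (n-1,n)` are all equal to the entry in the place `(2,1)`. -/
def Syzygies (m : ℕ) {n N : ℕ} (c : ZMod N → Matrix (Fin n) (Fin n) ℂ) : Prop :=
  ∀ (k : ZMod N) (i : ℕ) (hi : i + 1 < n),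
    cyclicProduct m c k ⟨i, by omega⟩ ⟨i + 1, hi⟩ =
      cyclicProduct m c k ⟨1, by omega⟩ ⟨0, by omega⟩

/-- The generic normal form of the coefficients: `a_k^0` is diagonal (all Toeplitz blocks have
size one) of determinant `(-1)^{n(m-1)}`, and the `a_k^{m-1}` satisfy the syzygies. -/
structure IsGenericNormalForm {m n N : ℕ} (a : Coefficients m n N) : Prop where
  diagonal : ∀ (k : ZMod N) (i : Fin m), (i : ℕ) = 0 → (a k i).IsDiag
  det : ∀ (k : ZMod N) (i : Fin m), (i : ℕ) = 0 → (a k i).det = (-1) ^ (n * (m - 1))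
  syzygies : ∀ i : Fin m, (i : ℕ) + 1 = m → Syzygies m fun k => a k i

/-- `T` is a set of places `(k, i, p, q)` (the entry `(p, q)` of `a_k^i`) consisting of
the first `n - 1` diagonal entries of each `a_k^0`, of `N (n^2 - n + 1)` entries
of the matrices `a_k^{m-1}`, and of all the entries of the `a_k^i` with `i ≠ 0, m - 1`. -/
structure IsCoordinateSelection {m n N : ℕ}
    (T : Finset (ZMod N × Fin m × Fin n × Fin n)) : Prop where
  first : ∀ (k : ZMod N) (i : Fin m) (p q : Fin n), (i : ℕ) = 0 →
    ((k, i, p, q) ∈ T ↔ p = q ∧ (p : ℕ) + 1 < n)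
  last : (T.filter fun t => (t.2.1 : ℕ) + 1 = m).card = N * (n ^ 2 - n + 1)
  middle : ∀ (k : ZMod N) (i : Fin m) (p q : Fin n), 0 < (i : ℕ) → (i : ℕ) + 1 < m →
    (k, i, p, q) ∈ T

/-- The entries of the coefficients in the places `T` are holomorphic local coordinates on the
moduli space: `e` is a homeomorphism of an open subset of the moduli space onto an open subset of
`ℂ^T`, and `α y` are the coefficients, in generic normal form, of a normalized lift of the point
with coordinates `y`. -/
structure IsCoefficientChart {m n N : ℕ} (T : Finset (ZMod N × Fin m × Fin n × Fin n))
    (e : OpenPartialHomeomorph (ModuliSpace m n N) (T → ℂ))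
    (α : (T → ℂ) → Coefficients m n N) : Prop where
  /-- the coordinates are the entries in the places `T` -/
  coordinates : ∀ y ∈ e.target, ∀ t : T, α y t.1.1 t.1.2.1 t.1.2.2.1 t.1.2.2.2 = y t
  normalForm : ∀ y ∈ e.target, IsGenericNormalForm (α y)
  /-- the point with coordinates `y` has a normalized twisted lift with coefficients `α y` -/
  lift : ∀ y ∈ e.target, ∃ (ψ : RegularPolygon m n N) (M : SLmn m n)
    (W : ℤ → Matrix (Fin m × Fin n) (Fin n) ℂ), ModuliSpace.mk ψ = e.symm y ∧
      ψ.1.IsTwistedLift M W ∧ (∀ k, (frame W k).det = 1) ∧ SatisfiesRecursion W (α y)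
  /-- all the entries depend holomorphically on the coordinates -/
  holomorphic : ∀ (k : ZMod N) (i : Fin m) (p q : Fin n),
    DifferentiableOn ℂ (fun y => α y k i p q) e.target
  /-- the entries of all the `a_k^{m-1}` are functions of the selected ones alone -/
  generated : ∀ y ∈ e.target, ∀ y' ∈ e.target,
    (∀ t : T, (t.1.2.1 : ℕ) + 1 = m → y t = y' t) →
      ∀ (k : ZMod N) (i : Fin m), (i : ℕ) + 1 = m → α y k i = α y' k i
  /-- the coordinates vary holomorphically along each holomorphic family of twisted polygons -/
  family : ∀ (r : ℕ) (O : Set (Fin r → ℂ)) (F : (Fin r → ℂ) → TwistedLiftSpace m n N),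
    IsOpen O → (∀ (k : ℤ) (x : Fin m × Fin n) (j : Fin n),
      DifferentiableOn ℂ (fun z => (F z).1.1 k x j) O) →
    (∀ z ∈ O, TwistedLiftSpace.toModuli (F z) ∈ e.source) →
      DifferentiableOn ℂ (fun z => e (TwistedLiftSpace.toModuli (F z))) O

/-! Write m = `μ + 1`. Replacing the bases `V_k` by `V_k h_k` replaces `a_k^i` by `h_{k+i}⁻¹ a_k^i
h_{k+m}`, and the coefficients determine a lift up to a constant left factor. So two polygons are
equivalent exactly when the coefficients of their lifts are intertwined by some family `h`
(`toModuli_eq_of_intertwines`, `exists_intertwines`), and the theorem becomes a question of normal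
forms for this action.

Since m is prime to N, the steps `k ↦ k + m` run through `ℤ/N` in a single cycle. This makes the
scalar system that normalizes the determinants solvable. It also shows that the only invariant of
the `a_k^0` under changes of bases is the conjugacy class of their product along the cycle. Hence
`a_k^0` can be made one fixed scalar matrix for `k ≠ 0`, and `a_0^0` a multiple of the Jordan form
of that product. This is (1).

For (2), when the eigenvalues of that product are distinct, all the `a_k^0` can be diagonal.
Diagonal `h_k` remain; periodic ones conjugate `b^k` by `h_k`, and the syzygies cut them down to
scalars and finitely many choices. `IsGeneric` collects conditions under which this works. One of
them forces the stabilizer in `SL(mn)` to be scalar, so that the monodromy is unique up to a root of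
unity `x` and every intertwiner satisfies `h_{k+N} = x h_k` (`exists_intertwines_of_isGeneric`).

A chart needs three facts near a generic normal form. Nearby coefficients are brought to normal form
by a holomorphic change of bases, because the normal form equations are transverse to the orbits
(`IsGeneric.exists_normalizer`). The nearby normal forms are holomorphic functions of the chosen
entries, because the syzygies are independent equations on the `a_k^{m-1}`
(`IsGeneric.exists_parametrization`). Two nearby normal forms of the same class are equal
(`IsGeneric.eventually_eq_of_intertwines`). Together they make the map from parameters to classes a
homeomorphism onto an open set (`IsGeneric.exists_chart`).

Density starts from the lift of (1), where `a_0^0` is upper triangular. A small diagonal factor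
separates its eigenvalues, after which it is diagonalizable. The `a_k^{m-1}` then move along a
complex line towards an explicit generic family. Genericity is implied by the non-vanishing of a
holomorphic function that is not identically zero on that line, so it holds arbitrarily close to the
starting point. -/

set_option linter.unusedSectionVars false

/-! ### Block companion matrices -/

/-- The `mn × n` matrix with blocks `B 0, …, B (m - 1)`. -/
def stack {m n : ℕ} (B : Fin m → Matrix (Fin n) (Fin n) ℂ) : Matrix (Fin m × Fin n) (Fin n) ℂ :=
  Matrix.of fun x q => B x.1 x.2 q

theorem frame_mul_stack {m n : ℕ} (X : ℤ → Matrix (Fin m × Fin n) (Fin n) ℂ) (k : ℤ)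
    (B : Fin m → Matrix (Fin n) (Fin n) ℂ) :
    frame X k * stack B = ∑ i : Fin m, X (k + (i : ℕ)) * B i := by
  ext r q
  simp [Matrix.mul_apply, frame, stack, Fintype.sum_prod_type, Matrix.sum_apply]

theorem stack_injective {m n : ℕ} : Function.Injective (stack (m := m) (n := n)) := by
  intro B B' h
  ext i p q
  exact congr_fun (congr_fun h (i, p)) q

/-- The block companion matrix with last block column `B`. -/
def companion {μ n : ℕ} (B : Fin (μ + 1) → Matrix (Fin n) (Fin n) ℂ) :
    Matrix (Fin (μ + 1) × Fin n) (Fin (μ + 1) × Fin n) ℂ :=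
  Matrix.of fun x y => Fin.lastCases (motive := fun _ => ℂ) (B x.1 x.2 y.2)
    (fun j => if x = (j.succ, y.2) then 1 else 0) y.1

theorem companion_last {μ n : ℕ} (B : Fin (μ + 1) → Matrix (Fin n) (Fin n) ℂ)
    (x : Fin (μ + 1) × Fin n) (q : Fin n) : companion B x (Fin.last μ, q) = B x.1 x.2 q := by
  simp [companion]

theorem companion_castSucc {μ n : ℕ} (B : Fin (μ + 1) → Matrix (Fin n) (Fin n) ℂ)
    (x : Fin (μ + 1) × Fin n) (j : Fin μ) (q : Fin n) :
    companion B x (j.castSucc, q) = if x = (j.succ, q) then 1 else 0 := by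
  simp [companion]

theorem mul_companion_castSucc {μ n : ℕ} {ι : Type*} (R : Matrix ι (Fin (μ + 1) × Fin n) ℂ)
    (B : Fin (μ + 1) → Matrix (Fin n) (Fin n) ℂ) (r : ι) (j : Fin μ) (q : Fin n) :
    (R * companion B) r (j.castSucc, q) = R r (j.succ, q) := by
  simp [Matrix.mul_apply, companion_castSucc]

theorem mul_companion_last {μ n : ℕ} {ι : Type*} (R : Matrix ι (Fin (μ + 1) × Fin n) ℂ)
    (B : Fin (μ + 1) → Matrix (Fin n) (Fin n) ℂ) (r : ι) (q : Fin n) :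
    (R * companion B) r (Fin.last μ, q) = (R * stack B) r q := by
  simp [Matrix.mul_apply, companion_last, stack]

theorem frame_add_one {μ n : ℕ} (X : ℤ → Matrix (Fin (μ + 1) × Fin n) (Fin n) ℂ) (k : ℤ)
    (B : Fin (μ + 1) → Matrix (Fin n) (Fin n) ℂ)
    (h : X (k + (μ + 1 : ℕ)) = ∑ i : Fin (μ + 1), X (k + (i : ℕ)) * B i) :
    frame X (k + 1) = frame X k * companion B := by
  ext r ⟨j, q⟩
  induction j using Fin.lastCases with
  | last =>
    rw [mul_companion_last, frame_mul_stack, ← h]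
    simp only [frame, Matrix.of_apply, Fin.val_last]
    rw [show k + 1 + ((μ : ℕ) : ℤ) = k + ((μ + 1 : ℕ) : ℤ) by push_cast; ring]
  | cast j =>
    rw [mul_companion_castSucc]
    simp only [frame, Matrix.of_apply, Fin.val_castSucc, Fin.val_succ]
    rw [show k + 1 + ((j : ℕ) : ℤ) = k + ((j + 1 : ℕ) : ℤ) by push_cast; ring]

/-- Rotating the block columns moves the last one to the front and leaves a block triangular matrix
with diagonal blocks `B 0` and the identity. The rotation consists of `n` disjoint cycles of length
`μ + 1`, which gives the sign. -/
theorem det_companion {μ n : ℕ} (B : Fin (μ + 1) → Matrix (Fin n) (Fin n) ℂ) :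
    (companion B).det = (-1) ^ (n * μ) * (B 0).det := by
  let C : Matrix (Fin (μ + 1) × Fin n) (Fin (μ + 1) × Fin n) ℂ :=
    Matrix.of fun x y => Fin.cases (motive := fun _ => ℂ) (B x.1 x.2 y.2)
      (fun j => if x = (j.succ, y.2) then 1 else 0) y.1
  have h0 : ∀ x q, C x (0, q) = B x.1 x.2 q := fun x q => by simp [C]
  have hs : ∀ x j q, C x (Fin.succ j, q) = if x = (j.succ, q) then 1 else 0 :=
    fun x j q => by simp [C]
  let σ : Equiv.Perm (Fin (μ + 1) × Fin n) := Equiv.prodCongrLeft fun _ => finRotate (μ + 1)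
  have hσ : companion B = C.submatrix id σ := by
    ext x ⟨j, q⟩
    induction j using Fin.lastCases with
    | last =>
      rw [companion_last]
      simp [σ, Matrix.submatrix_apply, Equiv.prodCongrLeft, h0]
    | cast j =>
      rw [companion_castSucc]
      simp [σ, Matrix.submatrix_apply, Equiv.prodCongrLeft, hs]
  have hC : C.det = (B 0).det := by
    rw [Matrix.twoBlockTriangular_det' C (fun x => x.1 = 0)]
    · have e1 : (C.toSquareBlockProp fun x => x.1 = 0).det = (B 0).det := by
        let e : {x : Fin (μ + 1) × Fin n // x.1 = 0} ≃ Fin n :=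
          { toFun := fun x => x.1.2
            invFun := fun q => ⟨(0, q), rfl⟩
            left_inv := by rintro ⟨⟨i, q⟩, h⟩; exact Subtype.ext (Prod.ext (Eq.symm h) rfl)
            right_inv := fun q => rfl }
        rw [← Matrix.det_reindex_self e]
        congr 1
      have e2 : (C.toSquareBlockProp fun x => ¬ x.1 = 0) = 1 := by
        ext ⟨⟨i, p⟩, hi⟩ ⟨⟨j, q⟩, hj⟩
        obtain ⟨j, rfl⟩ := Fin.exists_succ_eq.2 hj
        simp [Matrix.toSquareBlockProp, hs, Matrix.one_apply, Matrix.toBlock]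
      rw [e1, e2, Matrix.det_one, mul_one]
    · rintro ⟨i, p⟩ hi ⟨j, q⟩ hj
      obtain ⟨j, rfl⟩ := Fin.exists_succ_eq.2 hj
      simp only at hi
      subst hi
      rw [hs, if_neg]
      simp [Fin.succ_ne_zero, eq_comm]
  rw [hσ, Matrix.det_permute', hC, Equiv.Perm.sign_prodCongrLeft]
  simp [sign_finRotate, ← pow_mul, mul_comm]

theorem neg_one_pow_mul_neg_one_pow (n μ : ℕ) : ((-1 : ℂ) ^ (n * μ)) * (-1) ^ (n * μ) = 1 := by
  rw [← mul_pow]; simp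

/-! ### Lifts of a polygon and changes of bases -/

section Lifts

variable {m n N : ℕ}

theorem frame_mul_left (M : Matrix (Fin m × Fin n) (Fin m × Fin n) ℂ)
    (X : ℤ → Matrix (Fin m × Fin n) (Fin n) ℂ) (k : ℤ) :
    frame (fun j => M * X j) k = M * frame X k := by
  ext r c
  simp [frame, Matrix.mul_apply]

theorem linearIndependent_col_of_frame [NeZero m] {X : ℤ → Matrix (Fin m × Fin n) (Fin n) ℂ}
    {k : ℤ} (h : (frame X k).det ≠ 0) : LinearIndependent ℂ (X k).col := by
  rw [← isUnit_iff_ne_zero, ← Matrix.isUnit_iff_isUnit_det,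
    ← Matrix.linearIndependent_cols_iff_isUnit] at h
  have := h.comp (fun q : Fin n => ((0 : Fin m), q)) (fun a b hab => by simpa using hab)
  have e : (X k).col = (frame X k).col ∘ fun q => ((0 : Fin m), q) := by
    ext q r
    change _ = X (k + (((0 : Fin m) : ℕ) : ℤ)) r q
    simp
  rw [e]
  exact this

theorem mul_right_injective_of_col {ι κ : Type*} [Fintype ι] [Fintype κ] {X : Matrix ι κ ℂ}
    (h : LinearIndependent ℂ X.col) {A B : Matrix κ κ ℂ} (hAB : X * A = X * B) : A = B := by
  have := Matrix.mulVec_injective_iff.2 h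
  ext p q
  have h2 : X *ᵥ (A.col q) = X *ᵥ (B.col q) := by
    ext r
    exact congr_fun (congr_fun hAB r) q
  exact congr_fun (this h2) p

theorem exists_mul_of_colSpan_le {X Y : Matrix (Fin m × Fin n) (Fin n) ℂ}
    (h : colSpan Y ≤ colSpan X) : ∃ g : Matrix (Fin n) (Fin n) ℂ, Y = X * g := by
  have : ∀ q, ∃ v : Fin n → ℂ, X *ᵥ v = Y.col q := by
    intro q
    have hq : Y.col q ∈ colSpan X := h (Submodule.subset_span ⟨q, rfl⟩)
    unfold colSpan at hq
    rw [← Matrix.range_mulVecLin] at hq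
    exact hq
  choose v hv using this
  refine ⟨Matrix.of fun p q => v q p, ?_⟩
  ext r q
  exact (congr_fun (hv q) r).symm

theorem colSpan_mul_le (X : Matrix (Fin m × Fin n) (Fin n) ℂ) (g : Matrix (Fin n) (Fin n) ℂ) :
    colSpan (X * g) ≤ colSpan X := by
  unfold colSpan
  rw [← Matrix.range_mulVecLin, ← Matrix.range_mulVecLin, Matrix.mulVecLin_mul]
  exact LinearMap.range_comp_le_range _ _

theorem colSpan_mul_unit (X : Matrix (Fin m × Fin n) (Fin n) ℂ)
    (g : (Matrix (Fin n) (Fin n) ℂ)ˣ) : colSpan (X * (g : Matrix (Fin n) (Fin n) ℂ)) = colSpan X := by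
  refine le_antisymm (colSpan_mul_le _ _) ?_
  conv_lhs => rw [← Matrix.mul_one X, ← Units.mul_inv g, ← Matrix.mul_assoc]
  exact colSpan_mul_le _ _

theorem exists_unit_of_colSpan_eq {X Y : Matrix (Fin m × Fin n) (Fin n) ℂ}
    (hX : LinearIndependent ℂ X.col) (hY : LinearIndependent ℂ Y.col)
    (h : colSpan Y = colSpan X) : ∃ g : (Matrix (Fin n) (Fin n) ℂ)ˣ,
      Y = X * (g : Matrix (Fin n) (Fin n) ℂ) := by
  obtain ⟨g, hg⟩ := exists_mul_of_colSpan_le h.le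
  obtain ⟨g', hg'⟩ := exists_mul_of_colSpan_le h.ge
  refine ⟨⟨g, g', ?_, ?_⟩, hg⟩
  · apply mul_right_injective_of_col hX
    rw [← Matrix.mul_assoc, ← hg, ← hg', Matrix.mul_one]
  · apply mul_right_injective_of_col hY
    rw [← Matrix.mul_assoc, ← hg', ← hg, Matrix.mul_one]

theorem linearIndependent_mul_unit {X : Matrix (Fin m × Fin n) (Fin n) ℂ}
    (hX : LinearIndependent ℂ X.col) (g : (Matrix (Fin n) (Fin n) ℂ)ˣ) :
    LinearIndependent ℂ (X * (g : Matrix (Fin n) (Fin n) ℂ)).col := by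
  rw [← Matrix.mulVec_injective_iff] at hX ⊢
  intro v w hvw
  rw [← Matrix.mulVec_mulVec, ← Matrix.mulVec_mulVec] at hvw
  exact Matrix.mulVec_injective_of_isUnit g.isUnit (hX hvw)

theorem det_frame_mul (X : ℤ → Matrix (Fin m × Fin n) (Fin n) ℂ)
    (g : ℤ → Matrix (Fin n) (Fin n) ℂ) (k : ℤ) :
    (frame (fun j => X j * g j) k).det = (frame X k).det * ∏ i : Fin m, (g (k + (i : ℕ))).det := by
  -- The frame is multiplied on the right by a block diagonal matrix; `Matrix.blockDiagonal` puts
  -- the block index second, hence the swaps.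
  have : frame (fun j => X j * g j) k = frame X k *
      (Matrix.blockDiagonal fun i : Fin m => g (k + (i : ℕ))).submatrix Prod.swap Prod.swap := by
    ext r ⟨i, q⟩
    simp only [frame, Matrix.of_apply, Matrix.mul_apply, Fintype.sum_prod_type,
      Matrix.submatrix_apply, Prod.swap_prod_mk, Matrix.blockDiagonal_apply]
    rw [Finset.sum_eq_single i]
    · simp
    · intro j _ hj
      simp [hj]
    · simp
  have hs : ((Matrix.blockDiagonal fun i : Fin m => g (k + (i : ℕ))).submatrix Prod.swap
      Prod.swap).det = (Matrix.blockDiagonal fun i : Fin m => g (k + (i : ℕ))).det :=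
    Matrix.det_submatrix_equiv_self (Equiv.prodComm _ _) _
  rw [this, Matrix.det_mul, hs, Matrix.det_blockDiagonal]

theorem eq_of_periodic {α : Type*} [NeZero N] {f : ℤ → α} (h : ∀ k, f (k + N) = f k) {k l : ℤ}
    (hkl : (k : ZMod N) = l) : f k = f l := by
  have hp : Function.Periodic f (N : ℤ) := h
  obtain ⟨c, hc⟩ := (ZMod.intCast_eq_intCast_iff_dvd_sub k l N).1 hkl
  have : l = k + c * N := by linarith
  rw [this]
  exact (hp.int_mul c k).symm

end Lifts

/-! ### Coefficients of the recursion and their transformation -/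

section Coefficients

variable {m n N : ℕ}

theorem SatisfiesRecursion.eq_frame_mul {V : ℤ → Matrix (Fin m × Fin n) (Fin n) ℂ}
    {a : Coefficients m n N} (h : SatisfiesRecursion V a) (k : ℤ) :
    V (k + m) = frame V k * stack (a k) := by
  rw [h k, frame_mul_stack]

theorem satisfiesRecursion_iff {V : ℤ → Matrix (Fin m × Fin n) (Fin n) ℂ}
    {a : Coefficients m n N} :
    SatisfiesRecursion V a ↔ ∀ k : ℤ, V (k + m) = frame V k * stack (a k) := by
  simp only [SatisfiesRecursion, frame_mul_stack]

theorem frame_mul_cancel {V : ℤ → Matrix (Fin m × Fin n) (Fin n) ℂ} {k : ℤ}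
    (hV : (frame V k).det ≠ 0) {B B' : Fin m → Matrix (Fin n) (Fin n) ℂ}
    (h : frame V k * stack B = frame V k * stack B') : B = B' := by
  have hu : IsUnit (frame V k).det := isUnit_iff_ne_zero.2 hV
  apply stack_injective
  rw [← Matrix.nonsing_inv_mul_cancel_left (frame V k) (stack B) hu, h,
    Matrix.nonsing_inv_mul_cancel_left _ _ hu]

theorem SatisfiesRecursion.unique [NeZero N] {V : ℤ → Matrix (Fin m × Fin n) (Fin n) ℂ}
    {a a' : Coefficients m n N} (hV : ∀ k, (frame V k).det ≠ 0)
    (h : SatisfiesRecursion V a) (h' : SatisfiesRecursion V a') : a = a' := by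
  funext k
  obtain ⟨j, rfl⟩ := ZMod.intCast_surjective k
  exact frame_mul_cancel (hV j) (by rw [← h.eq_frame_mul, ← h'.eq_frame_mul])

/-- The coefficients of the recursion satisfied by a twisted lift. -/
noncomputable def TwistedLiftSpace.coeff (p : TwistedLiftSpace m n N) : Coefficients m n N :=
  fun k i => Matrix.of fun x y =>
    ((frame p.1.1 (k.val : ℤ))⁻¹ * p.1.1 ((k.val : ℤ) + m)) (i, x) y

theorem TwistedLiftSpace.frame_add_period (p : TwistedLiftSpace m n N) (k : ℤ) :
    frame p.1.1 (k + N) = (p.1.2 : Matrix (Fin m × Fin n) (Fin m × Fin n) ℂ) * frame p.1.1 k := by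
  rw [← frame_mul_left]
  ext r c
  have := p.2.2.1 (k + (c.1 : ℕ))
  simp only [frame, Matrix.of_apply]
  rw [← this]
  rw [show k + N + ((c.1 : ℕ) : ℤ) = k + (c.1 : ℕ) + N by ring]

theorem TwistedLiftSpace.recursion [NeZero N] (p : TwistedLiftSpace m n N) :
    SatisfiesRecursion p.1.1 p.coeff := by
  rw [satisfiesRecursion_iff]
  intro k
  have hper : ∀ k : ℤ, (frame p.1.1 (k + N))⁻¹ * p.1.1 (k + N + m) =
      (frame p.1.1 k)⁻¹ * p.1.1 (k + m) := by
    intro k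
    have hu : IsUnit (p.1.2 : Matrix (Fin m × Fin n) (Fin m × Fin n) ℂ).det := by simp
    rw [p.frame_add_period, show k + N + m = k + m + N by ring, p.2.2.1, Matrix.mul_inv_rev,
      Matrix.mul_assoc, Matrix.nonsing_inv_mul_cancel_left _ _ hu]
  have hs : stack (p.coeff (k : ZMod N)) = (frame p.1.1 k)⁻¹ * p.1.1 (k + m) := by
    have := eq_of_periodic (N := N) (f := fun k => (frame p.1.1 k)⁻¹ * p.1.1 (k + m)) hper (k := k)
      (l := (((k : ZMod N).val : ℕ) : ℤ)) (by simp)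
    rw [this]
    rfl
  rw [hs, Matrix.mul_nonsing_inv_cancel_left _ _ (isUnit_iff_ne_zero.2 (p.2.2.2 k))]

theorem TwistedLiftSpace.coeff_eq [NeZero N] {p : TwistedLiftSpace m n N} {a : Coefficients m n N}
    (h : SatisfiesRecursion p.1.1 a) : p.coeff = a :=
  p.recursion.unique p.2.2.2 h

theorem prod_range_zmod [NeZero N] {M : Type*} [CommMonoid M] (f : ZMod N → M) :
    ∏ i ∈ Finset.range N, f (i : ZMod N) = ∏ k : ZMod N, f k := by
  refine Finset.prod_bij' (fun i _ => (i : ZMod N)) (fun k _ => k.val) ?_ ?_ ?_ ?_ ?_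
  · simp
  · intro k _
    simpa using ZMod.val_lt k
  · intro i hi
    exact ZMod.val_cast_of_lt (Finset.mem_range.1 hi)
  · intro k _
    simp
  · simp

/-- As `m` is a unit modulo `N`, the multiples `0, m, …, (N-1)m` meet every residue class once. -/
theorem prod_range_step [NeZero N] (h : Nat.Coprime m N) {M : Type*} [CommMonoid M]
    (f : ZMod N → M) :
    ∏ i ∈ Finset.range N, f (((i * m : ℕ)) : ZMod N) = ∏ k : ZMod N, f k := by
  rw [← Equiv.prod_comp (Units.mulRight (ZMod.unitOfCoprime m h)) f, ← prod_range_zmod]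
  simp

/-- The relation `h_{k+i} a'_k^i = a_k^i h_{k+m}` between the coefficients of two lifts that
differ by a change of bases `h`. -/
def Intertwines (h : ℤ → (Matrix (Fin n) (Fin n) ℂ)ˣ) (a a' : Coefficients m n N) : Prop :=
  ∀ (k : ℤ) (i : Fin m), (h (k + (i : ℕ)) : Matrix (Fin n) (Fin n) ℂ) * a' (k : ZMod N) i =
    a (k : ZMod N) i * (h (k + m) : Matrix (Fin n) (Fin n) ℂ)

theorem Intertwines.refl (a : Coefficients m n N) : Intertwines 1 a a := fun k i => by simp

theorem Intertwines.trans {h h' : ℤ → (Matrix (Fin n) (Fin n) ℂ)ˣ} {a a' a'' : Coefficients m n N}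
    (H : Intertwines h a a') (H' : Intertwines h' a' a'') :
    Intertwines (fun k => h k * h' k) a a'' := fun k i => by
  rw [Units.val_mul, Units.val_mul, mul_assoc, H' k i, ← mul_assoc, H k i, mul_assoc]

theorem Intertwines.symm {h : ℤ → (Matrix (Fin n) (Fin n) ℂ)ˣ} {a a' : Coefficients m n N}
    (H : Intertwines h a a') : Intertwines (fun k => (h k)⁻¹) a' a := fun k i => by
  rw [Units.inv_mul_eq_iff_eq_mul, ← mul_assoc, H k i, mul_assoc, Units.mul_inv, mul_one]

theorem frame_mul_right (V : ℤ → Matrix (Fin m × Fin n) (Fin n) ℂ)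
    (h : ℤ → Matrix (Fin n) (Fin n) ℂ) (k : ℤ) (B : Fin m → Matrix (Fin n) (Fin n) ℂ) :
    frame (fun j => V j * h j) k * stack B = frame V k * stack fun i => h (k + (i : ℕ)) * B i := by
  simp [frame_mul_stack, Matrix.mul_assoc]

theorem mul_stack_mul (A : Matrix (Fin m × Fin n) (Fin m × Fin n) ℂ)
    (B : Fin m → Matrix (Fin n) (Fin n) ℂ)
    (g : Matrix (Fin n) (Fin n) ℂ) : A * stack B * g = A * stack fun i => B i * g := by
  rw [Matrix.mul_assoc]
  rfl

theorem SatisfiesRecursion.gauge {V : ℤ → Matrix (Fin m × Fin n) (Fin n) ℂ}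
    {a a' : Coefficients m n N} {h : ℤ → (Matrix (Fin n) (Fin n) ℂ)ˣ}
    (hV : SatisfiesRecursion V a) (H : Intertwines h a a') :
    SatisfiesRecursion (fun k => V k * (h k : Matrix (Fin n) (Fin n) ℂ)) a' := by
  rw [satisfiesRecursion_iff] at hV ⊢
  intro k
  rw [frame_mul_right V (fun k => (h k : Matrix (Fin n) (Fin n) ℂ)), hV k, mul_stack_mul]
  congr 2
  funext i
  exact (H k i).symm

theorem SatisfiesRecursion.intertwines {V : ℤ → Matrix (Fin m × Fin n) (Fin n) ℂ}
    {a a' : Coefficients m n N} {h : ℤ → (Matrix (Fin n) (Fin n) ℂ)ˣ}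
    (hd : ∀ k, (frame V k).det ≠ 0)
    (hV : SatisfiesRecursion V a)
    (hV' : SatisfiesRecursion (fun k => V k * (h k : Matrix (Fin n) (Fin n) ℂ)) a') :
    Intertwines h a a' := by
  rw [satisfiesRecursion_iff] at hV hV'
  intro k i
  have := hV' k
  rw [frame_mul_right V (fun k => (h k : Matrix (Fin n) (Fin n) ℂ)), hV k, mul_stack_mul] at this
  exact (congr_fun (frame_mul_cancel (hd k) this) i).symm

theorem SatisfiesRecursion.mul_left {V : ℤ → Matrix (Fin m × Fin n) (Fin n) ℂ}
    {a : Coefficients m n N} (hV : SatisfiesRecursion V a)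
    (M : Matrix (Fin m × Fin n) (Fin m × Fin n) ℂ) :
    SatisfiesRecursion (fun k => M * V k) a := by
  rw [satisfiesRecursion_iff] at hV ⊢
  intro k
  rw [frame_mul_left, Matrix.mul_assoc, hV k]

end Coefficients

/-! ### Equivalence of polygons in terms of coefficients -/

section Moduli

variable {μ n N : ℕ}

theorem SatisfiesRecursion.frame_add_one {V : ℤ → Matrix (Fin (μ + 1) × Fin n) (Fin n) ℂ}
    {a : Coefficients (μ + 1) n N} (hV : SatisfiesRecursion V a) (k : ℤ) :
    frame V (k + 1) = frame V k * companion (a k) :=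
  _root_.frame_add_one V k _ (hV k)

theorem frame_zero_block (V : ℤ → Matrix (Fin (μ + 1) × Fin n) (Fin n) ℂ) (k : ℤ) :
    V k = Matrix.of fun r q => frame V k r (0, q) := by
  ext r q
  simp [frame]

/-- Both sequences of frames are transported by the same companion matrices, so they differ by a
constant left factor. The backward induction uses that the companion matrices are invertible, which
follows from the invertible frames of `V`. -/
theorem eq_mul_of_recursion {V W : ℤ → Matrix (Fin (μ + 1) × Fin n) (Fin n) ℂ}
    {a : Coefficients (μ + 1) n N} (hV : SatisfiesRecursion V a) (hW : SatisfiesRecursion W a)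
    (hd : ∀ k, (frame V k).det ≠ 0) (k : ℤ) :
    W k = frame W 0 * (frame V 0)⁻¹ * V k := by
  have hC : ∀ k : ℤ, IsUnit (companion (a k)).det := by
    intro k
    have := hd (k + 1)
    rw [hV.frame_add_one, Matrix.det_mul] at this
    exact isUnit_iff_ne_zero.2 (right_ne_zero_of_mul this)
  have key : ∀ k : ℤ, frame W k = frame W 0 * (frame V 0)⁻¹ * frame V k := by
    intro k
    induction k using Int.induction_on with
    | zero => rw [Matrix.nonsing_inv_mul_cancel_right _ _ (isUnit_iff_ne_zero.2 (hd 0))]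
    | succ i ih => rw [hV.frame_add_one, hW.frame_add_one, ih, Matrix.mul_assoc _ _ (companion _)]
    | pred i ih =>
      have h1 := hV.frame_add_one (-(i : ℤ) - 1)
      have h2 := hW.frame_add_one (-(i : ℤ) - 1)
      rw [sub_add_cancel] at h1 h2
      rw [h1, h2, ← Matrix.mul_assoc] at ih
      rw [← Matrix.mul_nonsing_inv_cancel_right _ (frame W _) (hC (-(i : ℤ) - 1)), ih,
        Matrix.mul_nonsing_inv_cancel_right _ _ (hC (-(i : ℤ) - 1))]
  have h := key k
  rw [← frame_mul_left] at h
  rw [frame_zero_block W k, h, ← frame_zero_block (fun j => frame W 0 * (frame V 0)⁻¹ * V j) k]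

theorem SatisfiesRecursion.det_frame_add_one
    {V : ℤ → Matrix (Fin (μ + 1) × Fin n) (Fin n) ℂ}
    {a : Coefficients (μ + 1) n N} (hV : SatisfiesRecursion V a) (k : ℤ) :
    (frame V (k + 1)).det = (frame V k).det * ((-1) ^ (n * μ) * (a k 0).det) := by
  rw [hV.frame_add_one, Matrix.det_mul, det_companion]

/-- The determinants of the frames telescope over one period, and the monodromy has determinant one.
This is the constraint that every twisted lift puts on its coefficients. -/
theorem TwistedLiftSpace.prod_det_coeff [NeZero N] (p : TwistedLiftSpace (μ + 1) n N) :
    ∏ k : ZMod N, ((-1) ^ (n * μ) * (p.coeff k 0).det) = 1 := by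
  have key : ∀ j : ℕ, (frame p.1.1 j).det = (frame p.1.1 0).det *
      ∏ i ∈ Finset.range j, ((-1) ^ (n * μ) * (p.coeff (i : ZMod N) 0).det) := by
    intro j
    induction j with
    | zero => simp
    | succ j ih =>
      rw [Finset.prod_range_succ, ← mul_assoc, ← ih, Nat.cast_succ,
        p.recursion.det_frame_add_one]
      simp
  have hN := key N
  rw [prod_range_zmod fun k => ((-1) ^ (n * μ) * (p.coeff k 0).det)] at hN
  have h0 := p.frame_add_period 0
  rw [zero_add] at h0
  rw [h0, Matrix.det_mul, Matrix.SpecialLinearGroup.det_coe, one_mul] at hN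
  exact (mul_eq_left₀ (p.2.2.2 0)).1 hN.symm

theorem exists_pow_mul_eq_one {d : ℕ} (hd : d ≠ 0) {x : ℂ} (hx : x ≠ 0) :
    ∃ c : ℂ, c ≠ 0 ∧ c ^ d * x = 1 := by
  obtain ⟨c, hc⟩ := IsAlgClosed.exists_pow_nat_eq x⁻¹ (Nat.pos_of_ne_zero hd)
  refine ⟨c, ?_, by rw [hc, inv_mul_cancel₀ hx]⟩
  rintro rfl
  rw [zero_pow hd] at hc
  exact inv_ne_zero hx hc.symm

theorem colSpan_smul {m : ℕ} {c : ℂ} (hc : c ≠ 0) (X : Matrix (Fin m × Fin n) (Fin n) ℂ) :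
    colSpan (c • X) = colSpan X := by
  have := colSpan_mul_unit X (Units.mk0 c hc • 1)
  simpa [Units.smul_def] using this

theorem toModuli_eq_iff_polygon {m : ℕ} {p q : TwistedLiftSpace m n N} :
    p.toModuli = q.toModuli ↔
      ∃ g : SLmn m n, ∀ k, colSpan (q.1.1 k) = actSubspace g (colSpan (p.1.1 k)) :=
  ⟨fun h => Quotient.exact h, fun h => Quotient.sound h⟩

/-- After the change of bases `h` the two lifts have the same coefficients, hence differ by a
constant invertible matrix. Scaling it into `SL(mn)` does not alter the subspaces. No periodicity of
`h` is needed. -/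
theorem toModuli_eq_of_intertwines [NeZero n] [NeZero N] {p q : TwistedLiftSpace (μ + 1) n N}
    {h : ℤ → (Matrix (Fin n) (Fin n) ℂ)ˣ} (H : Intertwines h p.coeff q.coeff) :
    p.toModuli = q.toModuli := by
  rw [toModuli_eq_iff_polygon]
  set X : ℤ → Matrix (Fin (μ + 1) × Fin n) (Fin n) ℂ :=
    fun k => p.1.1 k * (h k : Matrix (Fin n) (Fin n) ℂ)
  have hX : SatisfiesRecursion X q.coeff := p.recursion.gauge H
  have hd : ∀ k, (frame X k).det ≠ 0 := by
    intro k
    rw [det_frame_mul p.1.1 (fun k => (h k : Matrix (Fin n) (Fin n) ℂ))]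
    refine mul_ne_zero (p.2.2.2 k) (Finset.prod_ne_zero_iff.2 fun i _ => ?_)
    exact isUnit_iff_ne_zero.1 ((Matrix.isUnit_iff_isUnit_det _).1 (h _).isUnit)
  set G := frame q.1.1 0 * (frame X 0)⁻¹
  have hG : G.det ≠ 0 := by
    rw [Matrix.det_mul, Matrix.det_nonsing_inv, Ring.inverse_eq_inv']
    exact mul_ne_zero (q.2.2.2 0) (inv_ne_zero (hd 0))
  obtain ⟨c, hc, hcd⟩ := exists_pow_mul_eq_one (d := (μ + 1) * n) (NeZero.ne _) hG
  obtain ⟨g, hg⟩ : ∃ g : SLmn (μ + 1) n,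
      (g : Matrix (Fin (μ + 1) × Fin n) (Fin (μ + 1) × Fin n) ℂ) = c • G :=
    ⟨⟨c • G, by simpa [Matrix.det_smul] using hcd⟩, rfl⟩
  refine ⟨g, fun k => ?_⟩
  rw [← colSpan_mul, hg, eq_mul_of_recursion hX q.recursion hd k]
  simp only [Matrix.smul_mul, X]
  rw [colSpan_smul hc, ← Matrix.mul_assoc, colSpan_mul_unit]

/-- The converse direction. The family `h` need not be periodic, because `g` need not carry the
monodromy of `p` to that of `q`. -/
theorem exists_intertwines [NeZero N] {p q : TwistedLiftSpace (μ + 1) n N}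
    (H : p.toModuli = q.toModuli) : ∃ (g : SLmn (μ + 1) n) (h : ℤ → (Matrix (Fin n) (Fin n) ℂ)ˣ),
      (∀ k, q.1.1 k = (g : Matrix (Fin (μ + 1) × Fin n) (Fin (μ + 1) × Fin n) ℂ) * p.1.1 k *
        (h k : Matrix (Fin n) (Fin n) ℂ)) ∧ Intertwines h p.coeff q.coeff := by
  obtain ⟨g, hg⟩ := toModuli_eq_iff_polygon.1 H
  have hind : ∀ k, LinearIndependent ℂ
      ((g : Matrix (Fin (μ + 1) × Fin n) (Fin (μ + 1) × Fin n) ℂ) * p.1.1 k).col := by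
    intro k
    refine linearIndependent_col_of_frame
      (X := fun k => (g : Matrix (Fin (μ + 1) × Fin n) (Fin (μ + 1) × Fin n) ℂ) * p.1.1 k)
      (k := k) ?_
    rw [frame_mul_left, Matrix.det_mul, Matrix.SpecialLinearGroup.det_coe, one_mul]
    exact p.2.2.2 k
  have : ∀ k, ∃ h : (Matrix (Fin n) (Fin n) ℂ)ˣ,
      q.1.1 k = (g : Matrix (Fin (μ + 1) × Fin n) (Fin (μ + 1) × Fin n) ℂ) * p.1.1 k *
        (h : Matrix (Fin n) (Fin n) ℂ) := by
    intro k
    refine exists_unit_of_colSpan_eq (hind k) (q.2.1 k) ?_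
    rw [hg, colSpan_mul]
  choose h hh using this
  refine ⟨g, h, hh, ?_⟩
  refine SatisfiesRecursion.intertwines
    (V := fun k => (g : Matrix (Fin (μ + 1) × Fin n) (Fin (μ + 1) × Fin n) ℂ) * p.1.1 k) ?_
    (p.recursion.mul_left _) ?_
  · intro k
    rw [frame_mul_left, Matrix.det_mul, Matrix.SpecialLinearGroup.det_coe, one_mul]
    exact p.2.2.2 k
  · simp_rw [← hh]
    exact q.recursion

end Moduli

/-! ### Reconstruction of a lift from its coefficients -/

section Sections

variable {μ n N : ℕ}

/-- The sequence `ρ` in a group with `ρ_0 = 1` and `ρ_{k+1} = ρ_k C_k`. -/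
def transport {G : Type*} [Group G] (C : ℤ → G) : ℤ → G
  | Int.ofNat j => Nat.rec 1 (fun i g => g * C i) j
  | Int.negSucc j => Nat.rec (C (-1))⁻¹ (fun i g => g * (C (-(i + 2 : ℕ)))⁻¹) j

theorem transport_zero {G : Type*} [Group G] (C : ℤ → G) : transport C 0 = 1 := rfl

theorem transport_add_one {G : Type*} [Group G] (C : ℤ → G) (k : ℤ) :
    transport C (k + 1) = transport C k * C k := by
  rcases k with j | j
  · rfl
  · rcases j with _ | j
    · change 1 = (C (-1))⁻¹ * C (-1)
      rw [inv_mul_cancel]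
    · have : Int.negSucc (j + 1) + 1 = Int.negSucc j := by omega
      rw [this]
      change transport C (Int.negSucc j) = transport C (Int.negSucc j) * (C (-(j + 2 : ℕ)))⁻¹ *
        C (Int.negSucc (j + 1))
      rw [show Int.negSucc (j + 1) = -((j + 2 : ℕ) : ℤ) by omega, inv_mul_cancel_right]

theorem continuous_transport {G Y : Type*} [Group G] [TopologicalSpace G] [IsTopologicalGroup G]
    [TopologicalSpace Y] {C : Y → ℤ → G} (hC : ∀ k, Continuous fun y => C y k) (k : ℤ) :
    Continuous fun y => transport (C y) k := by
  rcases k with j | j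
  · induction j with
    | zero => exact continuous_const
    | succ j ih => exact ih.mul (hC j)
  · induction j with
    | zero => exact (hC (-1)).inv
    | succ j ih => exact ih.mul (hC _).inv

theorem transport_add_period {G : Type*} [Group G] {C : ℤ → G} {N : ℤ} (h : ∀ k, C (k + N) = C k)
    (k : ℤ) : transport C (k + N) = transport C N * transport C k := by
  induction k using Int.induction_on with
  | zero => rw [zero_add, transport_zero, mul_one]
  | succ i ih =>
    rw [show (i : ℤ) + 1 + N = i + N + 1 by ring, transport_add_one, transport_add_one, ih, h,
      mul_assoc]
  | pred i ih =>
    have h1 := transport_add_one C (-(i : ℤ) - 1 + N)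
    have h2 := transport_add_one C (-(i : ℤ) - 1)
    rw [h, show -(i : ℤ) - 1 + N + 1 = -(i : ℤ) + N by ring, ih] at h1
    rw [sub_add_cancel] at h2
    rw [h2, ← mul_assoc] at h1
    exact (mul_right_cancel h1).symm

/-- The families of coefficients of the lifts all of whose frames have the same determinant. -/
abbrev UnimodularCoefficients (μ n N : ℕ) : Type :=
  {a : Coefficients (μ + 1) n N // ∀ k, (a k 0).det = (-1) ^ (n * μ)}

/-- The companion matrices, as elements of `SL`. -/
def UnimodularCoefficients.companion (a : UnimodularCoefficients μ n N) (k : ℤ) :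
    SLmn (μ + 1) n :=
  ⟨_root_.companion (a.1 k), by rw [det_companion, a.2, neg_one_pow_mul_neg_one_pow]⟩

theorem UnimodularCoefficients.companion_add_period (a : UnimodularCoefficients μ n N) (k : ℤ) :
    a.companion (k + N) = a.companion k :=
  Subtype.ext (by simp [companion])

theorem UnimodularCoefficients.continuous_companion (k : ℤ) :
    Continuous fun a : UnimodularCoefficients μ n N => a.companion k := by
  refine continuous_induced_rng.2 (continuous_matrix fun x y => ?_)
  obtain ⟨j, q⟩ := y
  induction j using Fin.lastCases with
  | last =>
    change Continuous fun a : UnimodularCoefficients μ n N =>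
      _root_.companion (a.1 k) x (Fin.last μ, q)
    simp only [companion_last]
    exact ((continuous_apply_apply (k : ZMod N) x.1).comp continuous_subtype_val).matrix_elem _ _
  | cast j =>
    change Continuous fun a : UnimodularCoefficients μ n N =>
      _root_.companion (a.1 k) x (j.castSucc, q)
    simp only [companion_castSucc]
    exact continuous_const

/-- The frames of the lift with given coefficients whose frame at `0` is the identity. -/
def UnimodularCoefficients.rho (a : UnimodularCoefficients μ n N) (k : ℤ) : SLmn (μ + 1) n :=
  transport a.companion k

/-- The lift with given coefficients whose frame at `0` is the identity. -/
def UnimodularCoefficients.vec (a : UnimodularCoefficients μ n N) (k : ℤ) :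
    Matrix (Fin (μ + 1) × Fin n) (Fin n) ℂ :=
  Matrix.of fun r q =>
    (a.rho k : Matrix (Fin (μ + 1) × Fin n) (Fin (μ + 1) × Fin n) ℂ) r (0, q)

theorem UnimodularCoefficients.rho_add_one (a : UnimodularCoefficients μ n N) (k : ℤ) :
    (a.rho (k + 1) : Matrix (Fin (μ + 1) × Fin n) (Fin (μ + 1) × Fin n) ℂ) =
      (a.rho k : Matrix (Fin (μ + 1) × Fin n) (Fin (μ + 1) × Fin n) ℂ) *
        _root_.companion (a.1 k) := by
  rw [rho, transport_add_one]
  rfl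

/-- A companion matrix shifts the block columns, so the first block column of `ρ_{k+i}` is the
`i`-th one of `ρ_k`. -/
theorem UnimodularCoefficients.frame_vec (a : UnimodularCoefficients μ n N) (k : ℤ) :
    frame a.vec k = a.rho k := by
  have key : ∀ (i : ℕ) (hi : i < μ + 1) (k : ℤ) (r : Fin (μ + 1) × Fin n) (q : Fin n),
      (a.rho (k + i) : Matrix (Fin (μ + 1) × Fin n) (Fin (μ + 1) × Fin n) ℂ) r (0, q) =
      (a.rho k : Matrix (Fin (μ + 1) × Fin n) (Fin (μ + 1) × Fin n) ℂ) r (⟨i, hi⟩, q) := by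
    intro i
    induction i with
    | zero => intro hi k r q; simp
    | succ i ih =>
      intro hi k r q
      have := ih (by omega) (k + 1) r q
      rw [show k + ((i + 1 : ℕ) : ℤ) = k + 1 + i by push_cast; ring, this, rho_add_one]
      exact mul_companion_castSucc _ _ r ⟨i, by omega⟩ q
  ext r ⟨⟨i, hi⟩, q⟩
  exact key i hi k r q

theorem UnimodularCoefficients.recursion_vec (a : UnimodularCoefficients μ n N) :
    SatisfiesRecursion a.vec a.1 := by
  rw [satisfiesRecursion_iff]
  intro k
  ext r q
  rw [frame_vec, ← mul_companion_last, ← rho_add_one, ← frame_vec]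
  simp only [frame, Matrix.of_apply, Fin.val_last]
  rw [show k + 1 + (μ : ℤ) = k + ((μ + 1 : ℕ) : ℤ) by push_cast; ring]

/-- The twisted lift with given coefficients whose frame at `0` is the identity. -/
def UnimodularCoefficients.toLift (a : UnimodularCoefficients μ n N) :
    TwistedLiftSpace (μ + 1) n N :=
  ⟨(a.vec, a.rho N), by
    have hd : ∀ k, (frame a.vec k).det ≠ 0 := fun k => by
      rw [a.frame_vec, Matrix.SpecialLinearGroup.det_coe]
      exact one_ne_zero
    refine ⟨fun k => linearIndependent_col_of_frame (hd k), fun k => ?_, hd⟩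
    have h : a.rho (k + N) = a.rho N * a.rho k :=
      transport_add_period a.companion_add_period k
    ext r q
    have h2 : (a.rho (k + N) : Matrix (Fin (μ + 1) × Fin n) (Fin (μ + 1) × Fin n) ℂ) =
        (a.rho N : Matrix (Fin (μ + 1) × Fin n) (Fin (μ + 1) × Fin n) ℂ) *
          (a.rho k : Matrix (Fin (μ + 1) × Fin n) (Fin (μ + 1) × Fin n) ℂ) := by
      rw [h, Matrix.SpecialLinearGroup.coe_mul]
    exact congr_fun (congr_fun h2 r) (0, q)⟩

/-- Lifts depending continuously on the coefficients make the class a continuous function of the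
coefficients. Both the continuity of the inverse charts and the density argument rest on this. -/
theorem UnimodularCoefficients.continuous_toLift :
    Continuous (toLift : UnimodularCoefficients μ n N → TwistedLiftSpace (μ + 1) n N) := by
  have hr : ∀ k, Continuous fun a : UnimodularCoefficients μ n N => a.rho k := fun k =>
    continuous_transport continuous_companion k
  refine Continuous.subtype_mk (Continuous.prodMk (continuous_pi fun k => ?_) (hr N)) _
  refine continuous_matrix fun r q => ?_
  exact ((continuous_induced_dom.comp (hr k)).matrix_elem r (0, q))

theorem UnimodularCoefficients.coeff_toLift [NeZero N] (a : UnimodularCoefficients μ n N) :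
    a.toLift.coeff = a.1 :=
  TwistedLiftSpace.coeff_eq a.recursion_vec

theorem continuous_frame {m : ℕ} (k : ℤ) :
    Continuous fun p : TwistedLiftSpace m n N => frame p.1.1 k := by
  refine continuous_matrix fun r c => ?_
  exact ((continuous_apply (k + (c.1 : ℕ))).comp
    (continuous_fst.comp continuous_subtype_val)).matrix_elem r c.2

theorem TwistedLiftSpace.continuous_coeff {m : ℕ} :
    Continuous (coeff : TwistedLiftSpace m n N → Coefficients m n N) := by
  refine continuous_pi fun k => continuous_pi fun i => continuous_matrix fun x y => ?_
  have h1 : Continuous fun p : TwistedLiftSpace m n N => (frame p.1.1 (k.val : ℤ))⁻¹ := by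
    simp only [Matrix.inv_def, Ring.inverse_eq_inv']
    exact ((continuous_frame _).matrix_det.inv₀ fun p => p.2.2.2 _).smul
      (continuous_frame _).matrix_adjugate
  have h2 : Continuous fun p : TwistedLiftSpace m n N => p.1.1 ((k.val : ℤ) + m) :=
    (continuous_apply _).comp (continuous_fst.comp continuous_subtype_val)
  exact (h1.matrix_mul h2).matrix_elem (i, x) y

theorem continuous_toModuli {m : ℕ} :
    Continuous (TwistedLiftSpace.toModuli (m := m) (n := n) (N := N)) :=
  continuous_coinduced_rng

/-- The class in the moduli space of the lifts with given coefficients. -/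
def UnimodularCoefficients.toModuli (a : UnimodularCoefficients μ n N) :
    ModuliSpace (μ + 1) n N :=
  a.toLift.toModuli

theorem UnimodularCoefficients.continuous_toModuli :
    Continuous (toModuli : UnimodularCoefficients μ n N → ModuliSpace (μ + 1) n N) :=
  _root_.continuous_toModuli.comp continuous_toLift

theorem UnimodularCoefficients.toModuli_eq_of_intertwines [NeZero n] [NeZero N]
    {a : UnimodularCoefficients μ n N} {p : TwistedLiftSpace (μ + 1) n N}
    {h : ℤ → (Matrix (Fin n) (Fin n) ℂ)ˣ} (H : Intertwines h p.coeff a.1) :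
    p.toModuli = a.toModuli :=
  _root_.toModuli_eq_of_intertwines (h := h) (by rwa [a.coeff_toLift])

end Sections

/-! ### Smoothness of matrix operations and of the coefficients -/

section Smoothness

attribute [local instance] Matrix.normedAddCommGroup Matrix.normedSpace

variable {E : Type*} [NormedAddCommGroup E] [NormedSpace ℂ E]
variable {ι κ l : Type*} [Fintype ι] [Fintype κ] [Fintype l]

theorem contDiff_matrix {f : E → Matrix ι κ ℂ} {r : WithTop ℕ∞} :
    ContDiff ℂ r f ↔ ∀ i j, ContDiff ℂ r fun x => f x i j := by
  refine (contDiff_pi (𝕜 := ℂ) (F' := fun _ : ι => κ → ℂ)).trans ?_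
  exact forall_congr' fun i => contDiff_pi (𝕜 := ℂ) (F' := fun _ : κ => ℂ)

theorem differentiableAt_matrix {f : E → Matrix ι κ ℂ} {x : E} :
    DifferentiableAt ℂ f x ↔ ∀ i j, DifferentiableAt ℂ (fun x => f x i j) x := by
  refine (differentiableAt_pi (𝕜 := ℂ) (F' := fun _ : ι => κ → ℂ)).trans ?_
  exact forall_congr' fun i => differentiableAt_pi (𝕜 := ℂ) (F' := fun _ : κ => ℂ)

theorem contDiff_matrix_mul {r : WithTop ℕ∞} :
    ContDiff ℂ r fun p : Matrix ι κ ℂ × Matrix κ l ℂ => p.1 * p.2 := by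
  refine contDiff_matrix.2 fun i j => ?_
  simp only [Matrix.mul_apply]
  refine ContDiff.sum fun k _ => ?_
  exact (contDiff_matrix.1 contDiff_fst i k).mul (contDiff_matrix.1 contDiff_snd k j)

theorem ContDiff.matrix_mul {r : WithTop ℕ∞} {f : E → Matrix ι κ ℂ} {g : E → Matrix κ l ℂ}
    (hf : ContDiff ℂ r f) (hg : ContDiff ℂ r g) : ContDiff ℂ r fun x => f x * g x :=
  contDiff_matrix_mul.comp (hf.prodMk hg)

theorem DifferentiableAt.matrix_mul {x : E} {f : E → Matrix ι κ ℂ} {g : E → Matrix κ l ℂ}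
    (hf : DifferentiableAt ℂ f x) (hg : DifferentiableAt ℂ g x) :
    DifferentiableAt ℂ (fun x => f x * g x) x :=
  ((contDiff_matrix_mul (r := 1)).differentiable one_ne_zero _).comp x (hf.prodMk hg)

variable [DecidableEq ι]

theorem contDiff_det {r : WithTop ℕ∞} : ContDiff ℂ r fun A : Matrix ι ι ℂ => A.det := by
  simp only [Matrix.det_apply]
  refine ContDiff.sum fun σ _ => ContDiff.const_smul _ (contDiff_prod fun i _ => ?_)
  exact contDiff_matrix.1 contDiff_id _ _

theorem contDiff_adjugate {r : WithTop ℕ∞} :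
    ContDiff ℂ r fun A : Matrix ι ι ℂ => A.adjugate := by
  refine contDiff_matrix.2 fun i j => ?_
  simp only [Matrix.adjugate_apply]
  refine contDiff_det.comp (contDiff_matrix.2 fun k l => ?_)
  by_cases h : k = j
  · subst h
    simpa using contDiff_const
  · simpa [h] using contDiff_matrix.1 contDiff_id k l

theorem DifferentiableAt.matrix_det {x : E} {f : E → Matrix ι ι ℂ} (hf : DifferentiableAt ℂ f x) :
    DifferentiableAt ℂ (fun x => (f x).det) x :=
  ((contDiff_det (r := 1)).differentiable one_ne_zero _).comp x hf

theorem DifferentiableAt.matrix_adjugate {x : E} {f : E → Matrix ι ι ℂ}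
    (hf : DifferentiableAt ℂ f x) : DifferentiableAt ℂ (fun x => (f x).adjugate) x :=
  ((contDiff_adjugate (r := 1)).differentiable one_ne_zero _).comp x hf

theorem DifferentiableAt.matrix_inv {x : E} {f : E → Matrix ι ι ℂ}
    (hf : DifferentiableAt ℂ f x) (h0 : (f x).det ≠ 0) :
    DifferentiableAt ℂ (fun x => (f x)⁻¹) x := by
  simp only [Matrix.inv_def, Ring.inverse_eq_inv']
  exact (hf.matrix_det.inv h0).smul hf.matrix_adjugate

theorem DifferentiableAt.coeff {m n N : ℕ} {x : E} {F : E → TwistedLiftSpace m n N}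
    (hF : ∀ (k : ℤ) (r : Fin m × Fin n) (q : Fin n), DifferentiableAt ℂ (fun z => (F z).1.1 k r q) x) :
    DifferentiableAt ℂ (fun z => (F z).coeff) x := by
  refine differentiableAt_pi.2 fun k => differentiableAt_pi.2 fun i =>
    differentiableAt_matrix.2 fun p q => ?_
  have h1 : DifferentiableAt ℂ (fun z => frame (F z).1.1 (k.val : ℤ)) x :=
    differentiableAt_matrix.2 fun r c => hF _ r c.2
  have h2 : DifferentiableAt ℂ (fun z => (F z).1.1 ((k.val : ℤ) + m)) x :=
    differentiableAt_matrix.2 fun r c => hF _ r c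
  exact differentiableAt_matrix.1 ((h1.matrix_inv ((F x).2.2.2 _)).matrix_mul h2) (i, p) q

end Smoothness

/-! ### The cycle `k ↦ k + m` modulo `N` -/

section Cycles

variable {N : ℕ} [NeZero N]

/-- The index `j < N` such that `k = j m` modulo `N`, for `m` prime to `N`. -/
def cycleIndex (m : ℕ) (k : ZMod N) : ℕ := (k * (m : ZMod N)⁻¹).val

theorem cycleIndex_lt (m : ℕ) (k : ZMod N) : cycleIndex m k < N := ZMod.val_lt _

theorem cycleIndex_zero (m : ℕ) : cycleIndex m (0 : ZMod N) = 0 := by simp [cycleIndex]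

theorem cycleIndex_mul {m : ℕ} (h : Nat.Coprime m N) (k : ZMod N) :
    ((cycleIndex m k * m : ℕ) : ZMod N) = k := by
  rw [cycleIndex, Nat.cast_mul, ZMod.natCast_zmod_val, mul_assoc, mul_comm _ (m : ZMod N),
    ZMod.coe_mul_inv_eq_one m h, mul_one]

/-- The index of `k + m` is one more than that of `k`, except when it wraps from `N - 1` to `0`;
there `y N = y 0` is used. -/
theorem apply_cycleIndex_add {m : ℕ} (h : Nat.Coprime m N) {X : Type*} {y : ℕ → X}
    (hy : y N = y 0) (k : ZMod N) :
    y (cycleIndex m (k + (m : ZMod N))) = y (cycleIndex m k + 1) := by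
  have h1 : cycleIndex m (k + (m : ZMod N)) = (cycleIndex m k + 1) % N := by
    rw [cycleIndex, add_mul, ZMod.coe_mul_inv_eq_one m h, ZMod.val_add, ZMod.val_one_eq_one_mod,
      Nat.add_mod_mod, cycleIndex]
  rw [h1]
  rcases (Nat.succ_le_of_lt (cycleIndex_lt m k)).lt_or_eq with h2 | h2
  · rw [Nat.mod_eq_of_lt h2]
  · rw [← Nat.succ_eq_add_one, h2, Nat.mod_self, hy]

/-- A recursion in steps of `m` on `ℤ/N` runs along one cycle of length `N`, so its solution is
fixed by the value at `0` and the only obstruction is that it closes up. -/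
theorem exists_of_cycle {m : ℕ} (h : Nat.Coprime m N) {X : Type*} {F : ZMod N → X → X} {y : ℕ → X}
    (hy : ∀ j : ℕ, y (j + 1) = F ((j * m : ℕ) : ZMod N) (y j)) (hN : y N = y 0) :
    ∃ x : ZMod N → X, x 0 = y 0 ∧ ∀ k, x (k + m) = F k (x k) :=
  ⟨fun k => y (cycleIndex m k), by simp only [cycleIndex_zero], fun k => by
    change y (cycleIndex m (k + (m : ZMod N))) = F k (y (cycleIndex m k))
    rw [apply_cycleIndex_add h hN, hy, cycleIndex_mul h]⟩

theorem natCast_mul_ne_zero {m : ℕ} (h : Nat.Coprime m N) {j : ℕ} (h0 : j ≠ 0) (hj : j < N) :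
    ((j * m : ℕ) : ZMod N) ≠ 0 := by
  rw [Ne, ZMod.natCast_eq_zero_iff]
  intro hd
  exact h0 (Nat.eq_zero_of_dvd_of_lt (h.symm.dvd_of_dvd_mul_right hd) hj)

theorem eq_of_add_one {X : Type*} {f : ZMod N → X} (h : ∀ k, f (k + 1) = f k) (k : ZMod N) :
    f k = f 0 := by
  have : ∀ j : ℕ, f (j : ZMod N) = f 0 := by
    intro j
    induction j with
    | zero => simp
    | succ j ih => rw [Nat.cast_succ, h, ih]
  rw [← ZMod.natCast_zmod_val k, this]

theorem prod_fin_add_one {M : Type*} [CommMonoid M] {m : ℕ} (u : ZMod N → M) (k : ZMod N) :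
    (∏ i : Fin m, u (k + 1 + (i : ℕ))) * u k = (∏ i : Fin m, u (k + (i : ℕ))) * u (k + m) := by
  rw [Fin.prod_univ_eq_prod_range (fun i => u (k + 1 + (i : ℕ))),
    Fin.prod_univ_eq_prod_range (fun i => u (k + (i : ℕ))),
    ← Finset.prod_range_succ (fun i => u (k + (i : ℕ))), Finset.prod_range_succ']
  simp only [Nat.cast_zero, add_zero, Nat.cast_add, Nat.cast_one]
  simp only [add_assoc, add_comm (1 : ZMod N)]

/-- The cyclic system `u_k u_{k+1} ⋯ u_{k+m-1} = c / d_k` can be solved when `m` is prime to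
`N`. -/
theorem exists_cyclic_system {m : ℕ} (h : Nat.Coprime m N) {G : Type*} [CommGroup G]
    (d : ZMod N → G) :
    ∃ (u : ZMod N → G) (c : G), ∀ k, d k * ∏ i : Fin m, u (k + (i : ℕ)) = c := by
  -- Dividing consecutive equations gives `u_{k+m} = u_k d_k / d_{k+1}`. The cycle closes because
  -- the product of all the `d_k / d_{k+1}` is one.
  obtain ⟨u, -, hu⟩ := exists_of_cycle h (F := fun k x => x * (d k / d (k + 1)))
    (y := fun j => ∏ i ∈ Finset.range j,
      (d ((i * m : ℕ) : ZMod N) / d (((i * m : ℕ) : ZMod N) + 1)))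
    (fun j => Finset.prod_range_succ _ _) (by
      rw [prod_range_step h fun k => d k / d (k + 1), Finset.prod_div_distrib]
      have := Equiv.prod_comp (Equiv.addRight (1 : ZMod N)) d
      simp only [Equiv.coe_addRight] at this
      rw [this]
      simp)
  refine ⟨u, _, fun k => eq_of_add_one (f := fun k => d k * ∏ i : Fin m, u (k + (i : ℕ)))
    (fun k => ?_) k⟩
  have := prod_fin_add_one (m := m) u k
  rw [hu, mul_left_comm, mul_comm _ (u k)] at this
  rw [mul_left_cancel this, mul_left_comm, mul_div_cancel, mul_comm]

end Cycles

/-! ### Twisted lifts with prescribed monodromy and unit determinants -/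

section Lifts

variable {m n N : ℕ}

theorem det_frame_smul (X : ℤ → Matrix (Fin m × Fin n) (Fin n) ℂ) (c : ℤ → ℂ) (k : ℤ) :
    (frame (fun j => c j • X j) k).det =
      (frame X k).det * ∏ i : Fin m, c (k + (i : ℕ)) ^ n := by
  have := det_frame_mul X (fun j => c j • (1 : Matrix (Fin n) (Fin n) ℂ)) k
  simpa [Matrix.det_smul] using this

/-- Scaling the bases multiplies the frame determinants by products of `m` consecutive `n`-th
powers. The cyclic system makes all of them equal, and a common factor `s` with `s ^ (n * m)`
prescribed makes them one. -/
theorem TwistedLiftSpace.exists_scalars [NeZero N] [NeZero m] [NeZero n] (h : Nat.Coprime m N)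
    (p : TwistedLiftSpace m n N) :
    ∃ c : ZMod N → ℂˣ, ∀ k : ℤ, (frame (fun j => (c j : ℂ) • p.1.1 j) k).det = 1 := by
  have hper : ∀ k, (frame p.1.1 (k + N)).det = (frame p.1.1 k).det := fun k => by
    rw [p.frame_add_period, Matrix.det_mul, Matrix.SpecialLinearGroup.det_coe, one_mul]
  obtain ⟨u, C, hu⟩ := exists_cyclic_system h
    (fun k : ZMod N => Units.mk0 _ (p.2.2.2 (k.val : ℤ)))
  have hroot : ∀ k : ZMod N, ∃ v : ℂ, v ^ n = u k := fun k =>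
    IsAlgClosed.exists_pow_nat_eq _ (Nat.pos_of_ne_zero (NeZero.ne n))
  choose v hv using hroot
  obtain ⟨s, hs0, hs⟩ := exists_pow_mul_eq_one (d := n * m) (NeZero.ne _) C.ne_zero
  have hv0 : ∀ k, v k ≠ 0 := fun k h0 => by
    have := hv k
    rw [h0, zero_pow (NeZero.ne n)] at this
    exact (u k).ne_zero this.symm
  refine ⟨fun k => Units.mk0 (s * v k) (mul_ne_zero hs0 (hv0 k)), fun k => ?_⟩
  rw [det_frame_smul]
  have h1 := congr_arg Units.val (hu (k : ZMod N))
  simp only [Units.val_mul, Units.val_mk0, Units.coe_prod] at h1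
  rw [eq_of_periodic (f := fun k => (frame p.1.1 k).det) hper (k := ((k : ZMod N).val : ℤ)) (l := k) (by simp)] at h1
  simp only [Units.val_mk0, mul_pow, hv, Finset.prod_mul_distrib, Finset.prod_const,
    Finset.card_univ, Fintype.card_fin]
  push_cast
  rw [mul_left_comm, h1, ← pow_mul, hs]

theorem exists_matrix_colSpan (W : Submodule ℂ (Fin m × Fin n → ℂ))
    (hW : Module.finrank ℂ W = n) :
    ∃ X : Matrix (Fin m × Fin n) (Fin n) ℂ, colSpan X = W := by
  let b := Module.finBasisOfFinrankEq ℂ W hW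
  refine ⟨Matrix.of fun r q => (b q : Fin m × Fin n → ℂ) r, ?_⟩
  have h := congr_arg (Submodule.map W.subtype) b.span_eq
  rw [Submodule.map_span, Submodule.map_top, Submodule.range_subtype, ← Set.range_comp] at h
  exact h

theorem linearIndependent_of_finrank_colSpan {X : Matrix (Fin m × Fin n) (Fin n) ℂ}
    (h : Module.finrank ℂ (colSpan X) = n) : LinearIndependent ℂ X.col := by
  rw [linearIndependent_iff_card_eq_finrank_span, Fintype.card_fin]
  exact h.symm

/-- Bases are chosen freely over one period and carried to the other vertices by the powers of `M`.
-/
theorem TwistedPolygon.IsMonodromy.exists_lift [NeZero N] {φ : TwistedPolygon m n N}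
    {M : SLmn m n} (hM : φ.IsMonodromy M) : ∃ V, φ.IsTwistedLift M V := by
  have : ∀ k, ∃ X : Matrix (Fin m × Fin n) (Fin n) ℂ, colSpan X = φ.vertex k := fun k =>
    exists_matrix_colSpan _ (φ.finrank_vertex k)
  choose X hX using this
  have hpow : ∀ (q : ℤ) (k : ℤ), φ.vertex (k + q * N) = actSubspace (M ^ q) (φ.vertex k) := by
    intro q
    induction q using Int.induction_on with
    | zero => intro k; simp [actSubspace_one]
    | succ i ih =>
      intro k
      rw [show k + ((i : ℤ) + 1) * N = k + i * N + N by ring, hM, ih, zpow_add, ← actSubspace_mul,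
        zpow_one, ← zpow_one_add, ← zpow_add_one, add_comm]
    | pred i ih =>
      intro k
      have h1 := hM (k + (-(i : ℤ) - 1) * N)
      rw [show k + (-(i : ℤ) - 1) * N + N = k + -(i : ℤ) * N by ring, ih] at h1
      have h2 := congr_arg (actSubspace M⁻¹) h1
      rw [← actSubspace_mul, ← actSubspace_mul, inv_mul_cancel, actSubspace_one,
        ← zpow_neg_one, ← zpow_add] at h2
      rw [← h2]
      congr 2
      ring
  have hN : (N : ℤ) ≠ 0 := by exact_mod_cast NeZero.ne N
  refine ⟨fun k => ((M ^ (k / N) : SLmn m n) : Matrix (Fin m × Fin n) (Fin m × Fin n) ℂ) *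
    X (k % N), fun k => ?_, fun k => ?_⟩
  · rw [colSpan_mul, hX, ← hpow]
    congr 1
    rw [mul_comm]
    exact Int.emod_add_mul_ediv k N
  · rw [Int.add_emod_right, Int.add_ediv_of_dvd_right (dvd_refl _), Int.ediv_self hN, add_comm,
      zpow_add, zpow_one, Matrix.SpecialLinearGroup.coe_mul, Matrix.mul_assoc]

theorem TwistedPolygon.IsTwistedLift.exists_toPolygon {φ : RegularPolygon m n N} {M : SLmn m n}
    {V : ℤ → Matrix (Fin m × Fin n) (Fin n) ℂ} (h : φ.1.IsTwistedLift M V) :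
    ∃ p : TwistedLiftSpace m n N, p.1 = (V, M) ∧ p.toPolygon = φ := by
  refine ⟨⟨(V, M), fun k => ?_, h.twisted, φ.2 V h.isLift⟩, rfl, ?_⟩
  · apply linearIndependent_of_finrank_colSpan
    rw [h.isLift k]
    exact φ.1.finrank_vertex k
  · apply Subtype.ext
    apply TwistedPolygon.ext
    funext k
    exact h.isLift k

theorem TwistedLiftSpace.isTwistedLift (p : TwistedLiftSpace m n N) :
    p.toPolygon.1.IsTwistedLift p.1.2 p.1.1 :=
  ⟨fun _ => rfl, p.2.2.1⟩

/-- The action of the periodic changes of bases on the twisted lifts. -/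
def TwistedLiftSpace.gauge (p : TwistedLiftSpace m n N)
    (h : ZMod N → (Matrix (Fin n) (Fin n) ℂ)ˣ) : TwistedLiftSpace m n N :=
  ⟨(fun k => p.1.1 k * (h k : Matrix (Fin n) (Fin n) ℂ), p.1.2),
    fun k => linearIndependent_mul_unit (p.2.1 k) _,
    fun k => by
      simp only
      rw [p.2.2.1, Matrix.mul_assoc]
      simp,
    fun k => by
      rw [det_frame_mul p.1.1 (fun k => (h k : Matrix (Fin n) (Fin n) ℂ))]
      refine mul_ne_zero (p.2.2.2 k) (Finset.prod_ne_zero_iff.2 fun i _ => ?_)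
      exact isUnit_iff_ne_zero.1 ((Matrix.isUnit_iff_isUnit_det _).1 (h _).isUnit)⟩

theorem TwistedLiftSpace.toPolygon_gauge (p : TwistedLiftSpace m n N)
    (h : ZMod N → (Matrix (Fin n) (Fin n) ℂ)ˣ) : (p.gauge h).toPolygon = p.toPolygon := by
  apply Subtype.ext
  apply TwistedPolygon.ext
  funext k
  exact colSpan_mul_unit _ _

theorem TwistedLiftSpace.intertwines_gauge [NeZero N] (p : TwistedLiftSpace m n N)
    (h : ZMod N → (Matrix (Fin n) (Fin n) ℂ)ˣ) :
    Intertwines (fun k => h k) p.coeff (p.gauge h).coeff :=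
  p.recursion.intertwines p.2.2.2 (p.gauge h).recursion

theorem TwistedLiftSpace.det_frame_gauge (p : TwistedLiftSpace m n N)
    (h : ZMod N → (Matrix (Fin n) (Fin n) ℂ)ˣ) (k : ℤ) :
    (frame (p.gauge h).1.1 k).det = (frame p.1.1 k).det *
      ∏ i : Fin m, (h ((k + (i : ℕ) : ℤ) : ZMod N) : Matrix (Fin n) (Fin n) ℂ).det :=
  det_frame_mul p.1.1 (fun k => (h k : Matrix (Fin n) (Fin n) ℂ)) k

theorem TwistedLiftSpace.exists_normalized [NeZero N] [NeZero m] [NeZero n] (h : Nat.Coprime m N)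
    (p : TwistedLiftSpace m n N) :
    ∃ c : ZMod N → ℂˣ, ∀ k, (frame (p.gauge fun k => c k • 1).1.1 k).det = 1 := by
  obtain ⟨c, hc⟩ := p.exists_scalars h
  refine ⟨c, fun k => ?_⟩
  refine Eq.trans ?_ (hc k)
  congr 2
  funext j
  simp [gauge, Units.smul_def]

theorem TwistedLiftSpace.det_coeff_zero {μ : ℕ} [NeZero N] {p : TwistedLiftSpace (μ + 1) n N}
    (hp : ∀ k, (frame p.1.1 k).det = 1) (k : ZMod N) :
    (p.coeff k 0).det = (-1) ^ (n * μ) := by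
  obtain ⟨k, rfl⟩ := ZMod.intCast_surjective k
  have := p.recursion.det_frame_add_one k
  rw [hp, hp, one_mul] at this
  have h2 := congr_arg (fun x => (-1 : ℂ) ^ (n * μ) * x) this
  simp only [mul_one] at h2
  rw [h2, ← mul_assoc, neg_one_pow_mul_neg_one_pow, one_mul]

end Lifts

/-! ### Normal forms of the `a_k^0` -/

section NormalForms

variable {μ n N : ℕ} [NeZero N] [NeZero n]

theorem exists_unimodular_unit {P : (Matrix (Fin n) (Fin n) ℂ)ˣ} :
    ∃ c : ℂˣ, ((c • P : (Matrix (Fin n) (Fin n) ℂ)ˣ) : Matrix (Fin n) (Fin n) ℂ).det = 1 := by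
  have hP : (P : Matrix (Fin n) (Fin n) ℂ).det ≠ 0 :=
    isUnit_iff_ne_zero.1 ((Matrix.isUnit_iff_isUnit_det _).1 P.isUnit)
  obtain ⟨c, hc, h⟩ := exists_pow_mul_eq_one (NeZero.ne n) hP
  refine ⟨Units.mk0 c hc, ?_⟩
  simpa [Units.smul_def, Matrix.det_smul] using h

theorem Intertwines.zero {m : ℕ} [NeZero m] {h : ℤ → (Matrix (Fin n) (Fin n) ℂ)ˣ}
    {a a' : Coefficients m n N} (H : Intertwines h a a') (k : ℤ) :
    (h k : Matrix (Fin n) (Fin n) ℂ) * a' k 0 =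
      a k 0 * (h (k + m) : Matrix (Fin n) (Fin n) ℂ) := by
  have := H k 0
  simpa using this

/-- A change of bases that brings the coefficients `a_k^0` to prescribed matrices. -/
theorem TwistedLiftSpace.exists_gauge_zero (h : Nat.Coprime (μ + 1) N)
    {p : TwistedLiftSpace (μ + 1) n N} (hp : ∀ k, (frame p.1.1 k).det = 1)
    {R : ZMod N → Matrix (Fin n) (Fin n) ℂ} (hR : ∀ k, (R k).det = (-1) ^ (n * μ))
    (P : (Matrix (Fin n) (Fin n) ℂ)ˣ)
    (hP : ((List.range N).map fun j => p.coeff ((j * (μ + 1) : ℕ) : ZMod N) 0).prod *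
      (P : Matrix (Fin n) (Fin n) ℂ) = (P : Matrix (Fin n) (Fin n) ℂ) *
      ((List.range N).map fun j => R ((j * (μ + 1) : ℕ) : ZMod N)).prod) :
    ∃ q : TwistedLiftSpace (μ + 1) n N, q.toPolygon = p.toPolygon ∧ q.1.2 = p.1.2 ∧
      (∀ k, (frame q.1.1 k).det = 1) ∧ ∀ k, q.coeff k 0 = R k := by
  have hε : ((-1 : ℂ) ^ (n * μ)) ≠ 0 := pow_ne_zero _ (by norm_num)
  have ha : ∀ k, IsUnit (p.coeff k 0) := fun k => by
    rw [Matrix.isUnit_iff_isUnit_det, det_coeff_zero hp]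
    exact isUnit_iff_ne_zero.2 hε
  have hRu : ∀ k, IsUnit (R k) := fun k => by
    rw [Matrix.isUnit_iff_isUnit_det, hR]
    exact isUnit_iff_ne_zero.2 hε
  choose ua hua using ha
  choose uR huR using hRu
  -- The relation `hP` is homogeneous in `P`, which may therefore be scaled to determinant one; this
  -- keeps the frame determinants equal to one.
  obtain ⟨c, hc⟩ := exists_unimodular_unit (P := P)
  set P' := c • P
  -- The change of bases at the place `j m`, forced by `y_{j+1} = a⁻¹ y_j R`; it closes up at `N`
  -- precisely by `hP`.
  let y : ℕ → (Matrix (Fin n) (Fin n) ℂ)ˣ := fun j =>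
    (((List.range j).map fun i => ua ((i * (μ + 1) : ℕ) : ZMod N)).prod)⁻¹ * P' *
      ((List.range j).map fun i => uR ((i * (μ + 1) : ℕ) : ZMod N)).prod
  have hy : ∀ j : ℕ, y (j + 1) = (fun (k : ZMod N) (x : (Matrix (Fin n) (Fin n) ℂ)ˣ) =>
      (ua k)⁻¹ * x * uR k) ((j * (μ + 1) : ℕ) : ZMod N) (y j) := by
    intro j
    simp only [y, List.range_succ, List.map_append, List.prod_append, List.map_singleton,
      List.prod_singleton, mul_inv_rev, mul_assoc]
  have hyN : y N = y 0 := by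
    simp only [y, List.range_zero, List.map_nil, List.prod_nil, inv_one, one_mul, mul_one]
    rw [mul_assoc, inv_mul_eq_iff_eq_mul]
    apply Units.ext
    have hcoe : ∀ f : ℕ → (Matrix (Fin n) (Fin n) ℂ)ˣ, (((List.range N).map f).prod :
        Matrix (Fin n) (Fin n) ℂ) =
          ((List.range N).map fun i => (f i : Matrix (Fin n) (Fin n) ℂ)).prod := fun f => by
      rw [← Units.coeHom_apply, map_list_prod, List.map_map]
      rfl
    rw [Units.val_mul, Units.val_mul, hcoe, hcoe]
    simp only [hua, huR]
    have hP' : (P' : Matrix (Fin n) (Fin n) ℂ) = (c : ℂ) • (P : Matrix (Fin n) (Fin n) ℂ) := rfl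
    rw [hP', Matrix.smul_mul, Matrix.mul_smul, hP]
  obtain ⟨g, hg0, hg⟩ := exists_of_cycle h
    (F := fun (k : ZMod N) (x : (Matrix (Fin n) (Fin n) ℂ)ˣ) => (ua k)⁻¹ * x * uR k) hy hyN
  have hgm : ∀ k : ZMod N, (g k : Matrix (Fin n) (Fin n) ℂ) * R k = p.coeff k 0 *
      (g (k + (μ + 1 : ℕ)) : Matrix (Fin n) (Fin n) ℂ) := by
    intro k
    rw [hg k, ← hua, ← huR, ← Units.val_mul, ← Units.val_mul]
    congr 1
    group
  have hdet : ∀ k, (g k : Matrix (Fin n) (Fin n) ℂ).det = 1 := by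
    have hstep : ∀ k : ZMod N, (g (k + (μ + 1 : ℕ)) : Matrix (Fin n) (Fin n) ℂ).det =
        (g k : Matrix (Fin n) (Fin n) ℂ).det := by
      intro k
      have := congr_arg Matrix.det (hgm k)
      rw [Matrix.det_mul, Matrix.det_mul, hR, det_coeff_zero hp, mul_comm] at this
      exact (mul_left_cancel₀ hε this).symm
    have hall : ∀ j : ℕ, (g ((j * (μ + 1) : ℕ) : ZMod N) : Matrix (Fin n) (Fin n) ℂ).det = 1 := by
      intro j
      induction j with
      | zero => simp [hg0, y, hc]
      | succ j ih => rw [add_one_mul, Nat.cast_add, hstep, ih]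
    intro k
    rw [← cycleIndex_mul h k]
    exact hall _
  refine ⟨p.gauge g, p.toPolygon_gauge g, rfl, fun k => ?_, fun k => ?_⟩
  · rw [p.det_frame_gauge, hp, one_mul, Finset.prod_eq_one fun i _ => hdet _]
  · obtain ⟨k, rfl⟩ := ZMod.intCast_surjective k
    have h1 := (p.intertwines_gauge g).zero k
    have h2 := hgm k
    rw [Int.cast_add, Int.cast_natCast, ← h2] at h1
    exact (Units.mul_right_inj (g k)).1 h1

theorem exists_root_sign (n μ : ℕ) [NeZero n] : ∃ r : ℂ, r ≠ 0 ∧ r ^ n = (-1) ^ (n * μ) :=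
  ⟨(-1) ^ μ, pow_ne_zero _ (by norm_num), by rw [← pow_mul, mul_comm]⟩

/-- The `a_k^0` can be brought to scalar matrices for `k ≠ 0`, and to a scalar multiple of any
prescribed conjugate of their cyclic product for `k = 0`. -/
theorem TwistedLiftSpace.exists_gauge_conj (h : Nat.Coprime (μ + 1) N)
    {p : TwistedLiftSpace (μ + 1) n N} (hp : ∀ k, (frame p.1.1 k).det = 1) {r : ℂ} (hr : r ≠ 0)
    (hrn : r ^ n = (-1) ^ (n * μ)) (P : (Matrix (Fin n) (Fin n) ℂ)ˣ)
    (J : Matrix (Fin n) (Fin n) ℂ)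
    (hP : ((List.range N).map fun j => p.coeff ((j * (μ + 1) : ℕ) : ZMod N) 0).prod *
      (P : Matrix (Fin n) (Fin n) ℂ) = (P : Matrix (Fin n) (Fin n) ℂ) * J) :
    ∃ q : TwistedLiftSpace (μ + 1) n N, q.toPolygon = p.toPolygon ∧ q.1.2 = p.1.2 ∧
      (∀ k, (frame q.1.1 k).det = 1) ∧ q.coeff 0 0 = (r ^ (N - 1))⁻¹ • J ∧
      ∀ k, k ≠ 0 → q.coeff k 0 = r • 1 := by
  have hε : ((-1 : ℂ) ^ (n * μ)) ≠ 0 := pow_ne_zero _ (by norm_num)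
  have hJ : J.det = ((-1) ^ (n * μ)) ^ N := by
    have h1 := congr_arg Matrix.det hP
    have h2 : ((List.range N).map fun j => p.coeff ((j * (μ + 1) : ℕ) : ZMod N) 0).prod.det =
        ((-1) ^ (n * μ)) ^ N := by
      rw [← Matrix.coe_detMonoidHom, map_list_prod, List.map_map]
      simp only [Function.comp_def, Matrix.coe_detMonoidHom, det_coeff_zero hp]
      simp
    rw [Matrix.det_mul, Matrix.det_mul, h2, mul_comm] at h1
    have hPd : (P : Matrix (Fin n) (Fin n) ℂ).det ≠ 0 :=
      isUnit_iff_ne_zero.1 ((Matrix.isUnit_iff_isUnit_det _).1 P.isUnit)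
    exact (mul_left_cancel₀ hPd h1).symm
  -- The scalar `r` occurs at the `N - 1` places other than `0`; the factor at `0` compensates, so
  -- that the product along the cycle is `J`.
  let R : ZMod N → Matrix (Fin n) (Fin n) ℂ :=
    fun k => if k = 0 then (r ^ (N - 1))⁻¹ • J else r • 1
  have hR : ∀ k, (R k).det = (-1) ^ (n * μ) := by
    intro k
    by_cases hk : k = 0
    · simp only [R, hk, if_true, Matrix.det_smul, hJ, Fintype.card_fin]
      have hrN : (r ^ (N - 1)) ^ n = ((-1) ^ (n * μ)) ^ (N - 1) := by
        rw [← pow_mul, mul_comm, pow_mul, hrn]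
      rw [inv_pow, hrN, mul_comm]
      obtain ⟨M, rfl⟩ := Nat.exists_eq_succ_of_ne_zero (NeZero.ne N)
      rw [Nat.succ_eq_add_one, Nat.add_sub_cancel, pow_succ, mul_comm _ ((-1 : ℂ) ^ (n * μ)),
        mul_assoc, mul_inv_cancel₀ (pow_ne_zero _ hε), mul_one]
    · simp [R, hk, hrn]
  have hprod : ∀ j : ℕ, j + 1 ≤ N →
      ((List.range (j + 1)).map fun j => R ((j * (μ + 1) : ℕ) : ZMod N)).prod =
        (r ^ j * (r ^ (N - 1))⁻¹) • J := by
    intro j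
    induction j with
    | zero => intro _; simp [R]
    | succ j ih =>
      intro hj
      have hne : (((j + 1) * (μ + 1) : ℕ) : ZMod N) ≠ 0 :=
        natCast_mul_ne_zero h (Nat.succ_ne_zero j) (by omega)
      rw [List.range_succ, List.map_append, List.prod_append, ih (by omega), List.map_singleton,
        List.prod_singleton]
      simp only [R, if_neg hne, Matrix.mul_smul, Matrix.mul_one, smul_smul]
      congr 1
      ring
  have hN : ((List.range N).map fun j => R ((j * (μ + 1) : ℕ) : ZMod N)).prod = J := by
    have := hprod (N - 1) (by have := NeZero.pos N; omega)
    rw [Nat.sub_add_cancel (NeZero.pos N), mul_inv_cancel₀ (pow_ne_zero _ hr), one_smul] at this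
    exact this
  obtain ⟨q, h1, h2, h3, h4⟩ := exists_gauge_zero h hp hR P (by rw [hN, hP])
  exact ⟨q, h1, h2, h3, by rw [h4]; simp [R], fun k hk => by rw [h4]; simp [R, hk]⟩

theorem IsUpperToeplitz.smul {l : ℕ} {R : Matrix (Fin l) (Fin l) ℂ} (h : IsUpperToeplitz R)
    (c : ℂ) : IsUpperToeplitz (c • R) := by
  obtain ⟨t, ht⟩ := h
  exact ⟨fun j => c * t j, fun p q => by simp [ht]⟩

theorem IsBlockToeplitz.smul {c : Composition n} {A : Matrix (Fin n) (Fin n) ℂ}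
    (h : IsBlockToeplitz c A) (x : ℂ) : IsBlockToeplitz c (x • A) := by
  obtain ⟨r, hr, rfl⟩ := h
  exact ⟨fun i => x • r i, fun i => (hr i).smul x, by
    rw [show (fun i => x • r i) = x • r from rfl, Matrix.blockDiagonal'_smul]
    rfl⟩

theorem isBlockToeplitz_one (c : Composition n) : IsBlockToeplitz c 1 := by
  refine ⟨fun i => 1, fun i => ⟨fun j => if j = 0 then 1 else 0, fun p q => ?_⟩, ?_⟩
  · change (1 : Matrix (Fin (c.blocksFun i)) (Fin (c.blocksFun i)) ℂ) p q =
      if p ≤ q then (if (q : ℕ) - p = 0 then 1 else 0) else 0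
    by_cases h : p = q
    · subst h
      simp
    · rw [Matrix.one_apply_ne h]
      split_ifs with h1 h2
      · exact absurd (le_antisymm h1 (Fin.le_def.2 (Nat.sub_eq_zero_iff_le.1 h2))) h
      · rfl
      · rfl
  · rw [show (fun i => (1 : Matrix (Fin (c.blocksFun i)) (Fin (c.blocksFun i)) ℂ)) = 1 from rfl,
      Matrix.blockDiagonal'_one]
    simp

end NormalForms

/-! ### Jordan form -/

section Jordan

open Polynomial DirectSum

theorem exists_linear_of_irreducible {p : ℂ[X]} (hp : Irreducible p) :
    ∃ x : ℂ, Associated (X - C x) p := by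
  obtain ⟨x, hx⟩ := IsAlgClosed.exists_root p (by
    rw [IsAlgClosed.degree_eq_one_of_irreducible ℂ hp]; exact one_ne_zero)
  exact ⟨x, (irreducible_X_sub_C x).associated_of_dvd hp (dvd_iff_isRoot.2 hx)⟩

/-- A finite-dimensional complex space with an endomorphism is a direct sum of cyclic modules
with generators `v i` annihilated by `(X - x_i)^{e_i}`. -/
theorem exists_cyclic_generators {V : Type} [AddCommGroup V] [Module ℂ V] [Module.Finite ℂ V]
    (f : Module.End ℂ V) :
    ∃ (ι : Type) (_ : Fintype ι) (x : ι → ℂ) (e : ι → ℕ) (v : ι → V),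
      (∀ i, ((f - algebraMap ℂ _ (x i)) ^ e i) (v i) = 0) ∧
      ∑ i, e i = Module.finrank ℂ V ∧
      ⊤ ≤ Submodule.span ℂ {u | ∃ i j, j < e i ∧ ((f - algebraMap ℂ _ (x i)) ^ j) (v i) = u} := by
  classical
  -- The structure theorem for the torsion module over `ℂ[X]` on which `X` acts as `f`; irreducible
  -- polynomials over `ℂ` are linear.
  obtain ⟨ι, hι, p, hp, e, ⟨Φ⟩⟩ := Module.equiv_directSum_of_isTorsion (R := ℂ[X])
    (M := Module.AEval' f) (Module.AEval.isTorsion_of_finiteDimensional ℂ V f)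
  choose x hx using fun i => exists_linear_of_irreducible (hp i)
  have hspan : ∀ i, ℂ[X] ∙ p i ^ e i = ℂ[X] ∙ (X - C (x i)) ^ e i := fun i =>
    Ideal.span_singleton_eq_span_singleton.2 ((hx i).pow_pow (n := e i)).symm
  let g : ∀ i, Module.AEval' f := fun i =>
    Φ.symm (DirectSum.lof ℂ[X] ι (fun i => ℂ[X] ⧸ ℂ[X] ∙ p i ^ e i) i (Submodule.Quotient.mk 1))
  let v : ι → V := fun i => (Module.AEval'.of f).symm (g i)
  have hsmul : ∀ (i : ι) (q : ℂ[X]), q • g i = Φ.symm (DirectSum.lof ℂ[X] ι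
      (fun i => ℂ[X] ⧸ ℂ[X] ∙ p i ^ e i) i (Submodule.Quotient.mk q)) := by
    intro i q
    simp only [g]
    rw [← map_smul, ← map_smul, ← Submodule.Quotient.mk_smul, smul_eq_mul, mul_one]
  have hv : ∀ (i : ι) (q : ℂ[X]), (aeval f q) (v i) = (Module.AEval'.of f).symm (q • g i) := by
    intro i q
    exact (Module.AEval.of_symm_smul (R := ℂ) (M := V) (a := f) q (g i)).symm
  have hpow : ∀ (i : ι) (j : ℕ), (f - algebraMap ℂ _ (x i)) ^ j = aeval f ((X - C (x i)) ^ j) := by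
    intro i j
    simp
  have hzero : ∀ i, (X - C (x i)) ^ e i • g i = 0 := by
    intro i
    rw [hsmul, (Submodule.Quotient.mk_eq_zero _).2, map_zero, map_zero]
    rw [hspan i]
    exact Submodule.mem_span_singleton_self _
  refine ⟨ι, hι, x, e, v, fun i => ?_, ?_, ?_⟩
  · rw [hpow, hv, hzero, map_zero]
  · have h1 : Module.finrank ℂ V = Module.finrank ℂ (⨁ i, ℂ[X] ⧸ ℂ[X] ∙ p i ^ e i) :=
      ((Module.AEval'.of f).trans (Φ.restrictScalars ℂ)).finrank_eq
    have hq : ∀ i, Module.finrank ℂ (ℂ[X] ⧸ ℂ[X] ∙ p i ^ e i) = e i := by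
      intro i
      have := finrank_quotient_span_eq_natDegree (K := ℂ) (f := p i ^ e i)
      rw [Polynomial.natDegree_pow, Polynomial.natDegree_eq_of_degree_eq_some
        (IsAlgClosed.degree_eq_one_of_irreducible ℂ (hp i))] at this
      exact this.trans (mul_one _)
    have hfin : ∀ i, Module.Finite ℂ (ℂ[X] ⧸ ℂ[X] ∙ p i ^ e i) := fun i =>
      (AdjoinRoot.powerBasis (pow_ne_zero (e i) (hp i).ne_zero)).finite
    rw [h1, Module.finrank_directSum]
    exact (Finset.sum_congr rfl fun i _ => hq i).symm
  · intro u _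
    have hu : u = ∑ i, (Module.AEval'.of f).symm
        (((Φ (Module.AEval'.of f u) i).out : ℂ[X]) • g i) := by
      rw [← map_sum, LinearEquiv.eq_symm_apply]
      apply Φ.injective
      rw [map_sum]
      simp only [hsmul, LinearEquiv.apply_symm_apply]
      refine (DirectSum.sum_univ_of (Φ (Module.AEval'.of f u))).symm.trans ?_
      refine Finset.sum_congr rfl fun i _ => ?_
      rw [DirectSum.lof_eq_of]
      congr 1
      exact (Submodule.Quotient.mk_out _).symm
    rw [hu]
    refine Submodule.sum_mem _ fun i _ => ?_
    -- Expanding the polynomial in powers of `X - x_i` writes its action on the generator through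
    -- the vectors of the chain; the terms of degree at least `e_i` vanish.
    rw [← hv, ← sum_taylor_eq (Quotient.out (Φ (Module.AEval'.of f u) i)) (x i),
      Polynomial.sum, map_sum, LinearMap.sum_apply]
    refine Submodule.sum_mem _ fun j _ => ?_
    rw [map_mul, Module.End.mul_apply, aeval_C, Module.algebraMap_end_apply]
    refine Submodule.smul_mem _ _ ?_
    rcases lt_or_ge j (e i) with hj | hj
    · exact Submodule.subset_span ⟨i, j, hj, by rw [hpow]⟩
    · rw [hv, ← Nat.sub_add_cancel hj, pow_add, mul_smul, hzero, smul_zero, map_zero]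
      exact Submodule.zero_mem _

/-- Jordan chains `w i 0, …, w i (e i - 1)` generating the space. -/
theorem exists_jordan_chains {n : ℕ} (A : Matrix (Fin n) (Fin n) ℂ) :
    ∃ (s : ℕ) (e : Fin s → ℕ) (x : Fin s → ℂ) (w : Fin s → ℕ → Fin n → ℂ),
      (∀ i, 0 < e i) ∧ ∑ i, e i = n ∧
      (∀ i j, j < e i → A *ᵥ w i j = x i • w i j + if j = 0 then 0 else w i (j - 1)) ∧
      ⊤ ≤ Submodule.span ℂ {u | ∃ i j, j < e i ∧ w i j = u} := by
  classical
  obtain ⟨ι, _, x, e, v, h0, hsum, hspan⟩ := exists_cyclic_generators (Matrix.toLin' A)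
  -- Summands with exponent `0` are dropped, since the blocks of a composition are non-empty.
  let σ := Fintype.equivFin {i : ι // e i ≠ 0}
  -- The chain is numbered backwards, from the eigenvector up to the generator, so that the ones of
  -- the Jordan block stand above the diagonal.
  let w : ι → ℕ → Fin n → ℂ := fun i j =>
    ((Matrix.toLin' A - algebraMap ℂ _ (x i)) ^ (e i - 1 - j)) (v i)
  have hw : ∀ i j, j < e i → A *ᵥ w i j = x i • w i j + if j = 0 then 0 else w i (j - 1) := by
    intro i j hj
    have h1 : (Matrix.toLin' A - algebraMap ℂ _ (x i)) (w i j) =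
        ((Matrix.toLin' A - algebraMap ℂ _ (x i)) ^ (e i - j)) (v i) := by
      rw [show e i - j = (e i - 1 - j) + 1 by omega, pow_succ']
      rfl
    rw [LinearMap.sub_apply, Matrix.toLin'_apply, Module.algebraMap_end_apply,
      sub_eq_iff_eq_add'] at h1
    rw [h1]
    congr 1
    split_ifs with hj0
    · rw [hj0, Nat.sub_zero, h0]
    · simp only [w]
      rw [show e i - j = e i - 1 - (j - 1) by omega]
  refine ⟨_, fun i => e (σ.symm i), fun i => x (σ.symm i), fun i => w (σ.symm i),
    fun i => Nat.pos_of_ne_zero (σ.symm i).2, ?_, fun i j hj => hw _ _ hj, hspan.trans ?_⟩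
  · rw [Equiv.sum_comp σ.symm (fun i => e i.1)]
    have h2 := Finset.sum_subtype_of_mem (p := fun i => e i ≠ 0) (s := Finset.univ.filter
      fun i => e i ≠ 0) e (by simp)
    have h3 : ∑ i : {i : ι // e i ≠ 0}, e i.1 = ∑ i ∈ Finset.univ.filter fun i => e i ≠ 0, e i := by
      rw [Finset.sum_subtype (Finset.univ.filter fun i => e i ≠ 0) (p := fun i => e i ≠ 0)
        (by simp)]
    rw [h3, Finset.sum_filter_ne_zero, hsum]
    simp
  · refine Submodule.span_mono ?_
    rintro u ⟨i, j, hj, rfl⟩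
    refine ⟨σ ⟨i, by omega⟩, e i - 1 - j, by simp; omega, ?_⟩
    simp only [Equiv.symm_apply_apply, w]
    rw [show e i - 1 - (e i - 1 - j) = j by omega]

theorem sum_mul_jordan_block {L : ℕ} (u : ℕ → ℂ) (x : ℂ) (j : Fin L) :
    ∑ k : Fin L, u k * (Matrix.of fun p q : Fin L =>
      if p = q then x else if (p : ℕ) + 1 = q then 1 else 0) k j =
        x * u j + if (j : ℕ) = 0 then 0 else u (j - 1) := by
  have h1 : ∀ k : Fin L, u k * (Matrix.of fun p q : Fin L =>
      if p = q then x else if (p : ℕ) + 1 = q then 1 else 0) k j =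
        (if k = j then x * u k else 0) + if (k : ℕ) + 1 = j then u k else 0 := by
    intro k
    rw [Matrix.of_apply]
    split_ifs with h h' h'
    · subst h; omega
    · ring
    · ring
    · ring
  rw [Finset.sum_congr rfl fun k _ => h1 k, Finset.sum_add_distrib, Finset.sum_ite_eq' _ j,
    if_pos (Finset.mem_univ _)]
  congr 1
  split_ifs with hj
  · exact Finset.sum_eq_zero fun k _ => if_neg (by omega)
  · rw [Finset.sum_eq_single (⟨j - 1, by omega⟩ : Fin L)]
    · exact if_pos (by simp only; omega)
    · intro k _ hk
      refine if_neg fun h => hk (Fin.ext ?_)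
      simp only
      omega
    · exact fun h => absurd (Finset.mem_univ _) h

/-- The Jordan chains are the columns of `P`, grouped by blocks. They span, and there are `n` of
them, so `P` is invertible; Jordan blocks are upper triangular Toeplitz. -/
theorem exists_jordan_form {n : ℕ} (A : Matrix (Fin n) (Fin n) ℂ) :
    ∃ (P : (Matrix (Fin n) (Fin n) ℂ)ˣ) (c : Composition n) (J : Matrix (Fin n) (Fin n) ℂ),
      IsBlockToeplitz c J ∧
      A * (P : Matrix (Fin n) (Fin n) ℂ) = (P : Matrix (Fin n) (Fin n) ℂ) * J := by
  obtain ⟨s, e, x, w, he, hsum, hw, hspan⟩ := exists_jordan_chains A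
  let c : Composition n := ⟨List.ofFn e, by
    intro i hi
    obtain ⟨j, rfl⟩ := (List.mem_ofFn' _ _).1 hi
    exact he j, by rw [List.sum_ofFn, hsum]⟩
  have hc : c.length = s := List.length_ofFn
  have hb : ∀ i : Fin c.length, c.blocksFun i = e (Fin.cast hc i) := by
    intro i
    simp [Composition.blocksFun, c]
    rfl
  let r : (i : Fin c.length) → Matrix (Fin (c.blocksFun i)) (Fin (c.blocksFun i)) ℂ := fun i =>
    Matrix.of fun p q => if p = q then x (Fin.cast hc i) else if (p : ℕ) + 1 = q then 1 else 0
  let P : Matrix (Fin n) (Fin n) ℂ := Matrix.of fun a b =>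
    w (Fin.cast hc (c.blocksFinEquiv.symm b).1) (c.blocksFinEquiv.symm b).2 a
  have hPx : ∀ y a, P a (c.blocksFinEquiv y) = w (Fin.cast hc y.1) y.2 a := by
    intro y a
    change w (Fin.cast hc (c.blocksFinEquiv.symm (c.blocksFinEquiv y)).1)
      (c.blocksFinEquiv.symm (c.blocksFinEquiv y)).2 a = _
    rw [Equiv.symm_apply_apply]
  have hP : P.det ≠ 0 := by
    rw [det_ne_zero_iff_span]
    refine top_le_iff.1 (hspan.trans (Submodule.span_mono ?_))
    rintro u ⟨i, j, hj, rfl⟩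
    refine ⟨c.blocksFinEquiv ⟨Fin.cast hc.symm i, ⟨j, by rw [hb]; exact hj⟩⟩, ?_⟩
    ext a
    exact hPx _ _
  refine ⟨Matrix.nonsingInvUnit P (isUnit_iff_ne_zero.2 hP), c, _, ⟨r, fun i => ?_, rfl⟩, ?_⟩
  · refine ⟨fun t => if t = 0 then x (Fin.cast hc i) else if t = 1 then 1 else 0, fun p q => ?_⟩
    simp only [r, Matrix.of_apply, Fin.ext_iff, Fin.le_def]
    split_ifs <;> first | rfl | omega
  · change A * P = P * _
    ext a b
    obtain ⟨⟨i, j⟩, rfl⟩ := c.blocksFinEquiv.surjective b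
    have h1 := congr_fun (hw (Fin.cast hc i) j (by rw [← hb]; exact j.2)) a
    have h2 : (A * P) a (c.blocksFinEquiv ⟨i, j⟩) = (A *ᵥ w (Fin.cast hc i) j) a := by
      simp only [Matrix.mul_apply, Matrix.mulVec, dotProduct, hPx]
    rw [h2, h1, Matrix.mul_apply, ← Equiv.sum_comp c.blocksFinEquiv, Fintype.sum_sigma,
      Finset.sum_eq_single i]
    · simp only [hPx, Matrix.reindex_apply, Matrix.submatrix_apply, Equiv.symm_apply_apply,
        Matrix.blockDiagonal'_apply_eq]
      rw [sum_mul_jordan_block (fun k => w (Fin.cast hc i) k a)]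
      split_ifs <;> rfl
    · intro i' _ hi'
      refine Finset.sum_eq_zero fun k _ => ?_
      simp only [Matrix.reindex_apply, Matrix.submatrix_apply, Equiv.symm_apply_apply]
      rw [Matrix.blockDiagonal'_apply_ne _ _ _ hi', mul_zero]
    · exact fun h => absurd (Finset.mem_univ _) h

end Jordan

/-! ### Generic coefficients and the triviality of the stabilizer -/

section Generic

variable {μ n N : ℕ}

/-- The family of the coefficients `a_k^{m-1}`. -/
abbrev lastCoeff (a : Coefficients (μ + 1) n N) : ZMod N → Matrix (Fin n) (Fin n) ℂ :=
  fun k => a k (Fin.last μ)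

/-- The products of the `p`-th diagonal entries of the `a_k^0`. -/
def cycleEigenvalue [NeZero N] (a : Coefficients (μ + 1) n N) (p : Fin n) : ℂ :=
  ∏ k : ZMod N, a k 0 p p

/-- Three matrices that commute with the stabilizer of the polygon. -/
def stabilizerMatrix [NeZero N] (a : Coefficients (μ + 1) n N) (j : Fin 3) :
    Matrix (Fin n) (Fin n) ℂ :=
  cyclicProduct (μ + 1) (lastCoeff a) 0 ^ (j : ℕ) * Matrix.diagonal (cycleEigenvalue a) *
    (cyclicProduct (μ + 1) (lastCoeff a) 0).adjugate ^ ((j : ℕ) + (μ + 1))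

/-- Only the scalar matrices commute with all the `Q j`. -/
def HasTrivialCommutant {κ : Type*} (Q : κ → Matrix (Fin n) (Fin n) ℂ) : Prop :=
  ∀ x, (∀ j, x * Q j = Q j * x) → ∃ c : ℂ, x = c • 1

/-- Generic coefficients with diagonal `a_k^0`. -/
structure IsGeneric [NeZero N] [NeZero n] (a : Coefficients (μ + 1) n N) : Prop where
  diagonal : ∀ k, (a k 0).IsDiag
  det_zero : ∀ k, (a k 0).det = (-1) ^ (n * μ)
  -- Distinct powers, and not only distinct eigenvalues: intertwiners are periodic only up to `x`
  -- with `x ^ ((μ + 1) * n) = 1`, and `x` must not exchange eigenvalues.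
  eigenvalue : ∀ p q, p ≠ q →
    cycleEigenvalue a p ^ ((μ + 1) * n) ≠ cycleEigenvalue a q ^ ((μ + 1) * n)
  super : ∀ (k : ZMod N) (i : ℕ) (hi : i + 1 < n),
    cyclicProduct (μ + 1) (lastCoeff a) k ⟨i, by omega⟩ ⟨i + 1, hi⟩ ≠ 0
  sub : ∀ (k : ZMod N) (hi : 1 < n),
    cyclicProduct (μ + 1) (lastCoeff a) k ⟨1, hi⟩ ⟨0, by omega⟩ ≠ 0
  -- A diagonal entry is not moved by a diagonal conjugation, so it detects the root of unity `x`.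
  corner : cyclicProduct (μ + 1) (lastCoeff a) 0 0 0 ≠ 0
  det_last : ∀ k, (a k (Fin.last μ)).det ≠ 0
  commutant : HasTrivialCommutant (stabilizerMatrix a)

/-- Telescoping: `g` is pushed through the factors one at a time. -/
theorem mul_prod_ofFn {R : Type*} [Monoid R] {f f' g : ℕ → R}
    (h : ∀ j, g j * f' j = f j * g (j + 1)) (r : ℕ) :
    g 0 * (List.ofFn fun j : Fin r => f' j).prod = (List.ofFn fun j : Fin r => f j).prod * g r := by
  induction r with
  | zero => simp
  | succ r ih =>
    rw [List.ofFn_succ', List.ofFn_succ']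
    simp only [List.concat_eq_append, List.prod_append, List.prod_singleton, Fin.val_castSucc,
      Fin.val_last]
    rw [← mul_assoc, ih, mul_assoc, h, mul_assoc]

/-- A version of `Intertwines` for families of not necessarily invertible matrices. -/
def IntertwinesMatrix {m : ℕ} (h : ℤ → Matrix (Fin n) (Fin n) ℂ) (a a' : Coefficients m n N) :
    Prop :=
  ∀ (k : ℤ) (i : Fin m), h (k + (i : ℕ)) * a' (k : ZMod N) i = a (k : ZMod N) i * h (k + m)

theorem IntertwinesMatrix.zero {h : ℤ → Matrix (Fin n) (Fin n) ℂ}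
    {a a' : Coefficients (μ + 1) n N} (H : IntertwinesMatrix h a a') (k : ℤ) :
    h k * a' k 0 = a k 0 * h (k + (μ + 1 : ℕ)) := by
  have := H k 0
  simpa using this

theorem IntertwinesMatrix.last {h : ℤ → Matrix (Fin n) (Fin n) ℂ}
    {a a' : Coefficients (μ + 1) n N} (H : IntertwinesMatrix h a a') (k : ℤ) :
    h (k + μ) * lastCoeff a' k = lastCoeff a k * h (k + μ + 1) := by
  have := H k (Fin.last μ)
  simpa [add_assoc] using this

/-- The relation for `a_{k-m+1}^{m-1}` links `h_k` to `h_{k+1}`, which is why `b^k` begins with this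
factor. After `N` factors one arrives at `h_{k+N}`, which may differ from `h_k`. -/
theorem IntertwinesMatrix.cyclicProduct {h : ℤ → Matrix (Fin n) (Fin n) ℂ}
    {a a' : Coefficients (μ + 1) n N} (H : IntertwinesMatrix h a a') (k : ℤ) :
    h k * cyclicProduct (μ + 1) (lastCoeff a') k =
      cyclicProduct (μ + 1) (lastCoeff a) k * h (k + N) := by
  have h1 := mul_prod_ofFn (g := fun j => h (k + j))
    (f := fun j : ℕ => lastCoeff a ((k : ZMod N) - ((μ + 1 : ℕ) : ZMod N) + 1 + (j : ZMod N)))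
    (f' := fun j : ℕ => lastCoeff a' ((k : ZMod N) - ((μ + 1 : ℕ) : ZMod N) + 1 + (j : ZMod N)))
    (fun j => by
      have h2 := H.last (k - μ + j)
      rw [show k - μ + (j : ℤ) + μ = k + j by ring] at h2
      rw [show (k : ZMod N) - ((μ + 1 : ℕ) : ZMod N) + 1 + (j : ZMod N) =
        ((k - μ + j : ℤ) : ZMod N) by push_cast; ring, h2]
      push_cast
      rw [add_assoc]) N
  simp only [Nat.cast_zero, add_zero] at h1
  exact h1

/-- For diagonal `a_k^0` the relation holds entry by entry, and can be iterated `N` times in steps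
of `m`. As `h` is indexed by integers and not assumed periodic, the walk ends at `k + N m`. -/
theorem mul_cycleEigenvalue [NeZero N] (hmN : Nat.Coprime (μ + 1) N)
    {h : ℤ → Matrix (Fin n) (Fin n) ℂ} {a a' : Coefficients (μ + 1) n N}
    (H : ∀ k : ℤ, h k * a' k 0 = a k 0 * h (k + (μ + 1 : ℕ)))
    (ha : ∀ k, (a k 0).IsDiag) (ha' : ∀ k, (a' k 0).IsDiag) (k : ℤ) (p q : Fin n) :
    h k p q * cycleEigenvalue a' q =
      cycleEigenvalue a p * h (k + (N : ℤ) * (μ + 1 : ℕ)) p q := by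
  have hstep : ∀ k : ℤ, h k p q * a' k 0 q q = a k 0 p p * h (k + (μ + 1 : ℕ)) p q := by
    intro k
    have h1 := congr_fun (congr_fun (H k) p) q
    rw [Matrix.mul_apply, Matrix.mul_apply, Finset.sum_eq_single q, Finset.sum_eq_single p] at h1
    · exact h1
    · intro r _ hr
      rw [ha k hr.symm, zero_mul]
    · simp
    · intro r _ hr
      rw [ha' k hr, mul_zero]
    · simp
  have hind : ∀ j : ℕ,
      h k p q * ∏ i ∈ Finset.range j, a' ((k : ZMod N) + ((i * (μ + 1) : ℕ) : ZMod N)) 0 q q =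
      (∏ i ∈ Finset.range j, a ((k : ZMod N) + ((i * (μ + 1) : ℕ) : ZMod N)) 0 p p) *
        h (k + j * (μ + 1 : ℕ)) p q := by
    intro j
    induction j with
    | zero => simp
    | succ j ih =>
      have h2 := hstep (k + j * (μ + 1 : ℕ))
      rw [show ((k + j * (μ + 1 : ℕ) : ℤ) : ZMod N) =
        (k : ZMod N) + ((j * (μ + 1) : ℕ) : ZMod N) by push_cast; ring] at h2
      rw [Finset.prod_range_succ, Finset.prod_range_succ, ← mul_assoc, ih, mul_assoc, h2,
        show k + (j : ℤ) * (μ + 1 : ℕ) + (μ + 1 : ℕ) = k + ((j + 1 : ℕ) : ℤ) * (μ + 1 : ℕ) by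
          push_cast; ring, mul_assoc]
  have h3 := hind N
  rw [prod_range_step hmN (fun i => a' ((k : ZMod N) + i) 0 q q),
    prod_range_step hmN (fun i => a ((k : ZMod N) + i) 0 p p)] at h3
  have h4 := Equiv.prod_comp (Equiv.addLeft (k : ZMod N)) (fun i => a' i 0 q q)
  have h5 := Equiv.prod_comp (Equiv.addLeft (k : ZMod N)) (fun i => a i 0 p p)
  simp only [Equiv.coe_addLeft] at h4 h5
  rwa [h4, h5] at h3

theorem IntertwinesMatrix.cycleEigenvalue [NeZero N] (hmN : Nat.Coprime (μ + 1) N)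
    {h : ℤ → Matrix (Fin n) (Fin n) ℂ}
    {a a' : Coefficients (μ + 1) n N} (H : IntertwinesMatrix h a a')
    (ha : ∀ k, (a k 0).IsDiag) (ha' : ∀ k, (a' k 0).IsDiag) (k : ℤ) (p q : Fin n) :
    h k p q * _root_.cycleEigenvalue a' q =
      _root_.cycleEigenvalue a p * h (k + (N : ℤ) * (μ + 1 : ℕ)) p q :=
  mul_cycleEigenvalue hmN H.zero ha ha' k p q

theorem det_cyclicProduct_ne_zero {m : ℕ} {c : ZMod N → Matrix (Fin n) (Fin n) ℂ}
    (hc : ∀ k, (c k).det ≠ 0) (k : ZMod N) : (cyclicProduct m c k).det ≠ 0 := by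
  rw [cyclicProduct, ← Matrix.coe_detMonoidHom, map_list_prod]
  refine List.prod_ne_zero ?_
  simp only [List.map_ofFn, List.mem_ofFn, not_exists]
  exact fun j => hc _

theorem pow_mul_adjugate_pow (b : Matrix (Fin n) (Fin n) ℂ) (r : ℕ) :
    b ^ r * b.adjugate ^ r = b.det ^ r • 1 := by
  have hc : Commute b b.adjugate := by
    rw [Commute, SemiconjBy, Matrix.mul_adjugate, Matrix.adjugate_mul]
  rw [← hc.mul_pow, Matrix.mul_adjugate, smul_pow, one_pow]

theorem adjugate_pow_mul_pow (b : Matrix (Fin n) (Fin n) ℂ) (r : ℕ) :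
    b.adjugate ^ r * b ^ r = b.det ^ r • 1 := by
  have hc : Commute b.adjugate b := by
    rw [Commute, SemiconjBy, Matrix.mul_adjugate, Matrix.adjugate_mul]
  rw [← hc.mul_pow, Matrix.adjugate_mul, smul_pow, one_pow]

variable [NeZero N] [NeZero n]

/-- The stabilizer of a generic polygon is trivial. -/
theorem IsGeneric.stabilizer (hmN : Nat.Coprime (μ + 1) N) {a : Coefficients (μ + 1) n N}
    (ha : IsGeneric a) {s : ℤ → Matrix (Fin n) (Fin n) ℂ} (H : IntertwinesMatrix s a a) :
    ∃ x : ℂ, ∀ k : ℕ, s k = x • 1 := by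
  set b := cyclicProduct (μ + 1) (lastCoeff a) 0 with hb
  have hdet : b.det ≠ 0 := det_cyclicProduct_ne_zero ha.det_last 0
  -- Nothing is assumed about periodicity of `s`: multiplication by `b` exchanges `s_{qN}` with
  -- `s_{(q+1)N}`, and `hdiag` below exchanges `s_{qN}` with `s_{(q+m)N}`.
  have hpow : ∀ (q r : ℕ), s ((q : ℤ) * N) * b ^ r = b ^ r * s (((q + r : ℕ) : ℤ) * N) := by
    intro q r
    induction r with
    | zero => simp
    | succ r ih =>
      have h1 := H.cyclicProduct (((q + r : ℕ) : ℤ) * N)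
      rw [show ((((q + r : ℕ) : ℤ) * N : ℤ) : ZMod N) = 0 by push_cast; simp,
        show ((q + r : ℕ) : ℤ) * N + N = ((q + (r + 1) : ℕ) : ℤ) * N by push_cast; ring] at h1
      rw [pow_succ, ← mul_assoc, ih, mul_assoc, ← hb] at *
      rw [h1, mul_assoc]
  have hadj : ∀ r : ℕ, s ((r : ℤ) * N) * b.adjugate ^ r = b.adjugate ^ r * s 0 := by
    intro r
    have h1 := hpow 0 r
    rw [zero_add, Nat.cast_zero, zero_mul] at h1
    have h2 : b.adjugate ^ r * (s 0 * b ^ r) * b.adjugate ^ r =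
        b.adjugate ^ r * (b ^ r * s ((r : ℤ) * N)) * b.adjugate ^ r := by rw [h1]
    rw [← mul_assoc, mul_assoc _ (b ^ r), pow_mul_adjugate_pow, ← mul_assoc,
      adjugate_pow_mul_pow] at h2
    simp only [Matrix.mul_smul, Matrix.smul_mul, mul_one, one_mul] at h2
    exact (smul_right_injective _ (pow_ne_zero r hdet) h2).symm
  have hdiag : ∀ q : ℕ, s ((q : ℤ) * N) * Matrix.diagonal (cycleEigenvalue a) =
      Matrix.diagonal (cycleEigenvalue a) * s (((q + (μ + 1) : ℕ) : ℤ) * N) := by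
    intro q
    ext i j
    rw [Matrix.mul_diagonal, Matrix.diagonal_mul,
      H.cycleEigenvalue hmN ha.diagonal ha.diagonal ((q : ℤ) * N) i j,
      show (q : ℤ) * N + (N : ℤ) * (μ + 1 : ℕ) = ((q + (μ + 1) : ℕ) : ℤ) * N by push_cast; ring]
  -- Moving `s_0` through `b^j` turns it into `s_{jN}`, through the eigenvalues into `s_{(j+m)N}`,
  -- and the `j + m` adjugates bring it back to `s_0`. So `s_0` commutes with the matrices whose
  -- commutant is assumed trivial.
  obtain ⟨x, hx⟩ := ha.commutant (s 0) fun j => by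
    simp only [stabilizerMatrix, ← hb]
    have h1 := hpow 0 j
    rw [zero_add, Nat.cast_zero, zero_mul] at h1
    rw [← mul_assoc, ← mul_assoc, h1, mul_assoc (b ^ (j : ℕ)), hdiag, mul_assoc, mul_assoc,
      hadj, ← mul_assoc, ← mul_assoc, mul_assoc (b ^ (j : ℕ) * _)]
  refine ⟨x, fun k => ?_⟩
  -- The remaining `s_k` follow from `s_0` by the relations with the invertible `a_k^{m-1}`.
  induction k with
  | zero => exact hx
  | succ k ih =>
    have h1 := H.last (k - μ)
    rw [sub_add_cancel, ih, Matrix.smul_mul, one_mul] at h1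
    have h2 : lastCoeff a ((k - μ : ℤ) : ZMod N) * (x • 1) =
        lastCoeff a ((k - μ : ℤ) : ZMod N) * s (k + 1) := by
      rw [← h1, Matrix.mul_smul, mul_one]
    have hu : IsUnit (lastCoeff a ((k - μ : ℤ) : ZMod N)) := by
      rw [Matrix.isUnit_iff_isUnit_det]
      exact isUnit_iff_ne_zero.2 (ha.det_last _)
    rw [Nat.cast_succ]
    exact (hu.mul_left_cancel h2).symm

/-- Up to scalars, a generic polygon has only one monodromy. -/
theorem exists_intertwines_of_isGeneric (hmN : Nat.Coprime (μ + 1) N)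
    {p q : TwistedLiftSpace (μ + 1) n N} (hp : IsGeneric p.coeff)
    (H : p.toModuli = q.toModuli) :
    ∃ (h : ℤ → (Matrix (Fin n) (Fin n) ℂ)ˣ) (x : ℂ), x ^ ((μ + 1) * n) = 1 ∧
      (∀ k, (h (k + N) : Matrix (Fin n) (Fin n) ℂ) = x • (h k : Matrix (Fin n) (Fin n) ℂ)) ∧
      Intertwines h p.coeff q.coeff := by
  obtain ⟨g, h, hgh, hI⟩ := exists_intertwines H
  -- Both `p.1.2` and the conjugate by `g` of the monodromy of `q` are monodromies of the polygon of
  -- `p`. Their quotient `S` fixes all its vertices, and acts on the bases by `s k`.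
  let S : SLmn (μ + 1) n := p.1.2⁻¹ * g⁻¹ * q.1.2 * g
  let s : ℤ → (Matrix (Fin n) (Fin n) ℂ)ˣ := fun k => h (k + N) * (h k)⁻¹
  have hS : ∀ k, (S : Matrix (Fin (μ + 1) × Fin n) (Fin (μ + 1) × Fin n) ℂ) * p.1.1 k =
      p.1.1 k * (s k : Matrix (Fin n) (Fin n) ℂ) := by
    intro k
    have h1 := q.2.2.1 k
    rw [hgh, hgh, p.2.2.1] at h1
    have h2 : (g * p.1.2 * S : SLmn (μ + 1) n) = q.1.2 * g := by simp only [S]; group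
    have h3 : ((g * p.1.2 : SLmn (μ + 1) n) :
        Matrix (Fin (μ + 1) × Fin n) (Fin (μ + 1) × Fin n) ℂ) *
          ((S : Matrix (Fin (μ + 1) × Fin n) (Fin (μ + 1) × Fin n) ℂ) * p.1.1 k) =
        ((g * p.1.2 : SLmn (μ + 1) n) :
          Matrix (Fin (μ + 1) × Fin n) (Fin (μ + 1) × Fin n) ℂ) *
          (p.1.1 k * (s k : Matrix (Fin n) (Fin n) ℂ)) := by
      rw [← Matrix.mul_assoc, ← Matrix.SpecialLinearGroup.coe_mul, h2,
        Matrix.SpecialLinearGroup.coe_mul, Matrix.SpecialLinearGroup.coe_mul]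
      have h4 : ((h k : (Matrix (Fin n) (Fin n) ℂ)ˣ) : Matrix (Fin n) (Fin n) ℂ) *
          ((h k)⁻¹ : (Matrix (Fin n) (Fin n) ℂ)ˣ) = 1 := Units.mul_inv _
      have h5 := congr_arg (fun X => X * (((h k)⁻¹ : (Matrix (Fin n) (Fin n) ℂ)ˣ) :
        Matrix (Fin n) (Fin n) ℂ)) h1
      simp only [Matrix.mul_assoc, h4, Matrix.mul_one] at h5
      simp only [s, Units.val_mul, Matrix.mul_assoc]
      exact h5.symm
    have hu : IsUnit ((g * p.1.2 : SLmn (μ + 1) n) :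
        Matrix (Fin (μ + 1) × Fin n) (Fin (μ + 1) × Fin n) ℂ).det := by simp
    rw [← Matrix.nonsing_inv_mul_cancel_left _
      ((S : Matrix (Fin (μ + 1) × Fin n) (Fin (μ + 1) × Fin n) ℂ) * p.1.1 k) hu, h3,
      Matrix.nonsing_inv_mul_cancel_left _ _ hu]
  have hs : Intertwines s p.coeff p.coeff := by
    refine p.recursion.intertwines p.2.2.2 ?_
    simp_rw [← hS]
    exact p.recursion.mul_left _
  obtain ⟨x, hx⟩ := hp.stabilizer hmN (s := fun k => s k) hs
  have hSx : (S : Matrix (Fin (μ + 1) × Fin n) (Fin (μ + 1) × Fin n) ℂ) = x • 1 := by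
    have h1 : (S : Matrix (Fin (μ + 1) × Fin n) (Fin (μ + 1) × Fin n) ℂ) * frame p.1.1 0 =
        (x • 1) * frame p.1.1 0 := by
      rw [← frame_mul_left]
      ext r c
      simp only [frame, Matrix.of_apply, Matrix.smul_mul, Matrix.one_mul, Matrix.smul_apply, hS,
        zero_add]
      rw [hx]
      simp
    have hu : IsUnit (frame p.1.1 0).det := isUnit_iff_ne_zero.2 (p.2.2.2 0)
    rw [← Matrix.mul_nonsing_inv_cancel_right _
      (S : Matrix (Fin (μ + 1) × Fin n) (Fin (μ + 1) × Fin n) ℂ) hu, h1,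
      Matrix.mul_nonsing_inv_cancel_right _ _ hu]
  refine ⟨h, x, ?_, fun k => ?_, hI⟩
  · have h1 := congr_arg Matrix.det hSx
    rw [Matrix.SpecialLinearGroup.det_coe] at h1
    simpa [Matrix.det_smul] using h1.symm
  · have h1 : (s k : Matrix (Fin n) (Fin n) ℂ) = x • 1 := by
      apply mul_right_injective_of_col (p.2.1 k)
      rw [← hS, hSx]
      simp
    have h2 : h (k + N) = s k * h k := by simp [s]
    rw [h2, Units.val_mul, h1, Matrix.smul_mul, one_mul]

end Generic

/-! ### Stability of genericity, and the syzygies -/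

section Stability

variable {μ n N : ℕ}

theorem unit_diag_ne_zero {g : (Matrix (Fin n) (Fin n) ℂ)ˣ}
    (hg : (g : Matrix (Fin n) (Fin n) ℂ).IsDiag) (p : Fin n) :
    (g : Matrix (Fin n) (Fin n) ℂ) p p ≠ 0 := by
  have h := isUnit_iff_ne_zero.1 ((Matrix.isUnit_iff_isUnit_det _).1 g.isUnit)
  rw [← hg.diagonal_diag, Matrix.det_diagonal, Finset.prod_ne_zero_iff] at h
  exact h p (Finset.mem_univ _)

theorem diag_mul_apply {g X : Matrix (Fin n) (Fin n) ℂ} (hg : g.IsDiag) (p q : Fin n) :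
    (g * X) p q = g p p * X p q := by
  conv_lhs => rw [← hg.diagonal_diag, Matrix.diagonal_mul, Matrix.diag_apply]

theorem mul_diag_apply {g X : Matrix (Fin n) (Fin n) ℂ} (hg : g.IsDiag) (p q : Fin n) :
    (X * g) p q = X p q * g q q := by
  conv_lhs => rw [← hg.diagonal_diag, Matrix.mul_diagonal, Matrix.diag_apply]

theorem twisted_add_mul {h : ℤ → Matrix (Fin n) (Fin n) ℂ} {x : ℂ}
    (hx : ∀ k, h (k + N) = x • h k) (k : ℤ) (j : ℕ) : h (k + (N : ℤ) * j) = x ^ j • h k := by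
  induction j with
  | zero => simp
  | succ j ih =>
    rw [show k + (N : ℤ) * ((j + 1 : ℕ) : ℤ) = k + (N : ℤ) * j + N by push_cast; ring, hx, ih,
      smul_smul, pow_succ']

/-- The adjugate is homogeneous of degree `n - 1`. It replaces the inverse of `b` throughout, to
keep the stabilizer matrices polynomial in the coefficients. -/
theorem mul_adjugate_intertwines {h b b' : Matrix (Fin n) (Fin n) ℂ} {x : ℂ} [NeZero n]
    (hx : x ≠ 0) (hh : h.det ≠ 0) (hb : b.det ≠ 0) (H : h * b' = x • (b * h)) :
    h * b'.adjugate = x ^ (n - 1) • (b.adjugate * h) := by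
  have hdet : b'.det = x ^ n * b.det := by
    have h1 := congr_arg Matrix.det H
    rw [Matrix.det_mul, Matrix.det_smul, Matrix.det_mul, Fintype.card_fin] at h1
    apply mul_left_cancel₀ hh
    rw [h1]
    ring
  have h1 : b.adjugate * (h * b') * b'.adjugate = b.adjugate * (x • (b * h)) * b'.adjugate := by
    rw [H]
  rw [mul_assoc, mul_assoc h, Matrix.mul_adjugate, hdet] at h1
  simp only [Matrix.mul_smul, Matrix.smul_mul, mul_one] at h1
  rw [← mul_assoc b.adjugate, Matrix.adjugate_mul] at h1
  simp only [Matrix.smul_mul, one_mul, smul_smul] at h1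
  have hne : x * b.det ≠ 0 := mul_ne_zero hx hb
  apply smul_right_injective _ hne
  simp only
  rw [← h1, smul_smul]
  congr 1
  obtain ⟨k, rfl⟩ := Nat.exists_eq_succ_of_ne_zero (NeZero.ne n)
  rw [Nat.succ_sub_one, pow_succ]
  ring

theorem mul_pow_intertwines {h b b' : Matrix (Fin n) (Fin n) ℂ} {x : ℂ}
    (H : h * b' = x • (b * h)) (j : ℕ) : h * b' ^ j = x ^ j • (b ^ j * h) := by
  induction j with
  | zero => simp
  | succ j ih =>
    rw [pow_succ, ← mul_assoc, ih, Matrix.smul_mul, mul_assoc, H, Matrix.mul_smul, smul_smul,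
      ← mul_assoc, ← pow_succ, ← pow_succ]

variable [NeZero N] [NeZero n]

/-- A diagonal change of bases twisted by `x` multiplies all the eigenvalues by the same power of
`x`, and conjugates `b^k` and the stabilizer matrices up to non-zero factors. None of the conditions
notices this. -/
theorem IsGeneric.of_intertwines (hmN : Nat.Coprime (μ + 1) N) {a a' : Coefficients (μ + 1) n N}
    (ha : IsGeneric a) {h : ℤ → (Matrix (Fin n) (Fin n) ℂ)ˣ} (H : Intertwines h a a')
    (hdiag : ∀ k, (h k : Matrix (Fin n) (Fin n) ℂ).IsDiag) {x : ℂ} (hx : x ≠ 0)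
    (htw : ∀ k, (h (k + N) : Matrix (Fin n) (Fin n) ℂ) = x • (h k : Matrix (Fin n) (Fin n) ℂ))
    (hdet : ∀ k, (a' k 0).det = (-1) ^ (n * μ)) : IsGeneric a' := by
  have HM : IntertwinesMatrix (fun k => (h k : Matrix (Fin n) (Fin n) ℂ)) a a' := H
  have hne : ∀ k p, (h k : Matrix (Fin n) (Fin n) ℂ) p p ≠ 0 := fun k p =>
    unit_diag_ne_zero (hdiag k) p
  have hd' : ∀ k, (a' k 0).IsDiag := by
    intro k p q hpq
    obtain ⟨k, rfl⟩ := ZMod.intCast_surjective k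
    have h1 := congr_fun (congr_fun (HM.zero k) p) q
    rw [diag_mul_apply (hdiag k), mul_diag_apply (hdiag _), ha.diagonal k hpq, zero_mul] at h1
    exact (mul_eq_zero.1 h1).resolve_left (hne k p)
  have heig : ∀ p, cycleEigenvalue a' p = x ^ (μ + 1) * cycleEigenvalue a p := by
    intro p
    have h1 := HM.cycleEigenvalue hmN ha.diagonal hd' 0 p p
    have h2 := twisted_add_mul (h := fun k => (h k : Matrix (Fin n) (Fin n) ℂ)) htw 0 (μ + 1)
    rw [h2, Matrix.smul_apply, smul_eq_mul] at h1
    apply mul_left_cancel₀ (hne 0 p)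
    rw [h1]
    ring
  have hprod : ∀ k : ℤ, (h k : Matrix (Fin n) (Fin n) ℂ) * cyclicProduct (μ + 1) (lastCoeff a') k =
      x • (cyclicProduct (μ + 1) (lastCoeff a) k * (h k : Matrix (Fin n) (Fin n) ℂ)) := by
    intro k
    have h1 := HM.cyclicProduct k
    rw [h1, htw, Matrix.mul_smul]
  have hentry : ∀ (k : ZMod N) (p q : Fin n), cyclicProduct (μ + 1) (lastCoeff a) k p q ≠ 0 →
      cyclicProduct (μ + 1) (lastCoeff a') k p q ≠ 0 := by
    intro k p q h0 h1
    obtain ⟨k, rfl⟩ := ZMod.intCast_surjective k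
    have h2 := congr_fun (congr_fun (hprod k) p) q
    rw [diag_mul_apply (hdiag k), Matrix.smul_apply, mul_diag_apply (hdiag k), h1, mul_zero] at h2
    exact mul_ne_zero hx (mul_ne_zero h0 (hne k q)) h2.symm
  have hunit : ∀ k, (h k : Matrix (Fin n) (Fin n) ℂ).det ≠ 0 := fun k =>
    isUnit_iff_ne_zero.1 ((Matrix.isUnit_iff_isUnit_det _).1 (h k).isUnit)
  refine ⟨hd', hdet, fun p q hpq => ?_, fun k i hi => hentry _ _ _ (ha.super k i hi),
    fun k hi => hentry _ _ _ (ha.sub k hi), hentry _ _ _ ha.corner, fun k => ?_, fun y hy => ?_⟩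
  · rw [heig, heig, mul_pow, mul_pow]
    intro h1
    exact ha.eigenvalue p q hpq (mul_left_cancel₀ (pow_ne_zero _ (pow_ne_zero _ hx)) h1)
  · obtain ⟨k, rfl⟩ := ZMod.intCast_surjective k
    have h1 := congr_arg Matrix.det (H k (Fin.last μ))
    rw [Matrix.det_mul, Matrix.det_mul] at h1
    intro h0
    rw [h0, mul_zero] at h1
    exact mul_ne_zero (ha.det_last k) (hunit _) h1.symm
  · have hstab : ∀ j, ∃ κ : ℂ, κ ≠ 0 ∧ (h 0 : Matrix (Fin n) (Fin n) ℂ) * stabilizerMatrix a' j =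
        κ • (stabilizerMatrix a j * (h 0 : Matrix (Fin n) (Fin n) ℂ)) := by
      intro j
      have hb := hprod 0
      rw [Int.cast_zero] at hb
      have hadj := mul_adjugate_intertwines hx (hunit 0) (det_cyclicProduct_ne_zero ha.det_last 0) hb
      have hA : (h 0 : Matrix (Fin n) (Fin n) ℂ) * Matrix.diagonal (cycleEigenvalue a') =
          x ^ (μ + 1) • (Matrix.diagonal (cycleEigenvalue a) *
            (h 0 : Matrix (Fin n) (Fin n) ℂ)) := by
        ext p q
        rw [Matrix.mul_diagonal, Matrix.smul_apply, Matrix.diagonal_mul, heig, smul_eq_mul]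
        by_cases hpq : p = q
        · subst hpq; ring
        · rw [hdiag 0 hpq]; ring
      refine ⟨x ^ (j : ℕ) * x ^ (μ + 1) * (x ^ (n - 1)) ^ ((j : ℕ) + (μ + 1)), by positivity, ?_⟩
      simp only [stabilizerMatrix]
      rw [← mul_assoc, ← mul_assoc, mul_pow_intertwines hb, Matrix.smul_mul, mul_assoc (_ ^ (j : ℕ)),
        hA, Matrix.smul_mul, Matrix.mul_smul, Matrix.smul_mul, ← mul_assoc, mul_assoc _ (h 0).val,
        mul_pow_intertwines hadj, Matrix.mul_smul, smul_smul, smul_smul, mul_assoc]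
      simp only [mul_assoc]
    obtain ⟨c, hc⟩ := ha.commutant ((h 0 : Matrix (Fin n) (Fin n) ℂ) * y *
        ((h 0)⁻¹ : (Matrix (Fin n) (Fin n) ℂ)ˣ)) (fun j => by
      obtain ⟨κ, hκ, h1⟩ := hstab j
      have h2 : stabilizerMatrix a' j = κ • ((((h 0)⁻¹ : (Matrix (Fin n) (Fin n) ℂ)ˣ) :
          Matrix (Fin n) (Fin n) ℂ) * stabilizerMatrix a j * (h 0 : Matrix (Fin n) (Fin n) ℂ)) := by
        rw [mul_assoc, ← Matrix.mul_smul, ← h1, Units.inv_mul_cancel_left]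
      have h3 := hy j
      rw [h2, Matrix.mul_smul, Matrix.smul_mul] at h3
      have h4 := smul_right_injective _ hκ h3
      have h5 := congr_arg (fun X => (h 0 : Matrix (Fin n) (Fin n) ℂ) * X *
        (((h 0)⁻¹ : (Matrix (Fin n) (Fin n) ℂ)ˣ) : Matrix (Fin n) (Fin n) ℂ)) h4
      simpa [mul_assoc] using h5)
    refine ⟨c, ?_⟩
    have h1 : y = (((h 0)⁻¹ : (Matrix (Fin n) (Fin n) ℂ)ˣ) : Matrix (Fin n) (Fin n) ℂ) *
        ((h 0 : Matrix (Fin n) (Fin n) ℂ) * y *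
          ((h 0)⁻¹ : (Matrix (Fin n) (Fin n) ℂ)ˣ)) * (h 0 : Matrix (Fin n) (Fin n) ℂ) := by
      simp [mul_assoc]
    rw [h1, hc]
    simp

/-- The diagonal change of bases that makes the entries above the diagonal of a matrix equal to
the entry in the place `(2, 1)`. -/
theorem exists_diagonal_syzygy {b : Matrix (Fin n) (Fin n) ℂ}
    (hsup : ∀ (i : ℕ) (hi : i + 1 < n), b ⟨i, by omega⟩ ⟨i + 1, hi⟩ ≠ 0)
    (hsub : ∀ (hi : 1 < n), b ⟨1, hi⟩ ⟨0, by omega⟩ ≠ 0) :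
    ∃ t : Fin n → ℂ, (∏ p, t p = 1) ∧ ∀ (i : ℕ) (hi : i + 1 < n),
      (t ⟨i, by omega⟩)⁻¹ * b ⟨i, by omega⟩ ⟨i + 1, hi⟩ * t ⟨i + 1, hi⟩ =
        (t ⟨1, by omega⟩)⁻¹ * b ⟨1, by omega⟩ ⟨0, by omega⟩ * t ⟨0, by omega⟩ := by
  let β : ℕ → ℂ := fun i => if hi : i + 1 < n then b ⟨i, by omega⟩ ⟨i + 1, hi⟩ else 1
  have hβ : ∀ i, β i ≠ 0 := by
    intro i
    simp only [β]
    split_ifs with hi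
    · exact hsup i hi
    · exact one_ne_zero
  let γ : ℂ := if hi : 1 < n then b ⟨1, hi⟩ ⟨0, by omega⟩ else 1
  have hγ : γ ≠ 0 := by
    simp only [γ]
    split_ifs with hi
    · exact hsub hi
    · exact one_ne_zero
  -- Let `w` be the common value of the transformed entries. Then `t_{i+1} / t_i = w / β_i`, and the
  -- entry `(2,1)` becomes `γ β_0 / w`, so that `w² = γ β_0`.
  obtain ⟨w, hw⟩ := IsAlgClosed.exists_pow_nat_eq (γ * β 0) (n := 2) (by norm_num)
  have hw0 : w ≠ 0 := by
    rintro rfl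
    exact mul_ne_zero hγ (hβ 0) (by rw [← hw]; norm_num)
  let u : ℕ → ℂ := fun i => ∏ j ∈ Finset.range i, w / β j
  have hu : ∀ i, u i ≠ 0 := fun i => Finset.prod_ne_zero_iff.2 fun j _ => div_ne_zero hw0 (hβ j)
  obtain ⟨s, hs, hsd⟩ := exists_pow_mul_eq_one (NeZero.ne n)
    (Finset.prod_ne_zero_iff.2 fun (p : Fin n) _ => hu p)
  refine ⟨fun p => s * u p, ?_, fun i hi => ?_⟩
  · rw [Finset.prod_mul_distrib]
    simpa using hsd
  · have h1 : b ⟨i, by omega⟩ ⟨i + 1, hi⟩ = β i := by simp only [β, dif_pos hi]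
    have h2 : b ⟨1, by omega⟩ ⟨0, by omega⟩ = γ := by
      simp only [γ]; rw [dif_pos (by omega)]
    have h3 : u (i + 1) = u i * (w / β i) := Finset.prod_range_succ _ _
    have h4 : u 1 = w / β 0 := by simp [u]
    have h5 : u 0 = 1 := by simp [u]
    simp only
    rw [h1, h2, h3, h4, h5]
    have := hβ i
    have := hβ 0
    have := hu i
    field_simp
    rw [hw]
    ring

/-- A normalized lift with generic coefficients has a diagonal change of bases to a lift that
satisfies the syzygies. -/
theorem TwistedLiftSpace.exists_syzygies (hmN : Nat.Coprime (μ + 1) N)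
    {p : TwistedLiftSpace (μ + 1) n N} (hp : ∀ k, (frame p.1.1 k).det = 1)
    (ha : IsGeneric p.coeff) :
    ∃ q : TwistedLiftSpace (μ + 1) n N, q.toPolygon = p.toPolygon ∧ q.1.2 = p.1.2 ∧
      (∀ k, (frame q.1.1 k).det = 1) ∧ IsGeneric q.coeff ∧
      Syzygies (μ + 1) (lastCoeff q.coeff) := by
  choose t ht ht' using fun k => exists_diagonal_syzygy (ha.super k) (ha.sub k)
  have hdet : ∀ k, (Matrix.diagonal (t k)).det = 1 := fun k => by rw [Matrix.det_diagonal, ht]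
  have ht0 : ∀ k p, t k p ≠ 0 := fun k p h0 => by
    have := ht k
    rw [Finset.prod_eq_zero (Finset.mem_univ p) h0] at this
    exact zero_ne_one this
  let g : ZMod N → (Matrix (Fin n) (Fin n) ℂ)ˣ := fun k =>
    Matrix.nonsingInvUnit (Matrix.diagonal (t k)) (by rw [hdet]; exact isUnit_one)
  have hg : ∀ k, (g k : Matrix (Fin n) (Fin n) ℂ) = Matrix.diagonal (t k) := fun k => rfl
  have hframe : ∀ k, (frame (p.gauge g).1.1 k).det = 1 := fun k => by
    rw [p.det_frame_gauge, hp, one_mul]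
    exact Finset.prod_eq_one fun i _ => hdet _
  have hI := p.intertwines_gauge g
  refine ⟨p.gauge g, p.toPolygon_gauge g, rfl, hframe, ?_, ?_⟩
  · refine ha.of_intertwines hmN hI (fun k => ?_) one_ne_zero (fun k => ?_)
      (TwistedLiftSpace.det_coeff_zero hframe)
    · simp only [hg]
      exact Matrix.isDiag_diagonal _
    · simp
  · intro k i hi
    have hk : ∀ p' q', t k p' * cyclicProduct (μ + 1) (lastCoeff (p.gauge g).coeff) k p' q' =
        cyclicProduct (μ + 1) (lastCoeff p.coeff) k p' q' * t k q' := by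
      intro p' q'
      obtain ⟨k, rfl⟩ := ZMod.intCast_surjective k
      have h1 := IntertwinesMatrix.cyclicProduct
        (h := fun k => (g (k : ZMod N) : Matrix (Fin n) (Fin n) ℂ)) hI k
      have h2 := congr_fun (congr_fun h1 p') q'
      simp only [hg, Matrix.diagonal_mul, Matrix.mul_diagonal] at h2
      simpa using h2
    have hk' : ∀ p' q', cyclicProduct (μ + 1) (lastCoeff (p.gauge g).coeff) k p' q' =
        (t k p')⁻¹ * cyclicProduct (μ + 1) (lastCoeff p.coeff) k p' q' * t k q' := by
      intro p' q'
      rw [mul_assoc, ← hk, inv_mul_cancel_left₀ (ht0 k p')]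
    rw [hk', hk']
    exact ht' k i hi

/-- The classes of the polygons with generic coefficients. -/
def genericLocus (μ n N : ℕ) [NeZero N] [NeZero n] : Set (ModuliSpace (μ + 1) n N) :=
  {x | ∃ p : TwistedLiftSpace (μ + 1) n N, (∀ k, (frame p.1.1 k).det = 1) ∧ IsGeneric p.coeff ∧
    p.toModuli = x}

/-- A lift with the given monodromy is related to a generic one by `h` with `h_{k+N} = x h_k`.
Multiplying `h_k⁻¹` by `θ^{-k}`, where `θ^N = x⁻¹`, gives a periodic change of bases. After it, only
scalars separate the two lifts, and genericity is transferred. -/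
theorem exists_generic_lift (hmN : Nat.Coprime (μ + 1) N) {φ : RegularPolygon (μ + 1) n N}
    (hφ : ModuliSpace.mk φ ∈ genericLocus μ n N) {M : SLmn (μ + 1) n} (hM : φ.1.IsMonodromy M) :
    ∃ p : TwistedLiftSpace (μ + 1) n N, p.toPolygon = φ ∧ p.1.2 = M ∧
      (∀ k, (frame p.1.1 k).det = 1) ∧ IsGeneric p.coeff ∧
      Syzygies (μ + 1) (lastCoeff p.coeff) := by
  obtain ⟨p, hp, hgen, hpφ⟩ := hφ
  obtain ⟨V, hV⟩ := hM.exists_lift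
  obtain ⟨q, hq, hqφ⟩ := hV.exists_toPolygon
  obtain ⟨h, x, hx, htw, hI⟩ := exists_intertwines_of_isGeneric hmN hgen (q := q) (by
    rw [hpφ, TwistedLiftSpace.toModuli, hqφ])
  have hx0 : x ≠ 0 := by
    rintro rfl
    rw [zero_pow (NeZero.ne _)] at hx
    exact zero_ne_one hx
  obtain ⟨θ, hθ⟩ := IsAlgClosed.exists_pow_nat_eq x⁻¹ (NeZero.pos N)
  have hθ0 : θ ≠ 0 := by
    rintro rfl
    rw [zero_pow (NeZero.ne N)] at hθ
    exact inv_ne_zero hx0 hθ.symm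
  let u : ℂˣ := Units.mk0 θ hθ0
  have hper : ∀ k : ℤ, (h (k + N))⁻¹ * (u ^ (-(k + N) : ℤ) • 1) =
      (h k)⁻¹ * (u ^ (-k : ℤ) • (1 : (Matrix (Fin n) (Fin n) ℂ)ˣ)) := by
    intro k
    have h1 : h (k + N) = (Units.mk0 x hx0) • h k := Units.ext (htw k)
    have h2 : u ^ (N : ℤ) = (Units.mk0 x hx0)⁻¹ := by
      apply Units.ext
      simp [u, hθ]
    rw [h1, neg_add, zpow_add, zpow_neg u (N : ℤ), h2, inv_inv]
    apply Units.ext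
    simp [Units.smul_def, smul_smul, mul_comm, hx0]
  let g : ZMod N → (Matrix (Fin n) (Fin n) ℂ)ˣ := fun k =>
    (h (k.val : ℤ))⁻¹ * (u ^ (-(k.val : ℤ)) • 1)
  have hg : ∀ k : ℤ, g (k : ZMod N) = (h k)⁻¹ * (u ^ (-k) • 1) := fun k =>
    eq_of_periodic (N := N) (f := fun k : ℤ => (h k)⁻¹ *
      (u ^ (-k) • (1 : (Matrix (Fin n) (Fin n) ℂ)ˣ))) hper (by simp)
  obtain ⟨c, hc⟩ := (q.gauge g).exists_normalized hmN
  set r := (q.gauge g).gauge fun k => c k • 1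
  have hrI := (hI.trans (q.intertwines_gauge g)).trans
    ((q.gauge g).intertwines_gauge fun k => c k • 1)
  have hval : ∀ k : ℤ, ((h k * g k * (c k • 1) : (Matrix (Fin n) (Fin n) ℂ)ˣ) :
      Matrix (Fin n) (Fin n) ℂ) = ((u ^ (-k) * c k : ℂˣ) : ℂ) • 1 := by
    intro k
    rw [hg, mul_inv_cancel_left]
    simp [Units.smul_def, smul_smul, mul_comm]
  have hrgen : IsGeneric r.coeff := by
    refine hgen.of_intertwines hmN hrI (x := x) (fun k => ?_) hx0 (fun k => ?_)
      (TwistedLiftSpace.det_coeff_zero hc)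
    · rw [hval]
      exact Matrix.isDiag_smul_one _ _
    · rw [hval, hval, smul_smul]
      congr 1
      simp only [Units.val_mul, u, neg_add, zpow_add, zpow_neg]
      simp [hθ, mul_comm, mul_left_comm]
  obtain ⟨s, h1, h2, h3, h4, h5⟩ := r.exists_syzygies hmN hc hrgen
  refine ⟨s, ?_, ?_, h3, h4, h5⟩
  · rw [h1, TwistedLiftSpace.toPolygon_gauge, TwistedLiftSpace.toPolygon_gauge, hqφ]
  · rw [h2]
    change q.1.2 = M
    rw [hq]

theorem IsGeneric.isGenericNormalForm {a : Coefficients (μ + 1) n N} (ha : IsGeneric a)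
    (hs : Syzygies (μ + 1) (lastCoeff a)) : IsGenericNormalForm a := by
  refine ⟨fun k i hi => ?_, fun k i hi => ?_, fun i hi => ?_⟩
  · rw [show i = 0 from Fin.ext hi]
    exact ha.diagonal k
  · rw [show i = 0 from Fin.ext hi]
    exact ha.det_zero k
  · rw [show i = Fin.last μ from Fin.ext (by simpa using hi)]
    exact hs

end Stability

/-! ### The inverse function theorem -/

section LocalInverse

open Filter Topology

theorem exists_local_inverse {E F : Type*} [NormedAddCommGroup E] [NormedSpace ℂ E]
    [NormedAddCommGroup F] [NormedSpace ℂ F] [FiniteDimensional ℂ E] [FiniteDimensional ℂ F]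
    {f : E → F} (hf : ContDiff ℂ 1 f) {x : E} (hinj : ∀ v, fderiv ℂ f x v = 0 → v = 0)
    (hdim : Module.finrank ℂ E = Module.finrank ℂ F) :
    ∃ g : F → E, (∀ᶠ y in 𝓝 x, g (f y) = y) ∧ (∀ᶠ z in 𝓝 (f x), f (g z) = z) ∧
      ∀ᶠ z in 𝓝 (f x), DifferentiableAt ℂ g z := by
  have : CompleteSpace E := FiniteDimensional.complete ℂ E
  let L : E ≃L[ℂ] F := (LinearEquiv.ofInjectiveOfFinrankEq (fderiv ℂ f x).toLinearMap
    (by rw [← LinearMap.ker_eq_bot, LinearMap.ker_eq_bot']; exact hinj) hdim).toContinuousLinearEquiv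
  have hL : HasFDerivAt f (L : E →L[ℂ] F) x := by
    have : (L : E →L[ℂ] F) = fderiv ℂ f x := by ext v; rfl
    rw [this]
    exact ((hf.differentiable one_ne_zero) x).hasFDerivAt
  have hs : HasStrictFDerivAt f (L : E →L[ℂ] F) x :=
    hf.contDiffAt.hasStrictFDerivAt' hL one_ne_zero
  refine ⟨hs.localInverse f L x, hs.eventually_left_inverse, hs.eventually_right_inverse, ?_⟩
  have hc : ContDiffAt ℂ 1 (hs.localInverse f L x) (f x) :=
    ContDiffAt.to_localInverse hf.contDiffAt hL one_ne_zero
  filter_upwards [hc.eventually (by simp)] with z hz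
  exact hz.differentiableAt one_ne_zero

end LocalInverse

/-! ### Derivatives along lines of matrices -/

section MatrixDerivative

variable {n : ℕ}

theorem hasDerivAt_matrix_mul {X Y : ℂ → Matrix (Fin n) (Fin n) ℂ}
    {X' Y' : Matrix (Fin n) (Fin n) ℂ} {t : ℂ}
    (hX : ∀ p q, HasDerivAt (fun s => X s p q) (X' p q) t)
    (hY : ∀ p q, HasDerivAt (fun s => Y s p q) (Y' p q) t) (p q : Fin n) :
    HasDerivAt (fun s => (X s * Y s) p q) ((X' * Y t + X t * Y') p q) t := by
  simp only [Matrix.mul_apply, Matrix.add_apply, ← Finset.sum_add_distrib]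
  exact HasDerivAt.fun_sum fun r _ => (hX p r).mul (hY r q)

theorem hasDerivAt_one_add_smul (τ : Matrix (Fin n) (Fin n) ℂ) (t : ℂ) (p q : Fin n) :
    HasDerivAt (fun s : ℂ => (1 + s • τ : Matrix (Fin n) (Fin n) ℂ) p q) (τ p q) t := by
  simp only [Matrix.add_apply, Matrix.smul_apply, smul_eq_mul]
  simpa using ((hasDerivAt_id t).mul_const (τ p q)).const_add ((1 : Matrix (Fin n) (Fin n) ℂ) p q)

attribute [local instance] Matrix.normedAddCommGroup Matrix.normedSpace

/-- Differentiate `adj(A) A = det(A) 1` at the identity. The value of `δ` plays no role later: it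
only multiplies terms that vanish. -/
theorem exists_hasDerivAt_adjugate (τ : Matrix (Fin n) (Fin n) ℂ) :
    ∃ δ : ℂ, ∀ p q, HasDerivAt (fun s : ℂ => (1 + s • τ : Matrix (Fin n) (Fin n) ℂ).adjugate p q)
      ((δ • 1 - τ) p q) 0 := by
  have hline : Differentiable ℂ fun s : ℂ => (1 + s • τ : Matrix (Fin n) (Fin n) ℂ) :=
    fun t => differentiableAt_matrix.2 fun p q =>
      (hasDerivAt_one_add_smul τ t p q).differentiableAt
  have hadj : ∀ p q, HasDerivAt (fun s : ℂ => (1 + s • τ : Matrix (Fin n) (Fin n) ℂ).adjugate p q)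
      ((Matrix.of fun p q => deriv (fun s : ℂ =>
        (1 + s • τ : Matrix (Fin n) (Fin n) ℂ).adjugate p q) 0) p q) 0 := fun p q =>
    (differentiableAt_matrix.1 (hline 0).matrix_adjugate p q).hasDerivAt
  have hdet := (hline 0).matrix_det.hasDerivAt
  refine ⟨deriv (fun s : ℂ => (1 + s • τ : Matrix (Fin n) (Fin n) ℂ).det) 0, fun p q => ?_⟩
  have h1 := hasDerivAt_matrix_mul hadj (hasDerivAt_one_add_smul τ 0) p q
  simp only [Matrix.adjugate_mul, Matrix.smul_apply, zero_smul, add_zero, Matrix.adjugate_one,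
    mul_one, one_mul] at h1
  have h2 := hdet.smul_const ((1 : Matrix (Fin n) (Fin n) ℂ) p q)
  have h3 := h1.unique h2
  have h4 := hadj p q
  rw [Matrix.add_apply] at h3
  rw [eq_sub_of_add_eq h3] at h4
  exact h4

theorem hasDerivAt_conj_adjugate {τ : Matrix (Fin n) (Fin n) ℂ} {δ : ℂ}
    (hδ : ∀ p q, HasDerivAt (fun s : ℂ => (1 + s • τ : Matrix (Fin n) (Fin n) ℂ).adjugate p q)
      ((δ • 1 - τ) p q) 0) (B τ' : Matrix (Fin n) (Fin n) ℂ) (p q : Fin n) :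
    HasDerivAt (fun s : ℂ => ((1 + s • τ : Matrix (Fin n) (Fin n) ℂ).adjugate * B *
      (1 + s • τ' : Matrix (Fin n) (Fin n) ℂ)) p q) ((δ • B - τ * B + B * τ') p q) 0 := by
  have h1 := hasDerivAt_matrix_mul (X := fun _ => B) (X' := 0) (t := 0)
    (fun p q => hasDerivAt_const _ _) (hasDerivAt_one_add_smul τ' 0)
  have h2 := hasDerivAt_matrix_mul hδ h1 p q
  simp only [zero_smul, add_zero, Matrix.adjugate_one, mul_one, one_mul, zero_add,
    sub_mul, Matrix.smul_mul] at h2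
  simpa only [Matrix.mul_assoc] using h2

theorem contDiff_list_prod {E : Type*} [NormedAddCommGroup E] [NormedSpace ℂ E] {r : WithTop ℕ∞}
    (l : List (E → Matrix (Fin n) (Fin n) ℂ)) (hl : ∀ f ∈ l, ContDiff ℂ r f) :
    ContDiff ℂ r fun x => (l.map fun f => f x).prod := by
  induction l with
  | nil => simpa using contDiff_const
  | cons f l ih =>
    simp only [List.map_cons, List.prod_cons]
    exact (hl f (by simp)).matrix_mul (ih fun g hg => hl g (by simp [hg]))

theorem contDiff_cyclicProduct {N : ℕ} {E : Type*} [NormedAddCommGroup E] [NormedSpace ℂ E]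
    {r : WithTop ℕ∞} (m : ℕ) {c : E → ZMod N → Matrix (Fin n) (Fin n) ℂ}
    (hc : ∀ k, ContDiff ℂ r fun x => c x k) (k : ZMod N) :
    ContDiff ℂ r fun x => cyclicProduct m (c x) k := by
  have := contDiff_list_prod (r := r)
    (List.ofFn fun j : Fin N => fun x => c x (k - (m : ZMod N) + 1 + ((j : ℕ) : ZMod N)))
    (by
      intro f hf
      obtain ⟨j, rfl⟩ := (List.mem_ofFn' _ _).1 hf
      exact hc _)
  simp only [List.map_ofFn, Function.comp_def] at this
  exact this

end MatrixDerivative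

/-! ### The slice transverse to the changes of bases -/

section Slice

open Filter Topology

attribute [local instance] Matrix.normedAddCommGroup Matrix.normedSpace

variable {μ n N : ℕ}

/-- The linear forms `X_{i,i+1} - X_{2,1}`, indexed by `i + 1`. -/
def syzygyForm (X : Matrix (Fin n) (Fin n) ℂ) (p : Fin n) : ℂ :=
  if h : (p : ℕ) = 0 then 0 else X ⟨p - 1, by omega⟩ p - X ⟨1, by omega⟩ ⟨0, by omega⟩

theorem syzygies_iff {m : ℕ} {c : ZMod N → Matrix (Fin n) (Fin n) ℂ} :
    Syzygies m c ↔ ∀ k p, syzygyForm (cyclicProduct m c k) p = 0 := by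
  constructor
  · intro h k p
    unfold syzygyForm
    split_ifs with hp
    · rfl
    · have h1 := h k (p - 1) (by omega)
      rw [sub_eq_zero, ← h1]
      congr 1
      ext
      simp only
      omega
  · intro h k i hi
    have h1 := h k ⟨i + 1, hi⟩
    rw [syzygyForm, dif_neg (by simp)] at h1
    exact sub_eq_zero.1 h1

theorem syzygyForm_add (X Y : Matrix (Fin n) (Fin n) ℂ) (p : Fin n) :
    syzygyForm (X + Y) p = syzygyForm X p + syzygyForm Y p := by
  unfold syzygyForm
  split_ifs
  · simp
  · simp only [Matrix.add_apply]; ring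

theorem syzygyForm_smul (x : ℂ) (X : Matrix (Fin n) (Fin n) ℂ) (p : Fin n) :
    syzygyForm (x • X) p = x * syzygyForm X p := by
  unfold syzygyForm
  split_ifs
  · simp
  · simp only [Matrix.smul_apply, smul_eq_mul]; ring

theorem contDiff_syzygyForm {E : Type*} [NormedAddCommGroup E] [NormedSpace ℂ E] {r : WithTop ℕ∞}
    {X : E → Matrix (Fin n) (Fin n) ℂ} (hX : ContDiff ℂ r X) (p : Fin n) :
    ContDiff ℂ r fun x => syzygyForm (X x) p := by
  unfold syzygyForm
  split_ifs
  · exact contDiff_const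
  · exact (contDiff_matrix.1 hX _ _).sub (contDiff_matrix.1 hX _ _)

theorem hasDerivAt_syzygyForm {X : ℂ → Matrix (Fin n) (Fin n) ℂ}
    {X' : Matrix (Fin n) (Fin n) ℂ} {t : ℂ}
    (hX : ∀ p q, HasDerivAt (fun s => X s p q) (X' p q) t) (p : Fin n) :
    HasDerivAt (fun s => syzygyForm (X s) p) (syzygyForm X' p) t := by
  unfold syzygyForm
  split_ifs
  · exact hasDerivAt_const _ _
  · exact (hX _ _).sub (hX _ _)

/-- A diagonal matrix whose commutator with `b` satisfies the linearized syzygies is scalar. -/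
theorem eq_of_syzygyForm_commutator {b τ : Matrix (Fin n) (Fin n) ℂ} (hτ : τ.IsDiag)
    (hb : ∀ p, syzygyForm b p = 0) (h0 : ∀ hi : 1 < n, b ⟨1, hi⟩ ⟨0, by omega⟩ ≠ 0)
    (h : ∀ p, syzygyForm (b * τ - τ * b) p = 0) (p q : Fin n) : τ p p = τ q q := by
  -- The entries of `b` in question all equal `b_{2,1} ≠ 0`, which divides out. The case `i = 0`
  -- reads `τ_1 - τ_0 = τ_0 - τ_1`, so all the differences vanish.
  have key : ∀ (i : ℕ) (hi : i + 1 < n), τ ⟨i + 1, hi⟩ ⟨i + 1, hi⟩ - τ ⟨i, by omega⟩ ⟨i, by omega⟩ =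
      τ ⟨0, by omega⟩ ⟨0, by omega⟩ - τ ⟨1, by omega⟩ ⟨1, by omega⟩ := by
    intro i hi
    have h1 := h ⟨i + 1, hi⟩
    have h2 := hb ⟨i + 1, hi⟩
    rw [syzygyForm, dif_neg (by simp)] at h1 h2
    simp only [Nat.add_sub_cancel, Matrix.sub_apply, mul_diag_apply hτ, diag_mul_apply hτ] at h1 h2
    rw [sub_eq_zero] at h2
    rw [h2] at h1
    have h3 := h0 (by omega)
    apply mul_left_cancel₀ h3
    linear_combination h1
  have hall : ∀ (i : ℕ) (hi : i < n), τ ⟨i, hi⟩ ⟨i, hi⟩ = τ ⟨0, by omega⟩ ⟨0, by omega⟩ := by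
    intro i
    induction i with
    | zero => intro _; rfl
    | succ i ih =>
      intro hi
      have h1 := key i hi
      have h2 := key 0 (by omega)
      rw [ih (by omega)] at h1
      simp only [zero_add] at h2
      linear_combination h1 + (1 / 2 : ℂ) * (-h2)
  exact (hall p p.2).trans (hall q q.2).symm

variable [NeZero N] [NeZero n]

/-- The equations of the slice: a change of bases `g` brings `a` to normal form, up to scalars,
when they vanish. -/
noncomputable def sliceMap (a : Coefficients (μ + 1) n N)
    (g : ZMod N → Matrix (Fin n) (Fin n) ℂ) : ZMod N → Matrix (Fin n) (Fin n) ℂ := fun k =>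
  -- The `n` diagonal places hold the `n - 1` syzygies (`p ≠ 0`) and the condition that `g_k` has
  -- first entry `1` (`p = 0`), which removes the scalars. There are thus as many equations as
  -- unknowns.
  Matrix.of fun p q => if p = q then
    syzygyForm ((g k).adjugate * cyclicProduct (μ + 1) (lastCoeff a) k * g k) p +
      (if p = 0 then g k 0 0 - 1 else 0)
    else ((g k).adjugate * a k 0 * g (k + (μ + 1 : ℕ))) p q

theorem contDiff_sliceMap {r : WithTop ℕ∞} :
    ContDiff ℂ r fun x : Coefficients (μ + 1) n N × (ZMod N → Matrix (Fin n) (Fin n) ℂ) =>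
      sliceMap x.1 x.2 := by
  have hg : ∀ k, ContDiff ℂ r
      fun x : Coefficients (μ + 1) n N × (ZMod N → Matrix (Fin n) (Fin n) ℂ) => x.2 k := fun k =>
    contDiff_pi.1 contDiff_snd k
  have ha : ∀ k i, ContDiff ℂ r
      fun x : Coefficients (μ + 1) n N × (ZMod N → Matrix (Fin n) (Fin n) ℂ) => x.1 k i :=
    fun k i => contDiff_pi.1 (contDiff_pi.1 contDiff_fst k) i
  refine contDiff_pi.2 fun k => contDiff_matrix.2 fun p q => ?_
  simp only [sliceMap, Matrix.of_apply]
  by_cases hpq : p = q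
  · simp only [if_pos hpq]
    refine ContDiff.add (contDiff_syzygyForm (((contDiff_adjugate.comp (hg k)).matrix_mul
      (contDiff_cyclicProduct _ (fun k => ha k _) k)).matrix_mul (hg k)) p) ?_
    by_cases hp : p = 0
    · simp only [if_pos hp]
      exact (contDiff_matrix.1 (hg k) 0 0).sub contDiff_const
    · simp only [if_neg hp]
      exact contDiff_const
  · simp only [if_neg hpq]
    exact contDiff_matrix.1 (((contDiff_adjugate.comp (hg k)).matrix_mul (ha k 0)).matrix_mul
      (hg _)) p q

theorem sliceMap_one {a : Coefficients (μ + 1) n N} (hd : ∀ k, (a k 0).IsDiag)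
    (hs : Syzygies (μ + 1) (lastCoeff a)) : sliceMap a 1 = 0 := by
  funext k
  ext p q
  simp only [sliceMap, Matrix.of_apply, Pi.one_apply, Matrix.adjugate_one, one_mul, mul_one]
  split_ifs with h1 h2
  · rw [syzygies_iff.1 hs]; simp
  · rw [syzygies_iff.1 hs]; simp
  · exact hd k h1

/-- The slice is transverse to the orbits of the changes of bases. -/
theorem IsGeneric.sliceMap_transverse (hmN : Nat.Coprime (μ + 1) N) {a : Coefficients (μ + 1) n N}
    (ha : IsGeneric a) (hs : Syzygies (μ + 1) (lastCoeff a))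
    {τ : ZMod N → Matrix (Fin n) (Fin n) ℂ}
    (hτ : ∀ k p q, HasDerivAt (fun t : ℂ => sliceMap a (1 + t • τ) k p q) 0 0) : τ = 0 := by
  choose δ hδ using fun k => exists_hasDerivAt_adjugate (τ k)
  have hoff : ∀ k p q, p ≠ q →
      τ k p q * a k 0 q q = a k 0 p p * τ (k + (μ + 1 : ℕ)) p q := by
    intro k p q hpq
    have h1 := hasDerivAt_conj_adjugate (hδ k) (a k 0) (τ (k + (μ + 1 : ℕ))) p q
    have h2 := hτ k p q
    simp only [sliceMap, Matrix.of_apply, if_neg hpq, Pi.add_apply, Pi.one_apply,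
      Pi.smul_apply] at h2
    have h3 := h1.unique h2
    rw [Matrix.add_apply, Matrix.sub_apply, Matrix.smul_apply, ha.diagonal k hpq,
      mul_diag_apply (ha.diagonal k), diag_mul_apply (ha.diagonal k)] at h3
    simp only [smul_zero, zero_sub] at h3
    linear_combination -h3
  have hdiag : ∀ k, (τ k).IsDiag := by
    -- The off-diagonal part of `τ` is periodic, so going once around the cycle multiplies its
    -- entries by quotients of distinct eigenvalues; hence it vanishes.
    let σ : ℤ → Matrix (Fin n) (Fin n) ℂ := fun k =>
      Matrix.of fun p q => if p = q then 0 else τ (k : ZMod N) p q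
    have hσ : ∀ k : ℤ, σ k * a k 0 = a k 0 * σ (k + (μ + 1 : ℕ)) := by
      intro k
      ext p q
      rw [mul_diag_apply (ha.diagonal k), diag_mul_apply (ha.diagonal k)]
      simp only [σ, Matrix.of_apply]
      by_cases hpq : p = q
      · simp [hpq]
      · rw [if_neg hpq, if_neg hpq, hoff k p q hpq]
        simp
    intro k p q hpq
    obtain ⟨k, rfl⟩ := ZMod.intCast_surjective k
    have h1 := mul_cycleEigenvalue hmN hσ ha.diagonal ha.diagonal k p q
    have h2 : σ (k + (N : ℤ) * (μ + 1 : ℕ)) = σ k := by simp [σ]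
    rw [h2] at h1
    have h3 : cycleEigenvalue a p ≠ cycleEigenvalue a q := fun h =>
      ha.eigenvalue p q hpq (by rw [h])
    have h4 : (cycleEigenvalue a q - cycleEigenvalue a p) * σ k p q = 0 := by
      linear_combination h1
    have h5 := (mul_eq_zero.1 h4).resolve_left (sub_ne_zero.2 h3.symm)
    simpa [σ, hpq] using h5
  funext k
  have hX := hasDerivAt_conj_adjugate (hδ k) (cyclicProduct (μ + 1) (lastCoeff a) k) (τ k)
  have hpp : ∀ p, syzygyForm (cyclicProduct (μ + 1) (lastCoeff a) k * τ k -
      τ k * cyclicProduct (μ + 1) (lastCoeff a) k) p + (if p = 0 then τ k 0 0 else 0) = 0 := by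
    intro p
    have h1 := hasDerivAt_syzygyForm hX p
    have h2 : HasDerivAt (fun t : ℂ => if p = 0 then
        (1 + t • τ k : Matrix (Fin n) (Fin n) ℂ) 0 0 - 1 else 0) (if p = 0 then τ k 0 0 else 0)
        0 := by
      split_ifs
      · exact (hasDerivAt_one_add_smul (τ k) 0 0 0).sub_const 1
      · exact hasDerivAt_const _ _
    have h3 := hτ k p p
    simp only [sliceMap, Matrix.of_apply, if_true, Pi.add_apply, Pi.one_apply,
      Pi.smul_apply] at h3
    have h4 := (h1.add h2).unique h3
    -- The term with `δ k` drops out because `b^k` itself satisfies the syzygies; a commutator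
    -- remains.
    rw [show δ k • cyclicProduct (μ + 1) (lastCoeff a) k -
        τ k * cyclicProduct (μ + 1) (lastCoeff a) k + cyclicProduct (μ + 1) (lastCoeff a) k * τ k =
      δ k • cyclicProduct (μ + 1) (lastCoeff a) k + (cyclicProduct (μ + 1) (lastCoeff a) k * τ k -
        τ k * cyclicProduct (μ + 1) (lastCoeff a) k) by abel, syzygyForm_add, syzygyForm_smul,
      syzygies_iff.1 hs, mul_zero, zero_add] at h4
    exact h4
  have h00 : τ k 0 0 = 0 := by
    have h1 := hpp 0
    rw [syzygyForm, dif_pos (by simp), if_pos rfl, zero_add] at h1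
    exact h1
  have hcomm : ∀ p, syzygyForm (cyclicProduct (μ + 1) (lastCoeff a) k * τ k -
      τ k * cyclicProduct (μ + 1) (lastCoeff a) k) p = 0 := by
    intro p
    have h1 := hpp p
    rwa [h00, ite_self, add_zero] at h1
  ext p q
  by_cases hpq : p = q
  · subst hpq
    rw [eq_of_syzygyForm_commutator (hdiag k) (syzygies_iff.1 hs k) (ha.sub k) hcomm p 0, h00]
    rfl
  · exact hdiag k hpq

/-- Near generic coefficients in normal form, there is a unique small change of bases that
brings the coefficients to the slice, and it depends holomorphically on them. -/
theorem IsGeneric.exists_slice (hmN : Nat.Coprime (μ + 1) N) {a : Coefficients (μ + 1) n N}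
    (ha : IsGeneric a) (hs : Syzygies (μ + 1) (lastCoeff a)) :
    ∃ γ : Coefficients (μ + 1) n N → ZMod N → Matrix (Fin n) (Fin n) ℂ,
      (∀ᶠ x in 𝓝 a, DifferentiableAt ℂ γ x) ∧ (∀ᶠ x in 𝓝 a, sliceMap x (γ x) = 0) ∧
      ∀ᶠ x in 𝓝 a, sliceMap x 1 = 0 → γ x = 1 := by
  -- Keeping the coefficients as first component reduces the implicit function theorem to the
  -- inverse function theorem.
  let f : Coefficients (μ + 1) n N × (ZMod N → Matrix (Fin n) (Fin n) ℂ) →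
      Coefficients (μ + 1) n N × (ZMod N → Matrix (Fin n) (Fin n) ℂ) :=
    fun x => (x.1, sliceMap x.1 x.2)
  have hf : ContDiff ℂ 1 f := contDiff_fst.prodMk contDiff_sliceMap
  have hfa : f (a, 1) = (a, 0) := by simp only [f, sliceMap_one ha.diagonal hs]
  obtain ⟨g, hg1, hg2, hg3⟩ := exists_local_inverse hf (x := (a, 1)) (by
    rintro ⟨α, τ⟩ hv
    have hF : HasFDerivAt f (fderiv ℂ f (a, 1)) (a, 1) :=
      (hf.differentiable one_ne_zero _).hasFDerivAt
    have hα : α = 0 := by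
      have h1 := (hasFDerivAt_fst (𝕜 := ℂ) (p := f (a, 1))).comp (a, 1) hF
      have h2 := h1.unique (hasFDerivAt_fst (𝕜 := ℂ)
        (E := Coefficients (μ + 1) n N) (F := ZMod N → Matrix (Fin n) (Fin n) ℂ) (p := (a, 1)))
      have h3 : (fderiv ℂ f (a, 1) (α, τ)).1 = α := DFunLike.congr_fun h2 (α, τ)
      exact h3.symm.trans (congr_arg Prod.fst hv)
    subst hα
    have hτ : τ = 0 := by
      apply ha.sliceMap_transverse hmN hs
      intro k p q
      have hline : HasDerivAt (fun t : ℂ => ((a, 1 + t • τ) : Coefficients (μ + 1) n N ×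
          (ZMod N → Matrix (Fin n) (Fin n) ℂ))) ((0, τ) : Coefficients (μ + 1) n N ×
          (ZMod N → Matrix (Fin n) (Fin n) ℂ)) 0 := by
        refine (hasDerivAt_const _ _).prodMk ?_
        simpa using ((hasDerivAt_id (0 : ℂ)).smul_const τ).const_add
          (1 : ZMod N → Matrix (Fin n) (Fin n) ℂ)
      have hF' : HasFDerivAt f (fderiv ℂ f (a, 1)) ((a, 1 + (0 : ℂ) • τ) :
          Coefficients (μ + 1) n N × (ZMod N → Matrix (Fin n) (Fin n) ℂ)) := by
        rw [zero_smul, add_zero]; exact hF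
      have h1 := hF'.comp_hasDerivAt (0 : ℂ) hline
      replace h1 := h1.congr_deriv hv
      have h2 := hasDerivAt_pi.1 ((hasFDerivAt_snd (𝕜 := ℂ)).comp_hasDerivAt (0 : ℂ) h1) k
      have h3 := (hasDerivAt_pi (φ := fun t => fun p => sliceMap a (1 + t • τ) k p)).1 h2 p
      exact (hasDerivAt_pi (φ := fun t => fun q => sliceMap a (1 + t • τ) k p q)).1 h3 q
    rw [hτ]
    rfl) rfl
  rw [hfa] at hg2 hg3
  have hc : Continuous fun x : Coefficients (μ + 1) n N =>
      ((x, 0) : Coefficients (μ + 1) n N × (ZMod N → Matrix (Fin n) (Fin n) ℂ)) := by fun_prop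
  have hc1 : Continuous fun x : Coefficients (μ + 1) n N =>
      ((x, 1) : Coefficients (μ + 1) n N × (ZMod N → Matrix (Fin n) (Fin n) ℂ)) := by fun_prop
  refine ⟨fun x => (g (x, 0)).2, ?_, ?_, ?_⟩
  · filter_upwards [hc.continuousAt.eventually hg3] with x hx
    exact (hx.comp x (differentiableAt_id.prodMk (differentiableAt_const _))).snd
  · filter_upwards [hc.continuousAt.eventually hg2] with x hx
    have h1 : (g (x, 0)).1 = x := congr_arg Prod.fst hx
    have h2 : sliceMap (g (x, 0)).1 (g (x, 0)).2 = 0 := congr_arg Prod.snd hx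
    rwa [h1] at h2
  · filter_upwards [hc1.continuousAt.eventually hg1] with x hx h0
    simp only [f, h0] at hx
    rw [hx]

end Slice

/-! ### Explicit action of changes of bases on coefficients -/

section Gauge

variable {μ n N : ℕ} [NeZero N] [NeZero n]

/-- The coefficients of a lift after the change of bases `h`. -/
noncomputable def gaugeCoeff {m : ℕ} (h : ℤ → Matrix (Fin n) (Fin n) ℂ) (a : Coefficients m n N) :
    Coefficients m n N := fun k i =>
  (h ((k.val : ℤ) + (i : ℕ)))⁻¹ * a k i * h ((k.val : ℤ) + m)

/-- The factor `x` picked up by `h_{k+m}` over a period cancels the one in `h_{k+i}⁻¹`, so the new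
coefficients are periodic although `h` is only twisted. -/
theorem intertwines_gaugeCoeff {m : ℕ} {h : ℤ → (Matrix (Fin n) (Fin n) ℂ)ˣ} {x : ℂ} (hx : x ≠ 0)
    (htw : ∀ k, (h (k + N) : Matrix (Fin n) (Fin n) ℂ) = x • (h k : Matrix (Fin n) (Fin n) ℂ))
    (a : Coefficients m n N) :
    Intertwines h a (gaugeCoeff (fun k => (h k : Matrix (Fin n) (Fin n) ℂ)) a) := by
  intro k i
  let F : ℤ → Matrix (Fin n) (Fin n) ℂ := fun k =>
    (h (k + (i : ℕ)) : Matrix (Fin n) (Fin n) ℂ)⁻¹ * a (k : ZMod N) i *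
      (h (k + m) : Matrix (Fin n) (Fin n) ℂ)
  have hF : ∀ k, F (k + N) = F k := by
    intro k
    have hu : (h (k + N + (i : ℕ)) : Matrix (Fin n) (Fin n) ℂ)⁻¹ =
        x⁻¹ • (h (k + (i : ℕ)) : Matrix (Fin n) (Fin n) ℂ)⁻¹ := by
      rw [add_right_comm, htw]
      have : x • (h (k + (i : ℕ)) : Matrix (Fin n) (Fin n) ℂ) =
          ((Units.mk0 x hx • h (k + (i : ℕ)) : (Matrix (Fin n) (Fin n) ℂ)ˣ) :
            Matrix (Fin n) (Fin n) ℂ) := rfl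
      rw [this, ← Matrix.coe_units_inv, ← Matrix.coe_units_inv]
      simp [Units.smul_def]
    simp only [F]
    rw [hu, add_right_comm k (N : ℤ) (m : ℤ), htw]
    simp [smul_smul, hx]
  have h1 : gaugeCoeff (fun k => (h k : Matrix (Fin n) (Fin n) ℂ)) a (k : ZMod N) i = F k := by
    refine (?_ : _ = F ((k : ZMod N).val : ℤ)).trans
      (eq_of_periodic (N := N) hF (by simp))
    simp [F, gaugeCoeff]
  rw [h1]
  simp only [F, ← Matrix.coe_units_inv, mul_assoc, Units.mul_inv_cancel_left]

theorem gaugeCoeff_one {m : ℕ} (a : Coefficients m n N) : gaugeCoeff (fun _ => 1) a = a := by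
  funext k i
  simp [gaugeCoeff]

theorem cyclicProduct_gaugeCoeff {g : ZMod N → Matrix (Fin n) (Fin n) ℂ} (hg : ∀ k, (g k).det ≠ 0)
    (a : Coefficients (μ + 1) n N) (k : ZMod N) :
    cyclicProduct (μ + 1) (lastCoeff (gaugeCoeff (fun k => g k) a)) k =
      (g k)⁻¹ * cyclicProduct (μ + 1) (lastCoeff a) k * g k := by
  let u : ZMod N → (Matrix (Fin n) (Fin n) ℂ)ˣ := fun k =>
    Matrix.nonsingInvUnit (g k) (isUnit_iff_ne_zero.2 (hg k))
  have H := intertwines_gaugeCoeff (h := fun k : ℤ => u k) (x := 1) one_ne_zero (by simp) a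
  obtain ⟨k, rfl⟩ := ZMod.intCast_surjective k
  have h1 := IntertwinesMatrix.cyclicProduct (h := fun k : ℤ => g k) H k
  rw [mul_assoc, ← (by simpa using h1 : _ = cyclicProduct (μ + 1) (lastCoeff a) k * g (k : ZMod N)),
    Matrix.nonsing_inv_mul_cancel_left _ _ (isUnit_iff_ne_zero.2 (hg _))]
  rfl

theorem isGenericNormalForm_iff {a : Coefficients (μ + 1) n N} :
    IsGenericNormalForm a ↔ (∀ k, (a k 0).IsDiag) ∧ (∀ k, (a k 0).det = (-1) ^ (n * μ)) ∧
      Syzygies (μ + 1) (lastCoeff a) := by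
  refine ⟨fun h => ⟨fun k => h.diagonal k 0 rfl, fun k => h.det k 0 rfl,
    h.syzygies (Fin.last μ) rfl⟩, fun h => ⟨fun k i hi => ?_, fun k i hi => ?_, fun i hi => ?_⟩⟩
  · rw [show i = 0 from Fin.ext hi]
    exact h.1 k
  · rw [show i = 0 from Fin.ext hi]
    exact h.2.1 k
  · rw [show i = Fin.last μ from Fin.ext (by simpa using hi)]
    exact h.2.2

end Gauge

/-! ### Holomorphic reduction to normal form -/

section Normalizer

open Filter Topology

attribute [local instance] Matrix.normedAddCommGroup Matrix.normedSpace

variable {μ n N : ℕ} [NeZero N] [NeZero n]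

/-- The determinants of the `a_k^0`, up to sign, after a change of bases `g`. -/
noncomputable def gaugeDet (a : Coefficients (μ + 1) n N) (g : ZMod N → Matrix (Fin n) (Fin n) ℂ)
    (k : ZMod N) : ℂ :=
  (-1) ^ (n * μ) * ((g k)⁻¹ * a k 0 * g (k + (μ + 1 : ℕ))).det

theorem prod_gaugeDet {a : Coefficients (μ + 1) n N} {g : ZMod N → Matrix (Fin n) (Fin n) ℂ}
    (hg : ∀ k, (g k).det ≠ 0) :
    ∏ k, gaugeDet a g k = ∏ k, ((-1) ^ (n * μ) * (a k 0).det) := by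
  have h1 : ∀ k, gaugeDet a g k = (-1) ^ (n * μ) * (a k 0).det *
      ((g (k + (μ + 1 : ℕ))).det / (g k).det) := by
    intro k
    rw [gaugeDet, Matrix.det_mul, Matrix.det_mul, Matrix.det_nonsing_inv, Ring.inverse_eq_inv']
    ring
  simp_rw [h1]
  rw [Finset.prod_mul_distrib, Finset.prod_div_distrib]
  have := Equiv.prod_comp (Equiv.addRight ((μ + 1 : ℕ) : ZMod N)) fun k => (g k).det
  simp only [Equiv.coe_addRight] at this
  rw [this, div_self (Finset.prod_ne_zero_iff.2 fun k _ => hg k), mul_one]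

/-- Scalars that make the determinants of the `a_k^0` equal. -/
noncomputable def gaugeScalar (δ : ZMod N → ℂ) (m n : ℕ) (k : ZMod N) : ℂ :=
  Complex.exp (-(1 / n : ℂ) * ∑ i ∈ Finset.range (cycleIndex m k),
    Complex.log (δ ((i * m : ℕ) : ZMod N)))

theorem gaugeScalar_ne_zero (δ : ZMod N → ℂ) (m n : ℕ) (k : ZMod N) : gaugeScalar δ m n k ≠ 0 :=
  Complex.exp_ne_zero _

theorem gaugeScalar_one (m n : ℕ) (k : ZMod N) : gaugeScalar (fun _ => 1) m n k = 1 := by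
  simp [gaugeScalar]

/-- The powers `l_k^n` solve `l_{k+m}^n δ_k = l_k^n` along the cycle, which closes because the `δ_k`
have product one. Exponentials of logarithms provide holomorphic `n`-th roots. -/
theorem gaugeScalar_add {m : ℕ} (hmN : Nat.Coprime m N) {δ : ZMod N → ℂ} (hδ : ∀ k, δ k ≠ 0)
    (hp : ∏ k, δ k = 1) (k : ZMod N) :
    gaugeScalar δ m n (k + m) ^ n * δ k = gaugeScalar δ m n k ^ n := by
  let y : ℕ → ℂ := fun j => ∏ i ∈ Finset.range j, (δ ((i * m : ℕ) : ZMod N))⁻¹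
  have hy : ∀ k, gaugeScalar δ m n k ^ n = y (cycleIndex m k) := by
    intro k
    rw [gaugeScalar, ← Complex.exp_nat_mul, ← mul_assoc, mul_neg,
      mul_one_div_cancel (Nat.cast_ne_zero.2 (NeZero.ne n)), neg_one_mul, ← Finset.sum_neg_distrib,
      Complex.exp_sum]
    refine Finset.prod_congr rfl fun i _ => ?_
    rw [Complex.exp_neg, Complex.exp_log (hδ _)]
  have hN : y N = y 0 := by
    simp only [y, Finset.prod_inv_distrib]
    rw [prod_range_step hmN δ, hp]
    simp
  rw [hy, hy, apply_cycleIndex_add hmN hN]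
  simp only [y]
  rw [Finset.prod_range_succ, cycleIndex_mul hmN, inv_mul_cancel_right₀ (hδ k)]

theorem DifferentiableAt.gaugeScalar {E : Type*} [NormedAddCommGroup E] [NormedSpace ℂ E] {x : E}
    {δ : E → ZMod N → ℂ} (hδ : ∀ k, DifferentiableAt ℂ (fun x => δ x k) x)
    (hs : ∀ k, δ x k ∈ Complex.slitPlane) (m n : ℕ) (k : ZMod N) :
    DifferentiableAt ℂ (fun x => gaugeScalar (δ x) m n k) x := by
  unfold _root_.gaugeScalar
  refine DifferentiableAt.cexp (DifferentiableAt.const_mul ?_ _)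
  exact DifferentiableAt.fun_sum fun i _ => (hδ _).clog (hs _)

theorem DifferentiableAt.gaugeCoeff {E : Type*} [NormedAddCommGroup E] [NormedSpace ℂ E] {x : E}
    {m : ℕ} {h : E → ℤ → Matrix (Fin n) (Fin n) ℂ} {a : E → Coefficients m n N}
    (hh : ∀ k, DifferentiableAt ℂ (fun x => h x k) x) (h0 : ∀ k, (h x k).det ≠ 0)
    (ha : DifferentiableAt ℂ a x) : DifferentiableAt ℂ (fun x => gaugeCoeff (h x) (a x)) x := by
  refine differentiableAt_pi.2 fun k => differentiableAt_pi.2 fun i => ?_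
  exact (((hh _).matrix_inv (h0 _)).matrix_mul
    (differentiableAt_pi.1 (differentiableAt_pi.1 ha k) i)).matrix_mul (hh _)

theorem inv_eq_smul_adjugate (g : Matrix (Fin n) (Fin n) ℂ) : g⁻¹ = (g.det)⁻¹ • g.adjugate := by
  rw [Matrix.inv_def, Ring.inverse_eq_inv']

/-- A point of the slice becomes a normal form after a scalar change of bases. -/
theorem isGenericNormalForm_gaugeCoeff (hmN : Nat.Coprime (μ + 1) N) {a : Coefficients (μ + 1) n N}
    {g : ZMod N → Matrix (Fin n) (Fin n) ℂ} (hg : ∀ k, (g k).det ≠ 0) (h0 : sliceMap a g = 0)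
    (hδ : ∀ k, gaugeDet a g k ≠ 0) (ha : ∏ k, ((-1) ^ (n * μ) * (a k 0).det) = 1) :
    IsGenericNormalForm (gaugeCoeff (fun k : ℤ =>
      gaugeScalar (gaugeDet a g) (μ + 1) n k • g k) a) := by
  set l := gaugeScalar (gaugeDet a g) (μ + 1) n with hl
  have hl0 : ∀ k, l k ≠ 0 := gaugeScalar_ne_zero _ _ _
  have hdet : ∀ k, (l k • g k).det ≠ 0 := by
    intro k
    rw [Matrix.det_smul]
    exact mul_ne_zero (pow_ne_zero _ (hl0 k)) (hg k)
  have hinv : ∀ k, (l k • g k)⁻¹ = (l k)⁻¹ • (g k)⁻¹ := fun k =>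
    Matrix.inv_eq_left_inv (by
      rw [Matrix.smul_mul, Matrix.mul_smul, smul_smul, inv_mul_cancel₀ (hl0 k), one_smul,
        Matrix.nonsing_inv_mul _ (isUnit_iff_ne_zero.2 (hg k))])
  have hzero : ∀ k, gaugeCoeff (fun k : ℤ => l k • g k) a k 0 =
      ((l k)⁻¹ * l (k + (μ + 1 : ℕ))) • ((g k)⁻¹ * a k 0 * g (k + (μ + 1 : ℕ))) := by
    intro k
    have : gaugeCoeff (fun k : ℤ => l k • g k) a k 0 =
        (l k • g k)⁻¹ * a k 0 * (l (k + (μ + 1 : ℕ)) • g (k + (μ + 1 : ℕ))) := by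
      simp [gaugeCoeff]
    rw [this, hinv]
    simp only [Matrix.smul_mul, Matrix.mul_smul, smul_smul, mul_comm]
  rw [isGenericNormalForm_iff]
  refine ⟨fun k p q hpq => ?_, fun k => ?_, ?_⟩
  · have h1 := congr_fun (congr_fun (congr_fun h0 k) p) q
    simp only [sliceMap, Matrix.of_apply, if_neg hpq] at h1
    change gaugeCoeff (fun k : ℤ => l k • g k) a k 0 p q = 0
    rw [hzero, inv_eq_smul_adjugate, Matrix.smul_mul, Matrix.smul_mul, Matrix.smul_apply,
      Matrix.smul_apply, h1]
    simp
  · have h1 := gaugeScalar_add (n := n) hmN hδ ((prod_gaugeDet hg).trans ha) k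
    rw [← hl] at h1
    rw [hzero, Matrix.det_smul, Fintype.card_fin, mul_pow, inv_pow, ← h1, gaugeDet]
    have h2 := hδ k
    rw [gaugeDet] at h2
    have h3 := pow_ne_zero n (hl0 (k + (μ + 1 : ℕ)))
    have h4 := neg_one_pow_mul_neg_one_pow n μ
    have h5 := right_ne_zero_of_mul h2
    generalize ((g k)⁻¹ * a k 0 * g (k + (μ + 1 : ℕ))).det = D at *
    generalize ((-1 : ℂ) ^ (n * μ)) = ε at *
    have h6 : ε ≠ 0 := left_ne_zero_of_mul h2
    field_simp
    linear_combination -h4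
  · rw [syzygies_iff]
    intro k p
    rw [cyclicProduct_gaugeCoeff (g := fun k => l k • g k) hdet, hinv]
    simp only [Matrix.smul_mul, Matrix.mul_smul, smul_smul]
    rw [mul_inv_cancel₀ (hl0 k), one_smul, inv_eq_smul_adjugate, Matrix.smul_mul, Matrix.smul_mul,
      syzygyForm_smul]
    have h1 := congr_fun (congr_fun (congr_fun h0 k) p) p
    simp only [sliceMap, Matrix.of_apply, if_true] at h1
    by_cases hp : p = 0
    · subst hp
      simp [syzygyForm]
    · rw [if_neg hp, add_zero] at h1
      rw [h1]
      simp

/-- Near generic coefficients in normal form there is a holomorphic choice of changes of bases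
that bring the coefficients to normal form. -/
theorem IsGeneric.exists_normalizer (hmN : Nat.Coprime (μ + 1) N) {a : Coefficients (μ + 1) n N}
    (ha : IsGeneric a) (hs : Syzygies (μ + 1) (lastCoeff a)) :
    ∃ ν : Coefficients (μ + 1) n N → Coefficients (μ + 1) n N,
      (∀ᶠ x in 𝓝 a, DifferentiableAt ℂ ν x) ∧
      (∀ᶠ x in 𝓝 a, ∏ k, ((-1) ^ (n * μ) * (x k 0).det) = 1 →
        IsGenericNormalForm (ν x) ∧ ∃ h, Intertwines h x (ν x)) ∧
      ∀ᶠ x in 𝓝 a, IsGenericNormalForm x → ν x = x := by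
  obtain ⟨γ, hγ1, hγ2, hγ3⟩ := ha.exists_slice hmN hs
  have hγa : γ a = 1 := hγ3.self_of_nhds (sliceMap_one ha.diagonal hs)
  have hcont : ContinuousAt γ a := hγ1.self_of_nhds.continuousAt
  have hdet : ∀ᶠ x in 𝓝 a, ∀ k, (γ x k).det ≠ 0 := by
    refine Filter.eventually_all.2 fun k => ?_
    have h1 : ContinuousAt (fun x => (γ x k).det) a :=
      (differentiableAt_pi.1 hγ1.self_of_nhds k).matrix_det.continuousAt
    refine h1.eventually_ne ?_
    simp [hγa]
  have hδd : ∀ x, DifferentiableAt ℂ γ x → (∀ k, (γ x k).det ≠ 0) → ∀ k,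
      DifferentiableAt ℂ (fun x => gaugeDet x (γ x) k) x := by
    intro x hx h0 k
    have hk := fun k => differentiableAt_pi.1 hx k
    exact DifferentiableAt.const_mul ((((hk k).matrix_inv (h0 k)).matrix_mul
      (differentiableAt_pi.1 (differentiableAt_pi.1 differentiableAt_id k) 0)).matrix_mul
        (hk _)).matrix_det _
  have hδa : ∀ k, gaugeDet a (γ a) k = 1 := by
    intro k
    simp [gaugeDet, hγa, ha.det_zero, neg_one_pow_mul_neg_one_pow]
  -- At `a` the determinants are `1`, hence nearby they stay where the principal logarithm is
  -- holomorphic.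
  have hslit : ∀ᶠ x in 𝓝 a, ∀ k, gaugeDet x (γ x) k ∈ Complex.slitPlane := by
    refine Filter.eventually_all.2 fun k => ?_
    have h1 := (hδd a hγ1.self_of_nhds hdet.self_of_nhds k).continuousAt
    refine h1.eventually_mem (Complex.isOpen_slitPlane.mem_nhds ?_)
    rw [hδa]
    exact Complex.one_mem_slitPlane
  let h : Coefficients (μ + 1) n N → ZMod N → Matrix (Fin n) (Fin n) ℂ := fun x k =>
    gaugeScalar (gaugeDet x (γ x)) (μ + 1) n k • γ x k
  have hh : ∀ x, (∀ k, (γ x k).det ≠ 0) → ∀ k, (h x k).det ≠ 0 := by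
    intro x hx k
    rw [Matrix.det_smul]
    exact mul_ne_zero (pow_ne_zero _ (gaugeScalar_ne_zero _ _ _ _)) (hx k)
  refine ⟨fun x => gaugeCoeff (fun k : ℤ => h x k) x, ?_, ?_, ?_⟩
  · filter_upwards [hγ1, hdet, hslit] with x h1 h2 h3
    refine DifferentiableAt.gaugeCoeff (fun k => ?_) (fun k => hh x h2 k) differentiableAt_id
    exact (DifferentiableAt.gaugeScalar (hδd x h1 h2) h3 _ _ _).smul (differentiableAt_pi.1 h1 _)
  · filter_upwards [hγ2, hdet, hslit] with x h1 h2 h3 h4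
    refine ⟨isGenericNormalForm_gaugeCoeff hmN h2 h1
      (fun k => Complex.slitPlane_ne_zero (h3 k)) h4, ?_⟩
    exact ⟨_, intertwines_gaugeCoeff (h := fun k : ℤ =>
      Matrix.nonsingInvUnit (h x k) (isUnit_iff_ne_zero.2 (hh x h2 k))) (x := 1) one_ne_zero
      (fun k => by
        simp only [Int.cast_add, Int.cast_natCast, CharP.cast_eq_zero, add_zero, one_smul]) x⟩
  · filter_upwards [hγ3] with x h1 h2
    obtain ⟨h3, h4, h5⟩ := isGenericNormalForm_iff.1 h2
    have h6 := h1 (sliceMap_one h3 h5)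
    have h7 : gaugeDet x (γ x) = fun _ => 1 := by
      funext k
      simp [gaugeDet, h6, h4, neg_one_pow_mul_neg_one_pow]
    have h8 : ∀ k : ZMod N, h x k = 1 := by
      intro k
      simp only [h]
      rw [h7, gaugeScalar_one, h6, one_smul]
      rfl
    simp only [h8]
    exact gaugeCoeff_one x

end Normalizer

/-! ### Implicit functions and independence of the syzygies -/

section Parametrization

open Filter Topology

/-- A submersion between coordinate spaces is, near a point, part of a coordinate system whose
other components are some of the coordinates. -/
theorem exists_implicit {S ι : Type*} [Fintype S] [Fintype ι] [DecidableEq S]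
    {σ : (S → ℂ) → ι → ℂ} (hσ : ContDiff ℂ 1 σ) {x : S → ℂ} (hx : σ x = 0)
    (hsurj : ∀ z, ∃ v, fderiv ℂ σ x v = z) :
    ∃ (Q : Finset S) (Γ : (Q → ℂ) → S → ℂ), Q.card + Fintype.card ι = Fintype.card S ∧
      (∀ᶠ y in 𝓝 x, σ y = 0 → Γ (fun s => y s) = y) ∧
      ∀ᶠ u in 𝓝 fun s : Q => x s,
        σ (Γ u) = 0 ∧ (∀ s : Q, Γ u s = u s) ∧ DifferentiableAt ℂ Γ u := by
  classical
  set L := fderiv ℂ σ x with hL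
  let w : S → ι → ℂ := fun s => L (Pi.single s 1)
  have hLw : ∀ v, L v = ∑ s, v s • w s := by
    intro v
    rw [← Finset.univ_sum_single v, map_sum]
    simp only [Finset.univ_sum_single]
    refine Finset.sum_congr rfl fun s _ => ?_
    rw [← map_smul]
    congr 1
    rw [← Pi.single_smul, smul_eq_mul, mul_one]
  have hspan : Submodule.span ℂ (Set.range w) = ⊤ := by
    rw [eq_top_iff]
    intro z _
    obtain ⟨v, rfl⟩ := hsurj z
    rw [hLw]
    exact Submodule.sum_mem _ fun s _ => Submodule.smul_mem _ _ (Submodule.subset_span ⟨s, rfl⟩)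
  -- The partial derivatives span, so some of them form a basis. The corresponding coordinates `P`
  -- are solved for, and the complementary ones remain free.
  obtain ⟨κ, a, ha, hsp, hli⟩ := exists_linearIndependent' ℂ w
  have : Fintype κ := Fintype.ofInjective a ha
  have hcard : Fintype.card κ = Fintype.card ι := by
    have h1 := finrank_span_eq_card hli
    rw [hsp, hspan, finrank_top, Module.finrank_fintype_fun_eq_card] at h1
    exact h1.symm
  let P : Finset S := Finset.univ.image a
  have hP : P.card = Fintype.card ι := by
    rw [Finset.card_image_of_injective _ ha, Finset.card_univ, hcard]
  have hQ : Pᶜ.card + Fintype.card ι = Fintype.card S := by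
    rw [← hP, Finset.card_compl_add_card]
  let f : (S → ℂ) → (ι → ℂ) × ((Pᶜ : Finset S) → ℂ) := fun y => (σ y, fun s => y s)
  let R : (S → ℂ) →L[ℂ] ((Pᶜ : Finset S) → ℂ) :=
    ContinuousLinearMap.pi fun s => ContinuousLinearMap.proj (s : S)
  have hf : ContDiff ℂ 1 f := hσ.prodMk (R.contDiff)
  have hfd : HasFDerivAt f (L.prod R) x :=
    ((hσ.differentiable one_ne_zero) x).hasFDerivAt.prodMk R.hasFDerivAt
  obtain ⟨g, hg1, hg2, hg3⟩ := exists_local_inverse hf (x := x) (by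
    intro v hv
    rw [hfd.fderiv] at hv
    have h1 : L v = 0 := congr_arg Prod.fst hv
    have h2 : R v = 0 := congr_arg Prod.snd hv
    have h3 : ∀ s, s ∉ P → v s = 0 := fun s hs =>
      congr_fun h2 ⟨s, Finset.mem_compl.2 hs⟩
    have h4 : ∑ i, v (a i) • (w ∘ a) i = 0 := by
      rw [hLw, ← Finset.sum_subset (Finset.subset_univ P) fun s _ hs => by rw [h3 s hs, zero_smul],
        Finset.sum_image fun _ _ _ _ h => ha h] at h1
      exact h1
    funext s
    by_cases hs : s ∈ P
    · obtain ⟨i, -, rfl⟩ := Finset.mem_image.1 hs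
      exact Fintype.linearIndependent_iff.1 hli (fun i => v (a i)) h4 i
    · exact h3 s hs) (by
    rw [Module.finrank_prod, Module.finrank_fintype_fun_eq_card,
      Module.finrank_fintype_fun_eq_card, Module.finrank_fintype_fun_eq_card, Fintype.card_coe,
      ← hQ, add_comm])
  have hc : Continuous fun u : (Pᶜ : Finset S) → ℂ => ((0, u) : (ι → ℂ) × ((Pᶜ : Finset S) → ℂ)) := by
    fun_prop
  have hfx : f x = ((0 : ι → ℂ), fun s : (Pᶜ : Finset S) => x s) := by simp only [f, hx]
  rw [hfx] at hg2 hg3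
  refine ⟨Pᶜ, fun u => g (0, u), hQ, ?_, ?_⟩
  · filter_upwards [hg1] with y hy h0
    simp only [f, h0] at hy
    exact hy
  · filter_upwards [hc.continuousAt.eventually hg2, hc.continuousAt.eventually hg3] with u h2 h3
    refine ⟨congr_arg Prod.fst h2, fun s => congr_fun (congr_arg Prod.snd h2) s, ?_⟩
    exact h3.comp u ((differentiableAt_const _).prodMk differentiableAt_id)

attribute [local instance] Matrix.normedAddCommGroup Matrix.normedSpace

variable {μ n N : ℕ} [NeZero N] [NeZero n]

/-- The family of matrices with given entries. -/
def ofEntries (x : ZMod N × Fin n × Fin n → ℂ) (k : ZMod N) : Matrix (Fin n) (Fin n) ℂ :=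
  Matrix.of fun p q => x (k, p, q)

/-- The syzygies of the cyclic products of matrices with given entries. -/
noncomputable def syzygyMap (m : ℕ) (x : ZMod N × Fin n × Fin n → ℂ)
    (s : ZMod N × {p : Fin n // p ≠ 0}) : ℂ :=
  syzygyForm (cyclicProduct m (ofEntries x) s.1) s.2

theorem syzygyMap_eq_zero_iff {m : ℕ} {x : ZMod N × Fin n × Fin n → ℂ} :
    syzygyMap m x = 0 ↔ Syzygies m (ofEntries x) := by
  rw [syzygies_iff]
  constructor
  · intro h k p
    by_cases hp : p = 0
    · simp [syzygyForm, hp]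
    · exact congr_fun h (k, ⟨p, hp⟩)
  · intro h
    funext s
    exact h s.1 s.2

theorem contDiff_syzygyMap {r : WithTop ℕ∞} {m : ℕ} :
    ContDiff ℂ r (syzygyMap (n := n) (N := N) m) := by
  refine contDiff_pi.2 fun s => contDiff_syzygyForm (contDiff_cyclicProduct m (fun k => ?_) _) _
  exact contDiff_matrix.2 fun p q => contDiff_apply ℂ ℂ (k, p, q)

/-- Independent diagonal changes of bases of the `a_k^{m-1}` telescope in the cyclic product and
conjugate each `b^k` by its own diagonal matrix. -/
theorem cyclicProduct_torus (c : ZMod N → Matrix (Fin n) (Fin n) ℂ)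
    (τ : ZMod N → Fin n → ℂ) (k : ZMod N) (p q : Fin n) :
    cyclicProduct (μ + 1) (fun k : ZMod N => Matrix.of fun p q =>
        Complex.exp (τ (k + μ + 1) q - τ (k + μ) p) * c k p q) k p q =
      Complex.exp (τ k q - τ k p) * cyclicProduct (μ + 1) c k p q := by
  have h1 := mul_prod_ofFn
    (g := fun j => Matrix.diagonal fun p => Complex.exp (τ (k + j) p))
    (f := fun j : ℕ => c (k - ((μ + 1 : ℕ) : ZMod N) + 1 + (j : ZMod N)))
    (f' := fun j : ℕ => (fun k : ZMod N => Matrix.of fun p q =>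
      Complex.exp (τ (k + μ + 1) q - τ (k + μ) p) * c k p q)
        (k - ((μ + 1 : ℕ) : ZMod N) + 1 + (j : ZMod N)))
    (fun j => by
      ext p q
      rw [Matrix.diagonal_mul, Matrix.mul_diagonal]
      simp only [Matrix.of_apply]
      rw [show k - ((μ + 1 : ℕ) : ZMod N) + 1 + (j : ZMod N) + μ + 1 = k + ((j + 1 : ℕ) : ZMod N) by
        push_cast; ring, show k - ((μ + 1 : ℕ) : ZMod N) + 1 + (j : ZMod N) + μ = k + j by
        push_cast; ring, Complex.exp_sub]
      have := Complex.exp_ne_zero (τ (k + j) p)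
      field_simp) N
  have h2 := congr_fun (congr_fun h1 p) q
  rw [Matrix.diagonal_mul, Matrix.mul_diagonal] at h2
  simp only [Nat.cast_zero, add_zero, CharP.cast_eq_zero] at h2
  rw [Complex.exp_sub, div_mul_eq_mul_div, eq_div_iff (Complex.exp_ne_zero _)]
  exact (mul_comm _ _).trans (h2.trans (mul_comm _ _))

/-- With `w_i = z_{i+1} / b_{2,1}`, the equations are `(τ_{i+1} - τ_i) + (τ_1 - τ_0) = w_i`. The
case `i = 0` gives `τ_1 - τ_0 = w_0 / 2`, and the other increments are `w_i - w_0 / 2`. -/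
theorem exists_torus_direction {b : Matrix (Fin n) (Fin n) ℂ} (hb : ∀ p, syzygyForm b p = 0)
    (h0 : ∀ hi : 1 < n, b ⟨1, hi⟩ ⟨0, by omega⟩ ≠ 0) (z : Fin n → ℂ) (hz : z 0 = 0) :
    ∃ τ : Fin n → ℂ, ∀ p, syzygyForm (Matrix.of fun p q => (τ q - τ p) * b p q) p = z p := by
  by_cases hn : 1 < n
  · let β := b ⟨1, hn⟩ ⟨0, by omega⟩
    let w : ℕ → ℂ := fun i => if h : i + 1 < n then z ⟨i + 1, h⟩ / β else 0
    refine ⟨fun p => ∑ j ∈ Finset.range p, (w j - w 0 / 2), fun p => ?_⟩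
    have h1 := hb p
    unfold syzygyForm at h1 ⊢
    split_ifs at h1 ⊢ with hp
    · rw [← hz]
      congr 1
      exact Fin.ext hp.symm
    · obtain ⟨p, hpn⟩ := p
      obtain ⟨i, rfl⟩ := Nat.exists_eq_add_one_of_ne_zero hp
      rw [sub_eq_zero] at h1
      simp only [Matrix.of_apply, Nat.add_sub_cancel, Finset.sum_range_succ, Finset.range_zero,
        Finset.sum_empty] at h1 ⊢
      have h2 : w i = z ⟨i + 1, by omega⟩ / β := by simp only [w]; rw [dif_pos (by omega)]
      have h3 : β ≠ 0 := h0 hn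
      rw [h1]
      generalize ∑ x ∈ Finset.range i, (w x - w 0 / 2) = S
      rw [h2]
      change (_ : ℂ) * β - _ * β = _
      field_simp
      ring
  · refine ⟨0, fun p => ?_⟩
    have hp : p = 0 := Fin.ext (by simp; omega)
    subst hp
    simp [syzygyForm, hz]

/-- Torus directions suffice: the curve `γ` acts on the `b^k` by independent diagonal conjugations,
whose effect on the syzygies is arbitrary. -/
theorem fderiv_syzygyMap_surjective {x : ZMod N × Fin n × Fin n → ℂ}
    (hs : syzygyMap (μ + 1) x = 0)
    (h0 : ∀ k (hi : 1 < n), cyclicProduct (μ + 1) (ofEntries x) k ⟨1, hi⟩ ⟨0, by omega⟩ ≠ 0)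
    (z : ZMod N × {p : Fin n // p ≠ 0} → ℂ) :
    ∃ v, fderiv ℂ (syzygyMap (μ + 1)) x v = z := by
  choose τ hτ using fun k => exists_torus_direction
    (syzygies_iff.1 (syzygyMap_eq_zero_iff.1 hs) k) (h0 k)
    (fun p => if h : p ≠ 0 then z (k, ⟨p, h⟩) else 0) (by simp)
  let γ : ℂ → ZMod N × Fin n × Fin n → ℂ := fun t s =>
    Complex.exp (t * τ (s.1 + μ + 1) s.2.2 - t * τ (s.1 + μ) s.2.1) * x s
  let v : ZMod N × Fin n × Fin n → ℂ := fun s =>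
    (τ (s.1 + μ + 1) s.2.2 - τ (s.1 + μ) s.2.1) * x s
  have hexp : ∀ u w y : ℂ, HasDerivAt (fun t : ℂ => Complex.exp (t * u - t * w) * y)
      ((u - w) * y) 0 := by
    intro u w y
    have h1 : HasDerivAt (fun t : ℂ => t * u - t * w) (1 * u - 1 * w) 0 :=
      ((hasDerivAt_id (0 : ℂ)).mul_const u).sub ((hasDerivAt_id (0 : ℂ)).mul_const w)
    simpa using h1.cexp.mul_const y
  have hγ : HasDerivAt γ v 0 := hasDerivAt_pi.2 fun s => hexp _ _ _
  have hγ0 : γ 0 = x := by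
    funext s
    simp [γ]
  have hF : HasFDerivAt (syzygyMap (μ + 1)) (fderiv ℂ (syzygyMap (μ + 1)) x) (γ 0) := by
    rw [hγ0]
    exact ((contDiff_syzygyMap (r := 1)).differentiable one_ne_zero x).hasFDerivAt
  refine ⟨v, ?_⟩
  have h1 := hasDerivAt_pi.1 (hF.comp_hasDerivAt (0 : ℂ) hγ)
  funext s
  refine (h1 s).unique ?_
  have h2 : ∀ t, cyclicProduct (μ + 1) (ofEntries (γ t)) s.1 = Matrix.of fun p q =>
      Complex.exp (t * τ s.1 q - t * τ s.1 p) * cyclicProduct (μ + 1) (ofEntries x) s.1 p q := by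
    intro t
    ext p q
    exact cyclicProduct_torus (ofEntries x) (fun k p => t * τ k p) s.1 p q
  have h3 := hasDerivAt_syzygyForm (X := fun t => cyclicProduct (μ + 1) (ofEntries (γ t)) s.1)
    (X' := Matrix.of fun p q => (τ s.1 q - τ s.1 p) * cyclicProduct (μ + 1) (ofEntries x) s.1 p q)
    (t := 0) (fun p q => by simp only [h2, Matrix.of_apply]; exact hexp _ _ _) s.2
  rw [hτ, dif_pos s.2.2] at h3
  exact h3

end Parametrization

/-! ### Choice of coordinates among the entries -/

section Parametrization

open Filter Topology

attribute [local instance] Matrix.normedAddCommGroup Matrix.normedSpace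

variable {μ n N : ℕ} [NeZero N] [NeZero n]

/-- The entries of the coefficients in the places `T`. -/
def entries {m : ℕ} (T : Finset (ZMod N × Fin m × Fin n × Fin n)) (a : Coefficients m n N) :
    T → ℂ := fun t => a t.1.1 t.1.2.1 t.1.2.2.1 t.1.2.2.2

theorem continuous_entries {m : ℕ} (T : Finset (ZMod N × Fin m × Fin n × Fin n)) :
    Continuous (entries T) :=
  continuous_pi fun t => (continuous_apply_apply t.1.1 t.1.2.1).matrix_elem _ _

/-- The places of the first `n - 1` diagonal entries of the `a_k^0`, of the entries `Q` of the
`a_k^{m-1}`, and of the entries of the other coefficients. -/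
def selection (μ : ℕ) (Q : Finset (ZMod N × Fin n × Fin n)) :
    Finset (ZMod N × Fin (μ + 1) × Fin n × Fin n) :=
  Finset.univ.filter fun t => (t.2.1 = 0 ∧ t.2.2.1 = t.2.2.2 ∧ (t.2.2.1 : ℕ) + 1 < n) ∨
    (t.2.1 = Fin.last μ ∧ (t.1, t.2.2) ∈ Q) ∨ (t.2.1 ≠ 0 ∧ t.2.1 ≠ Fin.last μ)

theorem card_mul_sub_add_one {q : ℕ} (h : q + N * (n - 1) = N * (n * n)) :
    q = N * (n ^ 2 - n + 1) := by
  obtain ⟨k, rfl⟩ := Nat.exists_eq_add_one_of_ne_zero (NeZero.ne n)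
  have h1 : (k + 1) ^ 2 - (k + 1) + 1 = k * k + k + 1 := by
    have : (k + 1) ^ 2 = k * k + k + (k + 1) := by ring
    omega
  rw [h1]
  rw [Nat.add_sub_cancel] at h
  have h2 : N * ((k + 1) * (k + 1)) = N * (k * k + k + 1) + N * k := by ring
  omega

theorem isCoordinateSelection (hμ : 1 ≤ μ) {Q : Finset (ZMod N × Fin n × Fin n)}
    (hQ : Q.card + N * (n - 1) = N * (n * n)) : IsCoordinateSelection (selection μ Q) := by
  have hne : (0 : Fin (μ + 1)) ≠ Fin.last μ := by
    intro h
    have := congr_arg Fin.val h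
    simp at this
    omega
  refine ⟨fun k i p q hi => ?_, ?_, fun k i p q h0 hi => ?_⟩
  · have : i = 0 := Fin.ext hi
    subst this
    simp [selection, hne]
  · rw [← card_mul_sub_add_one hQ, ← Finset.card_map (f := ⟨fun s : ZMod N × Fin n × Fin n =>
      ((s.1, Fin.last μ, s.2) : ZMod N × Fin (μ + 1) × Fin n × Fin n), fun s s' h => by
        simp only [Prod.mk.injEq] at h
        exact Prod.ext h.1 h.2.2⟩)]
    congr 1
    ext ⟨k, i, p, q⟩
    simp only [selection, Finset.mem_filter, Finset.mem_univ, true_and, Finset.mem_map,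
      Prod.exists]
    constructor
    · rintro ⟨h1, h2⟩
      have hi : i = Fin.last μ := Fin.ext (by simpa using h2)
      subst hi
      rcases h1 with h1 | h1 | h1
      · exact absurd h1.1.symm hne
      · exact ⟨k, p, q, h1.2, rfl⟩
      · exact absurd rfl h1.2
    · rintro ⟨k, p, q, h, h1⟩
      obtain ⟨rfl, h1⟩ := Prod.ext_iff.1 h1
      obtain ⟨rfl, h1⟩ := Prod.ext_iff.1 h1
      obtain ⟨rfl, rfl⟩ := Prod.ext_iff.1 h1
      exact ⟨Or.inr (Or.inl ⟨rfl, h⟩), rfl⟩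
  · simp only [selection, Finset.mem_filter, Finset.mem_univ, true_and]
    refine Or.inr (Or.inr ⟨fun h => ?_, fun h => ?_⟩)
    · rw [h] at h0; simp at h0
    · rw [h] at hi; simp at hi

/-- The diagonal matrix of determinant `ε` with given first `n - 1` diagonal entries. -/
noncomputable def diagonalOfDet (ε : ℂ) (u : Fin n → ℂ) : Matrix (Fin n) (Fin n) ℂ :=
  Matrix.diagonal fun p => if (p : ℕ) + 1 < n then u p else
    ε / ∏ q ∈ (Finset.univ.filter fun q : Fin n => (q : ℕ) + 1 < n), u q

theorem filter_not_add_one_lt :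
    (Finset.univ.filter fun q : Fin n => ¬ (q : ℕ) + 1 < n) =
      {⟨n - 1, Nat.sub_one_lt (NeZero.ne n)⟩} := by
  ext q
  have := q.2
  simp only [Finset.mem_filter, Finset.mem_univ, true_and, Finset.mem_singleton, Fin.ext_iff]
  omega

theorem det_diagonalOfDet {ε : ℂ} {u : Fin n → ℂ}
    (hu : ∏ q ∈ (Finset.univ.filter fun q : Fin n => (q : ℕ) + 1 < n), u q ≠ 0) : (diagonalOfDet ε u).det = ε := by
  rw [diagonalOfDet, Matrix.det_diagonal,
    ← Finset.prod_filter_mul_prod_filter_not _ fun q : Fin n => (q : ℕ) + 1 < n,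
    filter_not_add_one_lt, Finset.prod_singleton, if_neg (by simp only; omega),
    Finset.prod_congr rfl (g := u) fun q hq => by rw [if_pos (Finset.mem_filter.1 hq).2],
    mul_div_cancel₀ _ hu]

theorem eq_diagonalOfDet {ε : ℂ} (hε : ε ≠ 0) {A : Matrix (Fin n) (Fin n) ℂ} (hA : A.IsDiag)
    (hd : A.det = ε) : (∏ q ∈ (Finset.univ.filter fun q : Fin n => (q : ℕ) + 1 < n), A q q ≠ 0) ∧
      diagonalOfDet ε (fun p => A p p) = A := by
  rw [← hA.diagonal_diag, Matrix.det_diagonal,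
    ← Finset.prod_filter_mul_prod_filter_not _ fun q : Fin n => (q : ℕ) + 1 < n,
    filter_not_add_one_lt, Finset.prod_singleton] at hd
  simp only [Matrix.diag_apply] at hd
  have h0 : ∏ q ∈ (Finset.univ.filter fun q : Fin n => (q : ℕ) + 1 < n), A q q ≠ 0 := fun h => by
    rw [h, zero_mul] at hd
    exact hε hd.symm
  refine ⟨h0, ?_⟩
  conv_rhs => rw [← hA.diagonal_diag]
  unfold diagonalOfDet
  congr 1
  funext p
  split_ifs with hp
  · rfl
  · have : p = ⟨n - 1, Nat.sub_one_lt (NeZero.ne n)⟩ := Fin.ext (by simp only; omega)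
    subst this
    rw [← hd, mul_div_cancel_left₀ _ h0]
    rfl

/-- Near generic coefficients in normal form, the coefficients in normal form are a holomorphic
function of the entries in suitable places. -/
theorem IsGeneric.exists_parametrization (hμ : 1 ≤ μ) {a : Coefficients (μ + 1) n N}
    (ha : IsGeneric a) (hs : Syzygies (μ + 1) (lastCoeff a)) :
    ∃ (T : Finset (ZMod N × Fin (μ + 1) × Fin n × Fin n))
      (α : (T → ℂ) → Coefficients (μ + 1) n N), IsCoordinateSelection T ∧
      (∀ᶠ y in 𝓝 (entries T a), entries T (α y) = y ∧ IsGenericNormalForm (α y) ∧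
        DifferentiableAt ℂ α y) ∧
      (∀ᶠ x in 𝓝 a, IsGenericNormalForm x → α (entries T x) = x) ∧
      ∀ y y', (∀ t : T, (t.1.2.1 : ℕ) + 1 = μ + 1 → y t = y' t) →
        ∀ k, α y k (Fin.last μ) = α y' k (Fin.last μ) := by
  have hne : (0 : Fin (μ + 1)) ≠ Fin.last μ := by
    intro h
    have := congr_arg Fin.val h
    simp at this
    omega
  let c : Coefficients (μ + 1) n N → ZMod N × Fin n × Fin n → ℂ := fun x s =>
    x s.1 (Fin.last μ) s.2.1 s.2.2
  have hc : Continuous c := continuous_pi fun s =>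
    (continuous_apply_apply s.1 (Fin.last μ)).matrix_elem _ _
  have hσ0 : syzygyMap (μ + 1) (c a) = 0 := syzygyMap_eq_zero_iff.2 hs
  obtain ⟨Q, Γ, hQ, hΓ1, hΓ2⟩ := exists_implicit contDiff_syzygyMap hσ0
    (fderiv_syzygyMap_surjective hσ0 ha.sub)
  have hQ' : Q.card + N * (n - 1) = N * (n * n) := by
    simpa [Fintype.card_prod, ZMod.card, Fintype.card_subtype_compl] using hQ
  set T := selection μ Q with hT
  have hsel := isCoordinateSelection hμ hQ'
  rw [← hT] at hsel
  have hTQ : ∀ s : Q, ((s.1.1, Fin.last μ, s.1.2) : ZMod N × Fin (μ + 1) × Fin n × Fin n) ∈ T := by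
    intro s
    simp only [hT, selection, Finset.mem_filter, Finset.mem_univ, true_and]
    exact Or.inr (Or.inl s.2)
  let r : (T → ℂ) → Q → ℂ := fun y s => y ⟨_, hTQ s⟩
  have hr : Continuous r := continuous_pi fun s => continuous_apply _
  -- The default `0` only reaches the last diagonal entry of `a_k^0`, which `diagonalOfDet` ignores.
  let Y : (T → ℂ) → ZMod N × Fin (μ + 1) × Fin n × Fin n → ℂ := fun y t =>
    if h : t ∈ T then y ⟨t, h⟩ else 0
  have hYc : ∀ t, ContDiff ℂ 1 fun y => Y y t := by
    intro t
    simp only [Y]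
    split_ifs
    · exact contDiff_apply ℂ ℂ _
    · exact contDiff_const
  have hYd : ∀ t, Differentiable ℂ fun y => Y y t := fun t => (hYc t).differentiable one_ne_zero
  have hYT : ∀ y (t : T), Y y t = y t := fun y t => dif_pos t.2
  -- The last diagonal entry of `a_k^0` is forced by the determinant, the `a_k^{m-1}` are recovered
  -- from `Q` through the syzygies, and the other coefficients are free.
  let α : (T → ℂ) → Coefficients (μ + 1) n N := fun y k i =>
    if i = 0 then diagonalOfDet ((-1) ^ (n * μ)) fun p => Y y (k, 0, p, p)
    else if i = Fin.last μ then ofEntries (Γ (r y)) k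
    else Matrix.of fun p q => Y y (k, i, p, q)
  have hα0 : ∀ y k, α y k 0 = diagonalOfDet ((-1) ^ (n * μ)) fun p => Y y (k, 0, p, p) :=
    fun y k => if_pos rfl
  have hαl : ∀ y k, α y k (Fin.last μ) = ofEntries (Γ (r y)) k := fun y k => by
    simp only [α]
    simp only [if_neg hne.symm, if_true]
  have hαm : ∀ y k i, i ≠ 0 → i ≠ Fin.last μ → α y k i = Matrix.of fun p q => Y y (k, i, p, q) :=
    fun y k i h0 h1 => by
    simp only [α]
    rw [if_neg h0, if_neg h1]
  have hε : ((-1 : ℂ) ^ (n * μ)) ≠ 0 := pow_ne_zero _ (by norm_num)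
  have hYe : ∀ x t, t ∈ T → Y (entries T x) t = x t.1 t.2.1 t.2.2.1 t.2.2.2 := fun x t ht =>
    dif_pos ht
  have hprodT : ∀ (x : Coefficients (μ + 1) n N) k,
      ∏ q ∈ (Finset.univ.filter fun q : Fin n => (q : ℕ) + 1 < n), Y (entries T x) (k, 0, q, q) =
        ∏ q ∈ (Finset.univ.filter fun q : Fin n => (q : ℕ) + 1 < n), x k 0 q q := fun x k =>
    Finset.prod_congr rfl fun q hq =>
      hYe x _ ((hsel.first k 0 q q rfl).2 ⟨rfl, (Finset.mem_filter.1 hq).2⟩)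
  have hprod : ∀ᶠ y in 𝓝 (entries T a), ∀ k,
      ∏ q ∈ (Finset.univ.filter fun q : Fin n => (q : ℕ) + 1 < n), Y y (k, 0, q, q) ≠ 0 := by
    refine Filter.eventually_all.2 fun k => ContinuousAt.eventually_ne ?_ ?_
    · exact (continuous_finsetProd _ fun q _ => (hYd _).continuous).continuousAt
    · rw [hprodT]
      exact (eq_diagonalOfDet hε (ha.diagonal k) (ha.det_zero k)).1
  have hra : r (entries T a) = fun s : Q => c a s := rfl
  have hΓ2' : ∀ᶠ y in 𝓝 (entries T a), syzygyMap (μ + 1) (Γ (r y)) = 0 ∧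
      (∀ s : Q, Γ (r y) s = r y s) ∧ DifferentiableAt ℂ Γ (r y) := by
    rw [← hra] at hΓ2
    exact hr.continuousAt.eventually hΓ2
  refine ⟨T, α, hsel, ?_, ?_, fun y y' h k => ?_⟩
  · filter_upwards [hprod, hΓ2'] with y h1 ⟨h2, h3, h4⟩
    refine ⟨?_, ?_, ?_⟩
    · funext t
      obtain ⟨⟨k, i, p, q⟩, ht⟩ := t
      change α y k i p q = _
      by_cases hi : i = 0
      · subst hi
        obtain ⟨rfl, hp⟩ := (hsel.first k 0 p q rfl).1 ht
        rw [hα0, diagonalOfDet, Matrix.diagonal_apply_eq, if_pos hp]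
        exact hYT y ⟨_, ht⟩
      · by_cases hl : i = Fin.last μ
        · subst hl
          rw [hαl]
          have hq : (k, p, q) ∈ Q := by
            simpa [hT, selection, hne.symm] using ht
          exact h3 ⟨_, hq⟩
        · rw [hαm y k i hi hl]
          exact hYT y ⟨_, ht⟩
    · rw [isGenericNormalForm_iff]
      refine ⟨fun k => ?_, fun k => ?_, ?_⟩
      · rw [hα0]
        exact Matrix.isDiag_diagonal _
      · rw [hα0]
        exact det_diagonalOfDet (h1 k)
      · rw [show lastCoeff (α y) = ofEntries (Γ (r y)) from funext fun k => hαl y k]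
        exact syzygyMap_eq_zero_iff.1 h2
    · refine differentiableAt_pi.2 fun k => differentiableAt_pi.2 fun i =>
        differentiableAt_matrix.2 fun p q => ?_
      by_cases hi : i = 0
      · subst hi
        simp only [hα0, diagonalOfDet, Matrix.diagonal_apply]
        by_cases hpq : p = q
        · simp only [if_pos hpq]
          by_cases hp : (p : ℕ) + 1 < n
          · simp only [if_pos hp]
            exact (hYd _) y
          · simp only [if_neg hp]
            have hd : DifferentiableAt ℂ (fun y =>
                ∏ q ∈ (Finset.univ.filter fun q : Fin n => (q : ℕ) + 1 < n), Y y (k, 0, q, q)) y :=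
              (contDiff_prod (n := 1) fun q _ => hYc _).differentiable one_ne_zero y
            simp only [div_eq_mul_inv]
            exact (differentiableAt_const _).mul (hd.inv (h1 k))
        · simp only [if_neg hpq]
          exact differentiableAt_const _
      · by_cases hl : i = Fin.last μ
        · subst hl
          simp only [hαl, ofEntries, Matrix.of_apply]
          have hrd : DifferentiableAt ℂ r y :=
            differentiableAt_pi.2 fun s => differentiable_apply _ y
          exact differentiableAt_pi.1 (h4.comp y hrd) (k, p, q)
        · simp only [hαm _ k i hi hl, Matrix.of_apply]
          exact hYd _ y
  · filter_upwards [hc.continuousAt.eventually hΓ1] with x h1 hx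
    obtain ⟨h2, h3, h4⟩ := isGenericNormalForm_iff.1 hx
    funext k i
    by_cases hi : i = 0
    · subst hi
      rw [hα0]
      conv_rhs => rw [← (eq_diagonalOfDet hε (h2 k) (h3 k)).2]
      unfold diagonalOfDet
      rw [hprodT]
      congr 1
      funext p
      split_ifs with hp
      · exact hYe x _ ((hsel.first k 0 p p rfl).2 ⟨rfl, hp⟩)
      · rfl
    · by_cases hl : i = Fin.last μ
      · subst hl
        rw [hαl]
        have h5 := h1 (syzygyMap_eq_zero_iff.2 h4)
        change ofEntries (Γ fun s : Q => c x s) k = _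
        rw [h5]
        rfl
      · rw [hαm _ k i hi hl]
        ext p q
        refine hYe x _ (hsel.middle k i p q ?_ ?_)
        · exact Nat.pos_of_ne_zero fun h => hi (Fin.ext h)
        · have := i.2
          have h5 : (i : ℕ) ≠ μ := fun h => hl (Fin.ext h)
          omega
  · rw [hαl, hαl]
    congr 2
    funext s
    exact h _ (by simp)

end Parametrization

/-! ### Genericity as non-vanishing of a smooth function -/

section Openness

open Filter Topology

attribute [local instance] Matrix.normedAddCommGroup Matrix.normedSpace

variable {μ n N : ℕ} [NeZero N] [NeZero n]

/-- The triviality of the commutant of some matrices can be detected by a polynomial function of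
them. -/
theorem HasTrivialCommutant.exists_certificate {κ : Type*} [Fintype κ]
    {Q : κ → Matrix (Fin n) (Fin n) ℂ} (hQ : HasTrivialCommutant Q) :
    ∃ D : (κ → Matrix (Fin n) (Fin n) ℂ) → ℂ, ContDiff ℂ 1 D ∧ D Q ≠ 0 ∧
      ∀ Q', D Q' ≠ 0 → HasTrivialCommutant Q' := by
  -- The entry `x 0 0` is added to the commutators to exclude the scalars: the commutant is trivial
  -- when this linear map is injective.
  let L : (κ → Matrix (Fin n) (Fin n) ℂ) → Matrix (Fin n) (Fin n) ℂ →ₗ[ℂ]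
      (κ → Matrix (Fin n) (Fin n) ℂ) × ℂ := fun Q =>
    { toFun := fun x => (fun j => x * Q j - Q j * x, x 0 0)
      map_add' := fun x y => by
        refine Prod.ext (funext fun j => ?_) rfl
        simp only [add_mul, mul_add, Prod.fst_add, Pi.add_apply]
        abel
      map_smul' := fun c x => by
        refine Prod.ext (funext fun j => ?_) rfl
        simp [smul_sub] }
  have hL : ∀ Q, Function.Injective (L Q) → HasTrivialCommutant Q := by
    intro Q hinj x hx
    refine ⟨x 0 0, ?_⟩
    apply hinj
    refine Prod.ext (funext fun j => ?_) ?_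
    · simp [L, hx]
    · simp [L]
  have hker : LinearMap.ker (L Q) = ⊥ := by
    rw [LinearMap.ker_eq_bot']
    intro x hx
    obtain ⟨c, rfl⟩ := hQ x fun j => sub_eq_zero.1 (congr_fun (congr_arg Prod.fst hx) j)
    have h1 : (c • 1 : Matrix (Fin n) (Fin n) ℂ) 0 0 = 0 := congr_arg Prod.snd hx
    simp at h1
    rw [h1, zero_smul]
  -- A left inverse at `Q` is kept fixed while `Q'` varies. Its composite with `L Q'` is an
  -- endomorphism whose determinant serves as certificate.
  obtain ⟨Λ, hΛ⟩ := (L Q).exists_leftInverse_of_injective hker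
  let b := Matrix.stdBasis ℂ (Fin n) (Fin n)
  refine ⟨fun Q => (LinearMap.toMatrix b b (Λ ∘ₗ L Q)).det, ?_, ?_, fun Q' h => hL Q' ?_⟩
  · refine contDiff_det.comp (contDiff_matrix.2 fun i j => ?_)
    simp only [LinearMap.toMatrix_apply]
    have h1 : ContDiff ℂ 1 fun Q : κ → Matrix (Fin n) (Fin n) ℂ => L Q (b j) := by
      refine ContDiff.prodMk (contDiff_pi.2 fun l => ?_) contDiff_const
      have hl : ContDiff ℂ 1 fun Q : κ → Matrix (Fin n) (Fin n) ℂ => Q l :=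
        contDiff_pi.1 contDiff_id l
      exact (contDiff_const.matrix_mul hl).sub (hl.matrix_mul contDiff_const)
    exact ((b.coord i ∘ₗ Λ).toContinuousLinearMap.contDiff).comp h1
  · simp only [hΛ, LinearMap.toMatrix_id, Matrix.det_one]
    exact one_ne_zero
  · simp only [LinearMap.det_toMatrix] at h
    have h2 : Function.Injective (Λ ∘ₗ L Q') :=
      (LinearMap.equivOfDetNeZero _ h).injective
    exact Function.Injective.of_comp (f := Λ) h2

theorem contDiff_matrix_pow {E : Type*} [NormedAddCommGroup E] [NormedSpace ℂ E] {r : WithTop ℕ∞}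
    {f : E → Matrix (Fin n) (Fin n) ℂ} (hf : ContDiff ℂ r f) (j : ℕ) :
    ContDiff ℂ r fun x => f x ^ j := by
  induction j with
  | zero => simpa using contDiff_const
  | succ j ih =>
    simp only [pow_succ]
    exact ih.matrix_mul hf

theorem contDiff_coeff_apply {r : WithTop ℕ∞} (k : ZMod N) (i : Fin (μ + 1)) :
    ContDiff ℂ r fun x : Coefficients (μ + 1) n N => x k i :=
  contDiff_pi.1 (contDiff_pi.1 contDiff_id k) i

theorem contDiff_cycleEigenvalue {r : WithTop ℕ∞} (p : Fin n) :
    ContDiff ℂ r fun x : Coefficients (μ + 1) n N => cycleEigenvalue x p :=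
  contDiff_prod fun k _ => contDiff_matrix.1 (contDiff_coeff_apply k 0) p p

theorem contDiff_cyclicProduct_lastCoeff {r : WithTop ℕ∞} (k : ZMod N) :
    ContDiff ℂ r fun x : Coefficients (μ + 1) n N => cyclicProduct (μ + 1) (lastCoeff x) k :=
  contDiff_cyclicProduct (c := fun x : Coefficients (μ + 1) n N => lastCoeff x) _
    (fun k => contDiff_coeff_apply k _) k

theorem contDiff_stabilizerMatrix {r : WithTop ℕ∞} :
    ContDiff ℂ r fun x : Coefficients (μ + 1) n N => stabilizerMatrix x := by
  refine contDiff_pi.2 fun j => ?_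
  have hb := contDiff_cyclicProduct_lastCoeff (μ := μ) (n := n) (N := N) (r := r) 0
  refine ((contDiff_matrix_pow hb _).matrix_mul (contDiff_matrix.2 fun p q => ?_)).matrix_mul
    (contDiff_matrix_pow (contDiff_adjugate.comp hb) _)
  by_cases hpq : p = q
  · subst hpq
    simpa using contDiff_cycleEigenvalue p
  · simpa [Matrix.diagonal_apply_ne _ hpq] using contDiff_const

/-- Genericity, for coefficients with diagonal `a_k^0` of the right determinant, is the
non-vanishing of finitely many polynomial functions. -/
theorem IsGeneric.exists_certificate {a : Coefficients (μ + 1) n N} (ha : IsGeneric a) :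
    ∃ D : Coefficients (μ + 1) n N → ℂ, ContDiff ℂ 1 D ∧ D a ≠ 0 ∧
      ∀ x : Coefficients (μ + 1) n N, (∀ k, (x k 0).IsDiag) →
        (∀ k, (x k 0).det = (-1) ^ (n * μ)) → D x ≠ 0 → IsGeneric x := by
  obtain ⟨D, hD1, hD2, hD3⟩ := ha.commutant.exists_certificate
  let b : Coefficients (μ + 1) n N → ZMod N → Matrix (Fin n) (Fin n) ℂ := fun x k =>
    cyclicProduct (μ + 1) (lastCoeff x) k
  let e : Coefficients (μ + 1) n N → Fin n → ℂ := fun x p => cycleEigenvalue x p ^ ((μ + 1) * n)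
  -- The third factor contains all the entries of the `b^k` that do not vanish at `a`, among them
  -- those required by genericity.
  refine ⟨fun x => D (stabilizerMatrix x) *
    (∏ p, ∏ q, if p = q then 1 else e x p - e x q) *
    (∏ k, ∏ p, ∏ q, if b a k p q = 0 then 1 else b x k p q) *
    ∏ k, (x k (Fin.last μ)).det, ?_, ?_, fun x hd hdet h => ?_⟩
  · refine (((hD1.comp contDiff_stabilizerMatrix).mul (contDiff_prod fun p _ =>
      contDiff_prod fun q _ => ?_)).mul (contDiff_prod fun k _ => contDiff_prod fun p _ =>
      contDiff_prod fun q _ => ?_)).mul (contDiff_prod fun k _ => ?_)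
    · split_ifs
      · exact contDiff_const
      · exact ((contDiff_cycleEigenvalue p).pow _).sub ((contDiff_cycleEigenvalue q).pow _)
    · split_ifs
      · exact contDiff_const
      · exact contDiff_matrix.1 (contDiff_cyclicProduct_lastCoeff k) p q
    · exact contDiff_det.comp (contDiff_coeff_apply k _)
  · refine mul_ne_zero (mul_ne_zero (mul_ne_zero hD2 ?_) ?_) ?_
    · refine Finset.prod_ne_zero_iff.2 fun p _ => Finset.prod_ne_zero_iff.2 fun q _ => ?_
      split_ifs with hpq
      · exact one_ne_zero
      · exact sub_ne_zero.2 (ha.eigenvalue p q hpq)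
    · refine Finset.prod_ne_zero_iff.2 fun k _ => Finset.prod_ne_zero_iff.2 fun p _ =>
        Finset.prod_ne_zero_iff.2 fun q _ => ?_
      split_ifs with hpq
      · exact one_ne_zero
      · exact hpq
    · exact Finset.prod_ne_zero_iff.2 fun k _ => ha.det_last k
  · obtain ⟨h1, h2⟩ := mul_ne_zero_iff.1 h
    obtain ⟨h1, h3⟩ := mul_ne_zero_iff.1 h1
    obtain ⟨h1, h4⟩ := mul_ne_zero_iff.1 h1
    have h5 : ∀ k p q, b a k p q ≠ 0 → b x k p q ≠ 0 := by
      intro k p q h0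
      have := Finset.prod_ne_zero_iff.1 (Finset.prod_ne_zero_iff.1 (Finset.prod_ne_zero_iff.1 h3 k
        (Finset.mem_univ _)) p (Finset.mem_univ _)) q (Finset.mem_univ _)
      rwa [if_neg h0] at this
    refine ⟨hd, hdet, fun p q hpq => ?_, fun k i hi => h5 _ _ _ (ha.super k i hi),
      fun k hi => h5 _ _ _ (ha.sub k hi), h5 _ _ _ ha.corner,
      fun k => Finset.prod_ne_zero_iff.1 h2 k (Finset.mem_univ _), hD3 _ h1⟩
    have := Finset.prod_ne_zero_iff.1 (Finset.prod_ne_zero_iff.1 h4 p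
      (Finset.mem_univ _)) q (Finset.mem_univ _)
    rw [if_neg hpq] at this
    exact sub_ne_zero.1 this

theorem IsGeneric.eventually {a : Coefficients (μ + 1) n N} (ha : IsGeneric a) :
    ∀ᶠ x in 𝓝 a, IsGenericNormalForm x → IsGeneric x := by
  obtain ⟨D, hD1, hD2, hD3⟩ := ha.exists_certificate
  filter_upwards [hD1.continuous.continuousAt.eventually_ne hD2] with x hx hn
  obtain ⟨h1, h2, -⟩ := isGenericNormalForm_iff.1 hn
  exact hD3 x h1 h2 hx

end Openness

/-! ### Nearby normal forms of the same class coincide -/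

section Injectivity

open Filter Topology

attribute [local instance] Matrix.normedAddCommGroup Matrix.normedSpace

theorem eventually_eq_one_of_pow {K : ℕ} (hK : K ≠ 0) : ∀ᶠ z in 𝓝 (1 : ℂ), z ^ K = 1 → z = 1 := by
  let s : Set ℂ := {z | z ^ K = 1 ∧ z ≠ 1}
  have hs : s.Finite := by
    refine (Polynomial.nthRootsFinset K (1 : ℂ)).finite_toSet.subset fun z hz => ?_
    exact (Polynomial.mem_nthRootsFinset (Nat.pos_of_ne_zero hK) _).2 hz.1
  filter_upwards [hs.isClosed.isOpen_compl.mem_nhds (show (1 : ℂ) ∈ sᶜ from fun h => h.2 rfl)]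
    with z hz h1
  by_contra h2
  exact hz ⟨h1, h2⟩

/-- The quotient of two values near `f a` is near `1`, and roots of unity of given order are
isolated. This removes each of the finite ambiguities below. -/
theorem eventually_eq_of_pow_div {X : Type*} [TopologicalSpace X] {f : X → ℂ} {a : X}
    (hf : Continuous f) (h0 : f a ≠ 0) {K : ℕ} (hK : K ≠ 0) :
    ∀ᶠ z in 𝓝 (a, a), f z.1 ≠ 0 ∧ ∀ x, x ^ K = 1 → f z.2 = x * f z.1 → x = 1 := by
  have h1 : ContinuousAt (fun z : X × X => f z.2 / f z.1) (a, a) :=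
    (hf.comp continuous_snd).continuousAt.div (hf.comp continuous_fst).continuousAt h0
  have h2 : ∀ᶠ z in 𝓝 (a, a), (f z.2 / f z.1) ^ K = 1 → f z.2 / f z.1 = 1 := by
    have h2 := eventually_eq_one_of_pow hK
    rw [← div_self h0] at h2
    exact h1.eventually (p := fun w => w ^ K = 1 → w = 1) (by simpa only [div_self h0] using h2)
  filter_upwards [h2, (hf.comp continuous_fst).continuousAt.eventually_ne
    (show (f ∘ Prod.fst) (a, a) ≠ 0 from h0)] with z h3 h4
  refine ⟨h4, fun x hx h5 => ?_⟩
  have h6 : f z.2 / f z.1 = x := by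
    rw [h5]
    exact mul_div_cancel_right₀ _ h4
  rw [h6] at h3
  exact h3 hx

variable {μ n N : ℕ} [NeZero N] [NeZero n]

/-- Coefficients in normal form near generic ones are determined by the class of the polygon. -/
theorem IsGeneric.eventually_eq_of_intertwines (hmN : Nat.Coprime (μ + 1) N)
    {a : Coefficients (μ + 1) n N} (ha : IsGeneric a) :
    ∀ᶠ z in 𝓝 (a, a), ∀ (h : ℤ → (Matrix (Fin n) (Fin n) ℂ)ˣ) (x : ℂ), x ^ ((μ + 1) * n) = 1 →
      (∀ k, (h (k + N) : Matrix (Fin n) (Fin n) ℂ) = x • (h k : Matrix (Fin n) (Fin n) ℂ)) →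
      Intertwines h z.1 z.2 → IsGenericNormalForm z.1 → IsGenericNormalForm z.2 → z.1 = z.2 := by
  have hb : ∀ k p q, Continuous fun x : Coefficients (μ + 1) n N =>
      cyclicProduct (μ + 1) (lastCoeff x) k p q := fun k p q =>
    (contDiff_matrix.1 (contDiff_cyclicProduct_lastCoeff (r := 1) k) p q).continuous
  have hA : ∀ p, Continuous fun x : Coefficients (μ + 1) n N =>
      cycleEigenvalue x p ^ ((μ + 1) * n) := fun p =>
    ((contDiff_cycleEigenvalue (r := 1) p).continuous).pow _
  have hc : ∀ k p q, Continuous fun x : Coefficients (μ + 1) n N => x k (Fin.last μ) p q :=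
    fun k p q => (contDiff_matrix.1 (contDiff_coeff_apply (r := 1) k _) p q).continuous
  have hlast : ∀ k, ∃ s : Fin n × Fin n, a k (Fin.last μ) s.1 s.2 ≠ 0 := by
    intro k
    by_contra! h0
    have : a k (Fin.last μ) = 0 := by
      ext p q
      exact h0 (p, q)
    exact ha.det_last k (by rw [this, Matrix.det_zero])
  choose s hs using hlast
  have e1 : ∀ᶠ z in 𝓝 (a, a), ∀ p q, p ≠ q → cycleEigenvalue z.2 q ^ ((μ + 1) * n) -
      cycleEigenvalue z.1 p ^ ((μ + 1) * n) ≠ 0 := by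
    refine eventually_all.2 fun p => eventually_all.2 fun q => eventually_all.2 fun hpq => ?_
    refine (((hA q).comp continuous_snd).sub ((hA p).comp continuous_fst)).continuousAt.eventually_ne
      ?_
    exact sub_ne_zero.2 (ha.eigenvalue q p hpq.symm)
  have e2 := eventually_eq_of_pow_div (hb 0 0 0) ha.corner (K := (μ + 1) * n) (NeZero.ne _)
  have e3 : ∀ᶠ z in 𝓝 (a, a), ∀ (k : ZMod N) (hi : 1 < n), _ :=
    eventually_all.2 fun k => eventually_all.2 fun hi =>
      eventually_eq_of_pow_div (hb k ⟨1, hi⟩ ⟨0, by omega⟩) (ha.sub k hi) (K := 2) two_ne_zero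
  have e4 : ∀ᶠ z in 𝓝 (a, a), ∀ k : ZMod N, _ := eventually_all.2 fun k =>
    eventually_eq_of_pow_div (hc k (s k).1 (s k).2) (hs k) (K := n) (NeZero.ne n)
  filter_upwards [e1, e2, e3, e4] with z e1 ⟨_, e2⟩ e3 e4 h x hx htw hI hz1 hz2
  obtain ⟨hd1, hdet1, hs1⟩ := isGenericNormalForm_iff.1 hz1
  obtain ⟨hd2, hdet2, hs2⟩ := isGenericNormalForm_iff.1 hz2
  have HM : IntertwinesMatrix (fun k => (h k : Matrix (Fin n) (Fin n) ℂ)) z.1 z.2 := hI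
  -- A non-zero entry `(p, q)` of `h_k` forces `λ'_q = x^m λ_p`, whose powers agree; near `a` this
  -- is excluded for `p ≠ q`.
  have hdiag : ∀ k, (h k : Matrix (Fin n) (Fin n) ℂ).IsDiag := by
    intro k p q hpq
    by_contra h0
    have h1 := HM.cycleEigenvalue hmN hd1 hd2 k p q
    have h2 := twisted_add_mul (h := fun k => (h k : Matrix (Fin n) (Fin n) ℂ)) htw k (μ + 1)
    rw [h2, Matrix.smul_apply, smul_eq_mul, ← mul_assoc, mul_comm] at h1
    have h3 := mul_right_cancel₀ h0 h1
    refine e1 p q hpq ?_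
    rw [h3, mul_pow (cycleEigenvalue z.1 p), pow_right_comm x, hx, one_pow, mul_one, sub_self]
  have hne : ∀ k p, (h k : Matrix (Fin n) (Fin n) ℂ) p p ≠ 0 := fun k p =>
    unit_diag_ne_zero (hdiag k) p
  have hprod : ∀ (k : ℤ) p q, (h k : Matrix (Fin n) (Fin n) ℂ) p p *
      cyclicProduct (μ + 1) (lastCoeff z.2) k p q =
      x * (cyclicProduct (μ + 1) (lastCoeff z.1) k p q *
        (h k : Matrix (Fin n) (Fin n) ℂ) q q) := by
    intro k p q
    have h1 := congr_fun (congr_fun (HM.cyclicProduct k) p) q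
    rw [htw, Matrix.mul_smul, Matrix.smul_apply, diag_mul_apply (hdiag k),
      mul_diag_apply (hdiag k)] at h1
    exact h1
  -- For diagonal `h_0` the corner entries of the two cyclic products have quotient `x`.
  have hx1 : x = 1 := by
    refine e2 x hx ?_
    have h1 := hprod 0 0 0
    rw [Int.cast_zero] at h1
    apply mul_left_cancel₀ (hne 0 0)
    rw [h1]
    ring
  subst hx1
  have hsc : ∀ k : ℤ, (h k : Matrix (Fin n) (Fin n) ℂ) =
      ((h k : Matrix (Fin n) (Fin n) ℂ) 0 0) • 1 := by
    intro k
    have hstep : ∀ (i : ℕ) (hi : i + 1 < n),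
        (h k : Matrix (Fin n) (Fin n) ℂ) ⟨i, by omega⟩ ⟨i, by omega⟩ =
          (h k : Matrix (Fin n) (Fin n) ℂ) ⟨i + 1, hi⟩ ⟨i + 1, hi⟩ := by
      have hn : ∀ i, i + 1 < n → 1 < n := fun i hi => by omega
      intro i hi
      obtain ⟨hβ, e3⟩ := e3 (k : ZMod N) (hn i hi)
      have hrel : ∀ (i : ℕ) (hi : i + 1 < n),
          (h k : Matrix (Fin n) (Fin n) ℂ) ⟨i, by omega⟩ ⟨i, by omega⟩ *
            cyclicProduct (μ + 1) (lastCoeff z.2) k ⟨1, by omega⟩ ⟨0, by omega⟩ =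
          cyclicProduct (μ + 1) (lastCoeff z.1) k ⟨1, by omega⟩ ⟨0, by omega⟩ *
            (h k : Matrix (Fin n) (Fin n) ℂ) ⟨i + 1, hi⟩ ⟨i + 1, hi⟩ := by
        intro i hi
        have h1 := hprod k ⟨i, by omega⟩ ⟨i + 1, hi⟩
        rwa [hs1 k i hi, hs2 k i hi, one_mul] at h1
      have h2 := hprod k ⟨1, by omega⟩ ⟨0, by omega⟩
      have h3 := hrel 0 (by omega)
      rw [one_mul] at h2
      have h4 := hrel i hi
      have h00 := hne k ⟨0, by omega⟩
      have h10 := hne k ⟨1, by omega⟩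
      simp only [zero_add] at h3
      generalize cyclicProduct (μ + 1) (lastCoeff z.2) k ⟨1, by omega⟩ ⟨0, by omega⟩ = β' at *
      generalize cyclicProduct (μ + 1) (lastCoeff z.1) k ⟨1, by omega⟩ ⟨0, by omega⟩ = β at *
      -- The relations for the places `(1,2)` and `(2,1)` give `β'² = β²`; closeness decides the
      -- sign.
      have h5 : β' = β := by
        have h6 := e3 (β' / β) (by
          rw [div_pow, div_eq_one_iff_eq (pow_ne_zero 2 hβ)]
          apply mul_left_cancel₀ h00
          linear_combination β' * h3 + β * h2) (by rw [div_mul_cancel₀ _ hβ])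
        rwa [div_eq_one_iff_eq hβ] at h6
      rw [h5, mul_comm] at h4
      exact mul_left_cancel₀ hβ h4
    have hall : ∀ (i : ℕ) (hi : i < n),
        (h k : Matrix (Fin n) (Fin n) ℂ) ⟨i, hi⟩ ⟨i, hi⟩ =
          (h k : Matrix (Fin n) (Fin n) ℂ) 0 0 := by
      intro i
      induction i with
      | zero => intro _; rfl
      | succ i ih =>
        intro hi
        rw [← hstep i hi, ih]
    ext p q
    rw [Matrix.smul_apply, smul_eq_mul]
    by_cases hpq : p = q
    · subst hpq
      rw [hall p p.2, Matrix.one_apply_eq, mul_one]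
    · rw [hdiag k hpq, Matrix.one_apply_ne hpq, mul_zero]
  let t : ℤ → ℂ := fun k => (h k : Matrix (Fin n) (Fin n) ℂ) 0 0
  have ht0 : ∀ k, t k ≠ 0 := fun k => hne k 0
  have hrel : ∀ (k : ℤ) (i : Fin (μ + 1)), t (k + (i : ℕ)) • z.2 k i =
      t (k + (μ + 1 : ℕ)) • z.1 k i := by
    intro k i
    have h1 := hI k i
    rw [hsc, hsc (k + (μ + 1 : ℕ)), Matrix.smul_mul, Matrix.mul_smul, one_mul, mul_one] at h1
    exact h1
  have hper : ∀ k, t (k + N) = t k := fun k => by simp only [t, htw, one_smul]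
  let t' : ZMod N → ℂ := fun k => t k.val
  have ht' : ∀ k : ℤ, t' k = t k := fun k => eq_of_periodic (N := N) hper (by simp)
  -- The determinants of the `a_k^0` agree, so the `n`-th powers of the scalars are constant along
  -- the cycle.
  have hpow : ∀ k : ZMod N, t' (k + (μ + 1 : ℕ)) ^ n = t' k ^ n := by
    intro k
    obtain ⟨k, rfl⟩ := ZMod.intCast_surjective k
    have h1 := congr_arg Matrix.det (hrel k 0)
    rw [Matrix.det_smul, Matrix.det_smul, hdet1, hdet2, Fintype.card_fin] at h1
    have h2 := mul_right_cancel₀ (pow_ne_zero _ (by norm_num)) h1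
    have h3 := ht' (k + (μ + 1 : ℕ))
    rw [Int.cast_add, Int.cast_natCast] at h3
    rw [h3, ht', ← h2]
    simp
  have hpow0 : ∀ k : ZMod N, t' k ^ n = t' 0 ^ n := by
    have h1 : ∀ j : ℕ, t' ((j * (μ + 1) : ℕ) : ZMod N) ^ n = t' 0 ^ n := by
      intro j
      induction j with
      | zero => simp
      | succ j ih =>
        rw [← ih, ← hpow ((j * (μ + 1) : ℕ) : ZMod N)]
        congr 2
        push_cast
        ring
    intro k
    rw [← cycleIndex_mul hmN k, h1]
  -- The quotient `t_{k+1} / t_k` is an `n`-th root of unity, and is also the quotient of two nearby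
  -- non-zero entries of `a_{k-μ}^{m-1}`.
  have hconst : ∀ k : ZMod N, t' (k + 1) = t' k := by
    intro k
    obtain ⟨k, rfl⟩ := ZMod.intCast_surjective k
    obtain ⟨-, e4⟩ := e4 ((k - μ : ℤ) : ZMod N)
    have h1 := congr_fun (congr_fun (hrel (k - μ) (Fin.last μ)) (s ((k - μ : ℤ) : ZMod N)).1)
      (s ((k - μ : ℤ) : ZMod N)).2
    rw [Fin.val_last, sub_add_cancel,
      show k - μ + ((μ + 1 : ℕ) : ℤ) = k + 1 by push_cast; ring, Matrix.smul_apply,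
      Matrix.smul_apply, smul_eq_mul, smul_eq_mul] at h1
    have h2 := e4 (t (k + 1) / t k) (by
      have h3 := hpow0 ((k + 1 : ℤ) : ZMod N)
      rw [← hpow0 (k : ZMod N), ht', ht'] at h3
      rw [div_pow, h3, div_self (pow_ne_zero _ (ht0 k))]) (by
      rw [div_mul_eq_mul_div, ← h1, mul_div_cancel_left₀ _ (ht0 k)])
    rw [div_eq_one_iff_eq (ht0 k), ← ht', ← ht'] at h2
    simpa using h2
  funext k i
  obtain ⟨k, rfl⟩ := ZMod.intCast_surjective k
  have h1 := hrel k i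
  rw [← ht', ← ht', eq_of_add_one hconst, eq_of_add_one hconst ((_ : ℤ) : ZMod N)] at h1
  have h2 : t' 0 ≠ 0 := by
    have := ht0 0
    rwa [← ht', Int.cast_zero] at this
  exact (smul_right_injective _ h2 h1).symm

end Injectivity

/-! ### Local coordinates on the moduli space -/

section Charts

open Filter Topology

attribute [local instance] Matrix.normedAddCommGroup Matrix.normedSpace

variable {μ n N : ℕ} [NeZero N] [NeZero n]

/-- Shifting a window of `N` determinants of `h` by one place multiplies their product by `x ^ n`;
shifting by m multiplies it by `x ^ (m n) = 1`. -/
theorem prod_det_gaugeCoeff {h : ℤ → (Matrix (Fin n) (Fin n) ℂ)ˣ} {x : ℂ}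
    (hx : x ^ ((μ + 1) * n) = 1)
    (htw : ∀ k, (h (k + N) : Matrix (Fin n) (Fin n) ℂ) = x • (h k : Matrix (Fin n) (Fin n) ℂ))
    (a : Coefficients (μ + 1) n N) :
    ∏ k, ((-1) ^ (n * μ) *
        (gaugeCoeff (fun k => (h k : Matrix (Fin n) (Fin n) ℂ)) a k 0).det) =
      ∏ k, ((-1) ^ (n * μ) * (a k 0).det) := by
  let d : ℤ → ℂ := fun k => (h k : Matrix (Fin n) (Fin n) ℂ).det
  have hd0 : ∀ k, d k ≠ 0 := fun k =>
    isUnit_iff_ne_zero.1 ((Matrix.isUnit_iff_isUnit_det _).1 (h k).isUnit)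
  have hd : ∀ k, d (k + N) = x ^ n * d k := by
    intro k
    simp only [d]
    rw [htw, Matrix.det_smul, Fintype.card_fin]
  have hP : ∀ j : ℕ, ∏ i ∈ Finset.range N, d (i + j) =
      x ^ (j * n) * ∏ i ∈ Finset.range N, d i := by
    intro j
    induction j with
    | zero => simp
    | succ j ih =>
      have h1 := Finset.prod_range_succ (fun i : ℕ => d (i + j)) N
      have h2 := Finset.prod_range_succ' (fun i : ℕ => d (i + j)) N
      rw [h1] at h2
      rw [add_comm (N : ℤ), hd, Nat.cast_zero, zero_add, ← mul_assoc] at h2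
      have h3 := mul_right_cancel₀ (hd0 j) h2
      rw [ih] at h3
      rw [add_mul, one_mul, pow_add, mul_assoc, mul_comm (x ^ n), ← mul_assoc, h3]
      refine Finset.prod_congr rfl fun i _ => ?_
      congr 1
      push_cast
      ring
  have hP' : ∏ i ∈ Finset.range N, (d (i + (μ + 1 : ℕ)) / d i) = 1 := by
    rw [Finset.prod_div_distrib, hP, hx, one_mul, div_self]
    exact Finset.prod_ne_zero_iff.2 fun i _ => hd0 i
  rw [← prod_range_zmod, ← prod_range_zmod fun k => (-1) ^ (n * μ) * (a k 0).det]
  rw [← mul_one (∏ i ∈ Finset.range N, _ * (a _ 0).det), ← hP', ← Finset.prod_mul_distrib]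
  refine Finset.prod_congr rfl fun i hi => ?_
  have hv : ((i : ZMod N).val : ℤ) = i := by
    rw [ZMod.val_natCast, Nat.mod_eq_of_lt (Finset.mem_range.1 hi)]
  rw [gaugeCoeff, hv, Matrix.det_mul, Matrix.det_mul, Matrix.det_nonsing_inv,
    Ring.inverse_eq_inv']
  simp only [Fin.val_zero, Nat.cast_zero, add_zero, d]
  ring

theorem eq_of_intertwines {m : ℕ} {h : ℤ → (Matrix (Fin n) (Fin n) ℂ)ˣ}
    {a a' a'' : Coefficients m n N} (H : Intertwines h a a') (H' : Intertwines h a a'') :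
    a' = a'' := by
  funext k i
  obtain ⟨k, rfl⟩ := ZMod.intCast_surjective k
  exact (h (k + (i : ℕ))).isUnit.mul_left_cancel ((H k i).trans (H' k i).symm)

theorem ne_zero_of_pow_eq_one {x : ℂ} (hx : x ^ ((μ + 1) * n) = 1) : x ≠ 0 := by
  rintro rfl
  rw [zero_pow (NeZero.ne _)] at hx
  exact zero_ne_one hx

/-- Near a point `q` of the fibre over the class of a polygon with generic coefficients `a`, the
classes are those of polygons whose coefficients, in normal form, are near `a` and depend
holomorphically on the given coefficients. -/
theorem IsGeneric.exists_local_normalForm (hmN : Nat.Coprime (μ + 1) N)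
    {p q : TwistedLiftSpace (μ + 1) n N} (ha : IsGeneric p.coeff)
    (hpq : p.toModuli = q.toModuli)
    {ν : Coefficients (μ + 1) n N → Coefficients (μ + 1) n N}
    {O : Set (Coefficients (μ + 1) n N)} (hO : IsOpen O) (haO : p.coeff ∈ O)
    (hν : ∀ x ∈ O, DifferentiableAt ℂ ν x) (hνa : ν p.coeff = p.coeff)
    (hνO : ∀ x ∈ O, ∏ k, ((-1) ^ (n * μ) * (x k 0).det) = 1 →
        IsGenericNormalForm (ν x) ∧ ∃ h, Intertwines h x (ν x)) :
    ∃ f : Coefficients (μ + 1) n N → Coefficients (μ + 1) n N, f q.coeff = p.coeff ∧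
      ∀ᶠ c in 𝓝 q.coeff, DifferentiableAt ℂ f c ∧
        ∀ q' : TwistedLiftSpace (μ + 1) n N, q'.coeff = c →
          IsGenericNormalForm (f c) ∧ ∃ h, Intertwines h c (f c) := by
  obtain ⟨h, x, hx, htw, hI⟩ := exists_intertwines_of_isGeneric hmN ha hpq
  have hx0 := ne_zero_of_pow_eq_one hx
  have hx' : x⁻¹ ^ ((μ + 1) * n) = 1 := by rw [inv_pow, hx, inv_one]
  have htw' : ∀ k, ((h (k + N))⁻¹ : (Matrix (Fin n) (Fin n) ℂ)ˣ).val = x⁻¹ • ((h k)⁻¹ :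
      (Matrix (Fin n) (Fin n) ℂ)ˣ).val := by
    intro k
    have h1 : h (k + N) = Units.mk0 x hx0 • h k := Units.ext (htw k)
    rw [h1]
    simp [Units.smul_def]
  -- A fixed change of bases carries the coefficients of `q` exactly to those of `p`, and so carries
  -- a neighbourhood of the former into `O`, where `ν` applies.
  let G : Coefficients (μ + 1) n N → Coefficients (μ + 1) n N := fun c =>
    gaugeCoeff (fun k => ((h k)⁻¹ : (Matrix (Fin n) (Fin n) ℂ)ˣ).val) c
  have hGI : ∀ c, Intertwines (fun k => (h k)⁻¹) c (G c) := fun c =>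
    intertwines_gaugeCoeff (h := fun k => (h k)⁻¹) (inv_ne_zero hx0) htw' c
  have hGq : G q.coeff = p.coeff := eq_of_intertwines (hGI _) hI.symm
  have hGd : Differentiable ℂ G := fun c =>
    DifferentiableAt.gaugeCoeff (fun k => differentiableAt_const _)
      (fun k => isUnit_iff_ne_zero.1 ((Matrix.isUnit_iff_isUnit_det _).1 (h k)⁻¹.isUnit))
      differentiableAt_id
  refine ⟨fun c => ν (G c), by simp only [hGq, hνa], ?_⟩
  have hev : ∀ᶠ c in 𝓝 q.coeff, G c ∈ O :=
    hGd.continuous.continuousAt.eventually_mem (by rw [hGq]; exact hO.mem_nhds haO)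
  filter_upwards [hev] with c hc
  refine ⟨(hν _ hc).comp c (hGd c), ?_⟩
  rintro q' rfl
  obtain ⟨h1, h', h2⟩ := hνO _ hc
    ((prod_det_gaugeCoeff (h := fun k => (h k)⁻¹) hx' htw' _).trans q'.prod_det_coeff)
  exact ⟨h1, _, (hGI _).trans h2⟩

theorem IsGeneric.mem_genericLocus {a : UnimodularCoefficients μ n N} (ha : IsGeneric a.1) :
    a.toModuli ∈ genericLocus μ n N :=
  ⟨a.toLift, fun k => by
    change (frame a.vec k).det = 1
    rw [a.frame_vec, Matrix.SpecialLinearGroup.det_coe], by rwa [a.coeff_toLift], rfl⟩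

/-- The class of the polygons with given coefficients, when these are unimodular. -/
noncomputable def classOf (x₀ : ModuliSpace (μ + 1) n N) (a : Coefficients (μ + 1) n N) :
    ModuliSpace (μ + 1) n N :=
  open Classical in
  if h : ∀ k, (a k 0).det = (-1) ^ (n * μ) then UnimodularCoefficients.toModuli ⟨a, h⟩ else x₀

theorem classOf_eq {x₀ : ModuliSpace (μ + 1) n N} {a : Coefficients (μ + 1) n N}
    (h : ∀ k, (a k 0).det = (-1) ^ (n * μ)) :
    classOf x₀ a = UnimodularCoefficients.toModuli ⟨a, h⟩ :=
  dif_pos h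

theorem IsGenericNormalForm.det_zero {a : Coefficients (μ + 1) n N} (h : IsGenericNormalForm a) :
    ∀ k, (a k 0).det = (-1) ^ (n * μ) := (isGenericNormalForm_iff.1 h).2.1

/-- Around a generic polygon, suitable entries of the coefficients are local coordinates. -/
theorem IsGeneric.exists_chart (hμ : 1 ≤ μ) (hmN : Nat.Coprime (μ + 1) N)
    {p : TwistedLiftSpace (μ + 1) n N} (ha : IsGeneric p.coeff)
    (hs : Syzygies (μ + 1) (lastCoeff p.coeff)) :
    ∃ (T : Finset (ZMod N × Fin (μ + 1) × Fin n × Fin n))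
      (e : OpenPartialHomeomorph (ModuliSpace (μ + 1) n N) (T → ℂ))
      (α : (T → ℂ) → Coefficients (μ + 1) n N), IsCoordinateSelection T ∧
      IsCoefficientChart T e α ∧ p.toModuli ∈ e.source ∧ α (e p.toModuli) = p.coeff ∧
      e.source ⊆ genericLocus μ n N := by
  set a := p.coeff with ha_def
  have han : IsGenericNormalForm a := ha.isGenericNormalForm hs
  obtain ⟨ν, hν1, hν2, hν3⟩ := ha.exists_normalizer hmN hs
  obtain ⟨T, α, hT, hα1, hα2, hα3⟩ := ha.exists_parametrization hμ hs
  have hprod := ha.eventually_eq_of_intertwines hmN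
  rw [nhds_prod_eq] at hprod
  obtain ⟨S, hS, S', hS', hSS⟩ := Filter.mem_prod_iff.1 hprod
  -- All the local facts are gathered on a single open set `O`; the parameter domain `W` is then
  -- chosen so that `α` maps it into `O`.
  have hev : ∀ᶠ x in 𝓝 a, x ∈ S ∧ x ∈ S' ∧ DifferentiableAt ℂ ν x ∧
      (∏ k, ((-1) ^ (n * μ) * (x k 0).det) = 1 →
        IsGenericNormalForm (ν x) ∧ ∃ h, Intertwines h x (ν x)) ∧
      (IsGenericNormalForm x → ν x = x) ∧ (IsGenericNormalForm x → IsGeneric x) ∧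
      (IsGenericNormalForm x → α (entries T x) = x) := by
    filter_upwards [hS, hS', hν1, hν2, hν3, ha.eventually, hα2] with x h1 h2 h3 h4 h5 h6 h7
    exact ⟨h1, h2, h3, h4, h5, h6, h7⟩
  obtain ⟨O, hOsub, hO, haO⟩ := eventually_nhds_iff.1 hev
  have hαa : α (entries T a) = a := hα2.self_of_nhds han
  have hαc : ContinuousAt α (entries T a) := hα1.self_of_nhds.2.2.continuousAt
  obtain ⟨W, hWsub, hW, haW⟩ := eventually_nhds_iff.1
    (hα1.and (hαc.eventually_mem (by rw [hαa]; exact hO.mem_nhds haO)))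
  let Φ : (T → ℂ) → ModuliSpace (μ + 1) n N := fun y => classOf p.toModuli (α y)
  have hdet : ∀ y ∈ W, ∀ k, (α y k 0).det = (-1) ^ (n * μ) := fun y hy =>
    (hWsub y hy).1.2.1.det_zero
  have hΦ : ∀ y (hy : y ∈ W), Φ y = UnimodularCoefficients.toModuli ⟨α y, hdet y hy⟩ :=
    fun y hy => classOf_eq _
  have hgen : ∀ y ∈ W, IsGeneric (α y) := fun y hy =>
    (hOsub _ (hWsub y hy).2).2.2.2.2.2.1 (hWsub y hy).1.2.1
  have hΦ_of : ∀ y ∈ W, ∀ (q : TwistedLiftSpace (μ + 1) n N) h, Intertwines h q.coeff (α y) →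
      q.toModuli = Φ y := by
    intro y hy q h hI
    rw [hΦ y hy]
    exact UnimodularCoefficients.toModuli_eq_of_intertwines (h := h) hI
  have hinj : Set.InjOn Φ W := by
    intro y hy y' hy' h
    rw [hΦ y hy, hΦ y' hy'] at h
    obtain ⟨h, x, hx, htw, hI⟩ := exists_intertwines_of_isGeneric hmN
      (p := UnimodularCoefficients.toLift ⟨α y, hdet y hy⟩)
      (by rw [UnimodularCoefficients.coeff_toLift]; exact hgen y hy) h
    rw [UnimodularCoefficients.coeff_toLift, UnimodularCoefficients.coeff_toLift] at hI
    have h1 : α y = α y' := hSS (Set.mk_mem_prod (hOsub _ (hWsub y hy).2).1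
      (hOsub _ (hWsub y' hy').2).2.1) h x hx htw hI (hWsub y hy).1.2.1 (hWsub y' hy').1.2.1
    rw [← (hWsub y hy).1.1, ← (hWsub y' hy').1.1, h1]
  have hαcont : ContinuousOn α W := fun y hy =>
    (hWsub y hy).1.2.2.continuousAt.continuousWithinAt
  have hΦcont : ContinuousOn Φ W := by
    rw [continuousOn_iff_continuous_domRestrict]
    have h1 : W.domRestrict Φ = fun y : W => UnimodularCoefficients.toModuli
        ⟨α y, hdet y y.2⟩ := funext fun y => hΦ y y.2
    rw [h1]
    exact UnimodularCoefficients.continuous_toModuli.comp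
      ((continuousOn_iff_continuous_domRestrict.1 hαcont).subtype_mk _)
  -- The topology is a quotient topology, so every lift `q` over the class must be treated, however
  -- far from the normalized one. Coordinates that are holomorphic in the coefficients near `q`
  -- yield at once the openness of the image, the continuity of the inverse and the holomorphy along
  -- families.
  have key : ∀ y ∈ W, ∀ q : TwistedLiftSpace (μ + 1) n N, q.toModuli = Φ y →
      ∃ f : Coefficients (μ + 1) n N → (T → ℂ), ∀ᶠ c in 𝓝 q.coeff, DifferentiableAt ℂ f c ∧
        ∀ q' : TwistedLiftSpace (μ + 1) n N, q'.coeff = c → f c ∈ W ∧ q'.toModuli = Φ (f c) := by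
    intro y hy q hq
    have hyO := (hWsub y hy).2
    obtain ⟨f, hf1, hf2⟩ := IsGeneric.exists_local_normalForm hmN (q := q)
      (p := UnimodularCoefficients.toLift ⟨α y, hdet y hy⟩) (ν := ν)
      (by rw [UnimodularCoefficients.coeff_toLift]; exact hgen y hy)
      (by rw [hq, hΦ y hy]; rfl) hO (by rw [UnimodularCoefficients.coeff_toLift]; exact hyO)
      (fun x hx => (hOsub x hx).2.2.1)
      (by
        rw [UnimodularCoefficients.coeff_toLift]
        exact (hOsub _ hyO).2.2.2.2.1 (hWsub y hy).1.2.1)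
      (fun x hx => (hOsub x hx).2.2.2.1)
    rw [UnimodularCoefficients.coeff_toLift] at hf1
    have hfc : ContinuousAt f q.coeff := hf2.self_of_nhds.1.continuousAt
    have hd : Differentiable ℂ (entries T : Coefficients (μ + 1) n N → (T → ℂ)) := fun c =>
      differentiableAt_pi.2 fun t => differentiableAt_matrix.1
        (differentiableAt_pi.1 (differentiableAt_pi.1 differentiableAt_id _) _) _ _
    refine ⟨fun c => entries T (f c), ?_⟩
    filter_upwards [hf2, hfc.eventually_mem (by rw [hf1]; exact hO.mem_nhds hyO),
      (((continuous_entries T).continuousAt (x := f q.coeff)).comp hfc).eventually_mem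
        (show W ∈ 𝓝 (entries T (f q.coeff)) by
          rw [hf1, (hWsub y hy).1.1]; exact hW.mem_nhds hy)] with c ⟨h1, h2⟩ h3 h4
    refine ⟨(hd _).comp c h1, fun q' hq' => ⟨h4, ?_⟩⟩
    obtain ⟨h5, h, h6⟩ := h2 q' hq'
    refine hΦ_of _ h4 q' h ?_
    change Intertwines h q'.coeff (α (entries T (f c)))
    rw [(hOsub _ h3).2.2.2.2.2.2 h5, hq']
    exact h6
  have hinv : ∀ y ∈ W, Function.invFunOn Φ W (Φ y) = y := fun y hy =>
    hinj.leftInvOn_invFunOn hy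
  have hsource : IsOpen (Φ '' W) := by
    rw [isOpen_coinduced, isOpen_iff_mem_nhds]
    rintro q ⟨y, hy, hyq⟩
    obtain ⟨f, hf⟩ := key y hy q hyq.symm
    filter_upwards [TwistedLiftSpace.continuous_coeff.continuousAt.eventually hf] with q' hq'
    exact ⟨_, (hq'.2 q' rfl).1, (hq'.2 q' rfl).2.symm⟩
  let e : OpenPartialHomeomorph (ModuliSpace (μ + 1) n N) (T → ℂ) :=
    { toFun := Function.invFunOn Φ W
      invFun := Φ
      source := Φ '' W
      target := W
      map_source' := by
        rintro _ ⟨y, hy, rfl⟩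
        rw [hinv y hy]
        exact hy
      map_target' := fun y hy => ⟨y, hy, rfl⟩
      left_inv' := by
        rintro _ ⟨y, hy, rfl⟩
        rw [hinv y hy]
      right_inv' := fun y hy => hinv y hy
      open_source := hsource
      open_target := hW
      continuousOn_toFun := by
        rw [continuousOn_open_iff hsource]
        intro V hV
        rw [isOpen_coinduced, isOpen_iff_mem_nhds]
        rintro q ⟨⟨y, hy, hyq⟩, hqV⟩
        obtain ⟨f, hf⟩ := key y hy q hyq.symm
        have h1 := (hf.self_of_nhds.2 q rfl).2
        have h2 : f q.coeff ∈ V := by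
          rw [Set.mem_preimage, h1, hinv _ (hf.self_of_nhds.2 q rfl).1] at hqV
          exact hqV
        have h3 := hf.and (hf.self_of_nhds.1.continuousAt.eventually_mem (hV.mem_nhds h2))
        filter_upwards [TwistedLiftSpace.continuous_coeff.continuousAt.eventually h3] with q' hq'
        obtain ⟨h4, h5⟩ := hq'.1.2 q' rfl
        refine ⟨⟨_, h4, h5.symm⟩, ?_⟩
        rw [Set.mem_preimage, h5, hinv _ h4]
        exact hq'.2
      continuousOn_invFun := hΦcont }
  have hpΦ : p.toModuli = Φ (entries T a) := by
    refine hΦ_of _ haW p 1 ?_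
    rw [hαa]
    exact Intertwines.refl _
  refine ⟨T, e, α, hT, ⟨fun y hy t => congr_fun (hWsub y hy).1.1 t,
    fun y hy => (hWsub y hy).1.2.1, fun y hy => ?_, fun k i p q y hy => ?_,
    fun y hy y' hy' h k i hi => ?_, fun r D F hD hF hsrc z hz => ?_⟩, ⟨_, haW, hpΦ.symm⟩, ?_, ?_⟩
  · let u : UnimodularCoefficients μ n N := ⟨α y, hdet y hy⟩
    refine ⟨u.toLift.toPolygon, u.toLift.1.2, u.vec, (hΦ y hy).symm, u.toLift.isTwistedLift,
      fun k => ?_, u.recursion_vec⟩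
    rw [u.frame_vec, Matrix.SpecialLinearGroup.det_coe]
  · exact (differentiableAt_matrix.1 (differentiableAt_pi.1 (differentiableAt_pi.1
      (hWsub y hy).1.2.2 k) i) p q).differentiableWithinAt
  · rw [show i = Fin.last μ from Fin.ext (by simpa using hi)]
    exact hα3 y y' h k
  · obtain ⟨y, hy, hyq⟩ := hsrc z hz
    obtain ⟨f, hf⟩ := key y hy (F z) hyq.symm
    have hFd : DifferentiableAt ℂ (fun z => (F z).coeff) z :=
      DifferentiableAt.coeff fun k x j => (hF k x j).differentiableAt (hD.mem_nhds hz)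
    have h1 : (fun z => e (F z).toModuli) =ᶠ[𝓝 z] fun z => f (F z).coeff := by
      filter_upwards [hFd.continuousAt.eventually hf] with z' hz'
      obtain ⟨h4, h5⟩ := hz'.2 (F z') rfl
      rw [h5]
      exact hinv _ h4
    exact ((hf.self_of_nhds.1.comp z hFd).congr_of_eventuallyEq h1).differentiableWithinAt
  · rw [hpΦ]
    change α (Function.invFunOn Φ W (Φ (entries T a))) = a
    rw [hinv _ haW, hαa]
  · rintro _ ⟨y, hy, rfl⟩
    rw [hΦ y hy]
    exact IsGeneric.mem_genericLocus (hgen y hy)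

theorem isOpen_genericLocus (hμ : 1 ≤ μ) (hmN : Nat.Coprime (μ + 1) N) :
    IsOpen (genericLocus μ n N) := by
  rw [isOpen_iff_mem_nhds]
  intro x hx
  obtain ⟨p, hp, hgen, rfl⟩ := hx
  obtain ⟨q, hq, -, -, hqgen, hqs⟩ := p.exists_syzygies hmN hp hgen
  obtain ⟨T, e, α, -, -, h1, -, h2⟩ := hqgen.exists_chart hμ hmN hqs
  have h3 : q.toModuli = p.toModuli := by
    rw [TwistedLiftSpace.toModuli, hq]
    rfl
  rw [h3] at h1
  exact Filter.mem_of_superset (e.open_source.mem_nhds h1) h2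

end Charts

/-! ### An explicit generic family -/

section Average

variable {μ n N : ℕ} [NeZero N] [NeZero n]

/-- The projection onto the constant vectors. -/
noncomputable def averaging (n : ℕ) : Matrix (Fin n) (Fin n) ℂ := Matrix.of fun _ _ => (n : ℂ)⁻¹

theorem averaging_mul_averaging : averaging n * averaging n = averaging n := by
  ext p q
  have : (n : ℂ) ≠ 0 := Nat.cast_ne_zero.2 (NeZero.ne n)
  simp [averaging, Matrix.mul_apply]
  field_simp

/-- The matrix that multiplies the constant vectors by `s` and fixes the vectors of sum `0`. -/
noncomputable def stretch (n : ℕ) (s : ℂ) : Matrix (Fin n) (Fin n) ℂ := 1 + (s - 1) • averaging n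

theorem stretch_one : stretch n 1 = 1 := by simp [stretch]

theorem stretch_mul_stretch (s t : ℂ) : stretch n s * stretch n t = stretch n (s * t) := by
  simp only [stretch, add_mul, mul_add, one_mul, mul_one, Matrix.smul_mul, Matrix.mul_smul,
    averaging_mul_averaging]
  module

theorem stretch_pow (s : ℂ) (j : ℕ) : stretch n s ^ j = stretch n (s ^ j) := by
  induction j with
  | zero => simp [stretch_one]
  | succ j ih => rw [pow_succ, ih, stretch_mul_stretch, pow_succ]

theorem adjugate_stretch {s : ℂ} (hs : s ≠ 0) :
    (stretch n s).adjugate = (stretch n s).det • stretch n s⁻¹ := by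
  have h1 : (stretch n s).adjugate * (stretch n s * stretch n s⁻¹) =
      (stretch n s).det • stretch n s⁻¹ := by
    rw [← mul_assoc, Matrix.adjugate_mul, Matrix.smul_mul, one_mul]
  rwa [stretch_mul_stretch, mul_inv_cancel₀ hs, stretch_one, mul_one] at h1

theorem det_stretch_ne_zero {s : ℂ} (hs : s ≠ 0) : (stretch n s).det ≠ 0 := by
  intro h
  have h1 := congr_arg Matrix.det (stretch_mul_stretch (n := n) s s⁻¹)
  rw [Matrix.det_mul, h, zero_mul, mul_inv_cancel₀ hs, stretch_one, Matrix.det_one] at h1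
  exact zero_ne_one h1

/-- Separates the parts of weight `1`, `s` and `t`; below, `s * t` does not depend on `j`. -/
theorem stretch_mul_mul_stretch (A : Matrix (Fin n) (Fin n) ℂ) (s t : ℂ) :
    stretch n s * A * stretch n t =
      (A - averaging n * A - A * averaging n + (1 + s * t) • (averaging n * A * averaging n)) +
      s • (averaging n * A - averaging n * A * averaging n) +
      t • (A * averaging n - averaging n * A * averaging n) := by
  simp only [stretch, add_mul, mul_add, one_mul, mul_one, Matrix.smul_mul, Matrix.mul_smul]
  module

/-- A Vandermonde system at the nodes `1`, `w`, `w⁻¹`, which are distinct because `w ^ 2 ≠ 1`. This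
is why three stabilizer matrices are used. -/
theorem eq_zero_of_laurent {w p s t : ℂ} (hw : w ≠ 0) (hw2 : w ^ 2 ≠ 1) (h0 : p + s + t = 0)
    (h1 : p + w * s + w⁻¹ * t = 0) (h2 : p + w ^ 2 * s + w⁻¹ ^ 2 * t = 0) :
    p = 0 ∧ s = 0 ∧ t = 0 := by
  have hw1 : w - 1 ≠ 0 := fun h => hw2 (by rw [sub_eq_zero.1 h, one_pow])
  have e1 : w * s = t := by
    apply mul_left_cancel₀ hw1
    field_simp at h1
    linear_combination h1 - w * h0
  have e2 : w ^ 3 * s = t := by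
    apply mul_left_cancel₀ hw1
    field_simp at h1 h2
    linear_combination h2 - w * h1
  have e3 : s = 0 := by
    have : (w * (w ^ 2 - 1)) * s = 0 := by linear_combination e2 - e1
    exact (mul_eq_zero.1 this).resolve_left (mul_ne_zero hw (sub_ne_zero.2 hw2))
  subst e3
  rw [mul_zero] at e1
  subst e1
  exact ⟨by simpa using h0, rfl, rfl⟩

theorem averaging_mul_diagonal_apply (d : Fin n → ℂ) (p q : Fin n) :
    (averaging n * Matrix.diagonal d - averaging n * Matrix.diagonal d * averaging n) p q =
      (n : ℂ)⁻¹ * (d q - (n : ℂ)⁻¹ * ∑ r, d r) := by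
  rw [Matrix.sub_apply, Matrix.mul_diagonal, Matrix.mul_apply]
  simp only [Matrix.mul_diagonal, averaging, Matrix.of_apply, ← Finset.sum_mul, ← Finset.mul_sum]
  ring

theorem diagonal_mul_averaging_apply (d : Fin n → ℂ) (p q : Fin n) :
    (Matrix.diagonal d * averaging n - averaging n * Matrix.diagonal d * averaging n) p q =
      (n : ℂ)⁻¹ * (d p - (n : ℂ)⁻¹ * ∑ r, d r) := by
  rw [Matrix.sub_apply, Matrix.diagonal_mul, Matrix.mul_apply]
  simp only [Matrix.mul_diagonal, averaging, Matrix.of_apply, ← Finset.sum_mul, ← Finset.mul_sum]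
  ring

/-- A diagonal matrix with distinct entries and the projection onto the constant vectors have a
trivial commutant, even if only some of their products are known. -/
theorem exists_eq_smul_of_commute_stretch {d : Fin n → ℂ} (hd : Function.Injective d)
    {w v : ℂ} (hw : w ≠ 0) (hw2 : w ^ 2 ≠ 1) (hv : v ≠ 0) {x : Matrix (Fin n) (Fin n) ℂ}
    (h : ∀ j : Fin 3, Commute x (stretch n (w ^ (j : ℕ)) * Matrix.diagonal d *
      stretch n (w⁻¹ ^ (j : ℕ) * v))) : ∃ c : ℂ, x = c • 1 := by
  by_cases hn : ∃ p q : Fin n, p ≠ q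
  swap
  · push Not at hn
    refine ⟨x 0 0, ?_⟩
    ext p q
    rw [hn p 0, hn q 0]
    simp
  obtain ⟨p₀, q₀, hpq⟩ := hn
  set A := Matrix.diagonal d with hA
  set E := averaging n with hE
  set S := E * A - E * A * E with hS
  set T := A * E - E * A * E with hT
  set P := A - E * A - A * E + (1 + v) • (E * A * E) with hP
  have hdec : ∀ j : ℕ, stretch n (w ^ j) * A * stretch n (w⁻¹ ^ j * v) =
      P + w ^ j • S + (w⁻¹ ^ j * v) • T := by
    intro j
    rw [stretch_mul_mul_stretch, ← mul_assoc, ← mul_pow, mul_inv_cancel₀ hw, one_pow, one_mul]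
  have hent : ∀ p q, (x * P - P * x) p q = 0 ∧ (x * S - S * x) p q = 0 ∧
      v * (x * T - T * x) p q = 0 := by
    intro p q
    have hj : ∀ j : Fin 3, (x * P - P * x) p q + w ^ (j : ℕ) * (x * S - S * x) p q +
        w⁻¹ ^ (j : ℕ) * (v * (x * T - T * x) p q) = 0 := by
      intro j
      have h1 := (h j).eq
      rw [hdec] at h1
      have h2 := congr_arg (fun y : Matrix (Fin n) (Fin n) ℂ => y p q) h1
      simp only [mul_add, add_mul, Matrix.mul_smul, Matrix.smul_mul, Matrix.sub_apply,
        Matrix.add_apply, Matrix.smul_apply, smul_eq_mul] at h2 ⊢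
      linear_combination h2
    have h0 := hj 0
    have h1 := hj 1
    have h2 := hj 2
    simp only [Fin.val_zero, Fin.val_one, Fin.val_two, pow_zero, pow_one, one_mul] at h0 h1 h2
    exact eq_zero_of_laurent hw hw2 h0 h1 h2
  have cP : Commute x P := sub_eq_zero.1 (by ext p q; exact (hent p q).1)
  have cS : Commute x S := sub_eq_zero.1 (by ext p q; exact (hent p q).2.1)
  have cT : Commute x T := sub_eq_zero.1 (by
    ext p q; exact (mul_eq_zero.1 (hent p q).2.2).resolve_left hv)
  have hn0 : (n : ℂ) ≠ 0 := Nat.cast_ne_zero.2 (NeZero.ne n)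
  let y : Fin n → ℂ := fun p => (n : ℂ)⁻¹ * (d p - (n : ℂ)⁻¹ * ∑ r, d r)
  -- The vector `y` measures the deviation of `d` from its mean; it is non-zero since `d` takes at
  -- least two values.
  obtain ⟨p₁, hp₁⟩ : ∃ p, y p ≠ 0 := by
    by_contra! h0
    have h1 : ∀ p, d p = (n : ℂ)⁻¹ * ∑ r, d r := fun p =>
      sub_eq_zero.1 ((mul_eq_zero.1 (h0 p)).resolve_left (inv_ne_zero hn0))
    exact hpq (hd ((h1 p₀).trans (h1 q₀).symm))
  have hSy : ∀ p q, S p q = y q := fun p q => averaging_mul_diagonal_apply d p q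
  have hTy : ∀ p q, T p q = y p := fun p q => diagonal_mul_averaging_apply d p q
  -- All the rows of `S` equal `y`, so commuting with `S` makes the row sums of `x` constant. The
  -- columns of `T` do the same for the column sums, and then `x` commutes with `E`.
  obtain ⟨l, hl⟩ : ∃ l, ∀ p, ∑ r, x p r = l := by
    refine ⟨(∑ r, y r * x r p₁) / y p₁, fun p => ?_⟩
    have h1 := congr_fun (congr_fun cS.eq p) p₁
    simp only [Matrix.mul_apply, hSy, ← Finset.sum_mul] at h1
    rw [eq_div_iff hp₁, h1]
  obtain ⟨l', hl'⟩ : ∃ l, ∀ q, ∑ r, x r q = l := by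
    refine ⟨(∑ r, x p₁ r * y r) / y p₁, fun q => ?_⟩
    have h1 := congr_fun (congr_fun cT.eq p₁) q
    simp only [Matrix.mul_apply, hTy, ← Finset.mul_sum] at h1
    rw [eq_div_iff hp₁, h1, mul_comm]
  have hll : l = l' := by
    have h1 : ∑ p, ∑ r, x p r = ∑ r, ∑ p, x p r := Finset.sum_comm
    simp only [hl, hl', Finset.sum_const, Finset.card_univ, Fintype.card_fin, nsmul_eq_mul] at h1
    exact mul_left_cancel₀ hn0 h1
  have cE : Commute x E := by
    ext p q
    simp only [Matrix.mul_apply, hE, averaging, Matrix.of_apply, ← Finset.sum_mul,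
      ← Finset.mul_sum]
    rw [hl, hl', hll, mul_comm]
  have hEE : E * E = E := averaging_mul_averaging
  have hEPE : E * P * E = v • (E * A * E) := by
    have h1 : E * (E * A) = E * A := by rw [← mul_assoc, hEE]
    have h2 : E * A * E * E = E * A * E := by rw [mul_assoc, hEE]
    have h3 : E * (E * A * E) = E * A * E := by rw [← mul_assoc, h1]
    rw [hP, mul_add, mul_sub, mul_sub, h1, Matrix.mul_smul, h3, ← mul_assoc E A E, add_mul, sub_mul,
      sub_mul, Matrix.smul_mul, h2]
    module
  have cZ : Commute x (E * A * E) := by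
    have h1 : Commute x (v • (E * A * E)) := hEPE ▸ (cE.mul_right cP).mul_right cE
    have h2 := h1.smul_right v⁻¹
    rwa [smul_smul, inv_mul_cancel₀ hv, one_smul] at h2
  -- Compressing `P` by `E` isolates `E * A * E`, and `A` is a combination of the four matrices
  -- known to commute with `x`.
  have cA : Commute x A := by
    have h1 : A = P + S + T + (1 - v) • (E * A * E) := by
      rw [hP, hS, hT]
      module
    rw [h1]
    exact ((cP.add_right cS).add_right cT).add_right (cZ.smul_right _)
  have hx : ∀ p q, p ≠ q → x p q = 0 := by
    intro p q hpq
    have h1 := congr_fun (congr_fun cA.eq p) q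
    rw [hA, Matrix.mul_diagonal, Matrix.diagonal_mul] at h1
    have h2 : x p q * (d q - d p) = 0 := by linear_combination h1
    exact (mul_eq_zero.1 h2).resolve_right (sub_ne_zero.2 fun h => hpq (hd h).symm)
  refine ⟨l, ?_⟩
  ext p q
  rw [Matrix.smul_apply, smul_eq_mul]
  by_cases h1 : p = q
  · subst h1
    rw [Matrix.one_apply_eq, mul_one, ← hl p,
      Finset.sum_eq_single p (fun r _ hr => hx p r hr.symm) (by simp)]
  · rw [hx p q h1, Matrix.one_apply_ne h1, mul_zero]

/-- Explicit generic coefficients. -/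
theorem isGeneric_of_lastCoeff_eq {a : Coefficients (μ + 1) n N} (hd : ∀ k, (a k 0).IsDiag)
    (hdet : ∀ k, (a k 0).det = (-1) ^ (n * μ))
    (he : ∀ p q, p ≠ q → cycleEigenvalue a p ^ ((μ + 1) * n) ≠ cycleEigenvalue a q ^ ((μ + 1) * n))
    (hc : ∀ k, a k (Fin.last μ) = stretch n 2) : IsGeneric a := by
  set w : ℂ := 2 ^ N with hw
  have hw0 : w ≠ 0 := pow_ne_zero _ two_ne_zero
  have hN : 1 < 2 ^ N := Nat.one_lt_two_pow (NeZero.ne N)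
  have hw' : w = ((2 ^ N : ℕ) : ℂ) := by rw [hw]; push_cast; rfl
  have hw1 : w - 1 ≠ 0 := by
    rw [hw', sub_ne_zero]
    exact_mod_cast hN.ne'
  have hw2 : w ^ 2 ≠ 1 := by
    rw [hw', ← Nat.cast_pow]
    exact_mod_cast (Nat.one_lt_pow two_ne_zero hN).ne'
  have hb : ∀ k, cyclicProduct (μ + 1) (lastCoeff a) k = stretch n w := by
    intro k
    simp only [cyclicProduct, hc, List.ofFn_const, List.prod_replicate, stretch_pow, hw]
  have hn0 : (n : ℂ) ≠ 0 := Nat.cast_ne_zero.2 (NeZero.ne n)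
  have hoff : ∀ p q : Fin n, p ≠ q → stretch n w p q ≠ 0 := by
    intro p q hpq
    simp only [stretch, averaging, Matrix.add_apply, Matrix.one_apply_ne hpq, zero_add,
      Matrix.smul_apply, Matrix.of_apply, smul_eq_mul]
    exact mul_ne_zero hw1 (inv_ne_zero hn0)
  refine ⟨hd, hdet, he, fun k i hi => ?_, fun k hi => ?_, ?_, fun k => ?_, fun x hx => ?_⟩
  · rw [hb]
    exact hoff _ _ (by simp [Fin.ext_iff])
  · rw [hb]
    exact hoff _ _ (by simp [Fin.ext_iff])
  · rw [hb]
    simp only [stretch, averaging, Matrix.add_apply, Matrix.one_apply_eq,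
      Matrix.smul_apply, Matrix.of_apply, smul_eq_mul]
    intro h
    have h1 : w + n = 1 := by
      field_simp at h
      linear_combination h
    rw [hw'] at h1
    have h2 : 2 ^ N + n = 1 := by exact_mod_cast h1
    omega
  · rw [hc]
    exact det_stretch_ne_zero two_ne_zero
  · refine exists_eq_smul_of_commute_stretch (d := cycleEigenvalue a) (w := w)
      (v := w⁻¹ ^ (μ + 1)) (fun p q h => ?_) hw0 hw2 (pow_ne_zero _ (inv_ne_zero hw0)) fun j => ?_
    · by_contra hpq
      exact he p q hpq (by rw [h])
    · have h1 := hx j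
      simp only [stabilizerMatrix, hb, adjugate_stretch hw0, smul_pow, stretch_pow,
        Matrix.mul_smul, Matrix.smul_mul] at h1
      have h2 := smul_right_injective _ (pow_ne_zero _ (det_stretch_ne_zero (n := n) hw0)) h1
      rw [← pow_add]
      exact h2

end Average

/-! ### Density of the generic locus -/

section Density

open Filter Topology

variable {μ n N : ℕ} [NeZero N] [NeZero n]

/-- Continuity of the class in the coefficients reduces approximation in the moduli space to
approximation of coefficients. The values of `γ` are only required to be unimodular at the points
used. -/
theorem UnimodularCoefficients.mem_closure_of_frequently {X : Type*} {l : Filter X}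
    {γ : X → Coefficients (μ + 1) n N} {u : UnimodularCoefficients μ n N}
    (hγ : Tendsto γ l (𝓝 u.1)) {S : Set (ModuliSpace (μ + 1) n N)}
    (h : ∃ᶠ z in l, ∃ v : UnimodularCoefficients μ n N, v.1 = γ z ∧ v.toModuli ∈ closure S) :
    u.toModuli ∈ closure S := by
  by_contra hu
  obtain ⟨O, hO, hO'⟩ := isOpen_induced_iff.1
    (isClosed_closure.isOpen_compl.preimage
      (UnimodularCoefficients.continuous_toModuli (μ := μ) (n := n) (N := N)) :
        IsOpen (UnimodularCoefficients.toModuli ⁻¹' (closure S)ᶜ))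
  have hmem : ∀ v : UnimodularCoefficients μ n N, v.1 ∈ O ↔ v.toModuli ∉ closure S :=
    fun v => Set.ext_iff.1 hO' v
  obtain ⟨z, ⟨v, hv, hvS⟩, hz⟩ :=
    (h.and_eventually (hγ.eventually_mem (hO.mem_nhds ((hmem u).2 hu)))).exists
  exact (hmem v).1 (hv ▸ hz) hvS

/-- The coefficients with the last ones moved towards explicit generic ones. -/
noncomputable def deformLast (a : Coefficients (μ + 1) n N) (t : ℂ) : Coefficients (μ + 1) n N :=
  fun k => Function.update (a k) (Fin.last μ)
    ((1 - t) • a k (Fin.last μ) + t • stretch n 2)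

theorem deformLast_zero (a : Coefficients (μ + 1) n N) : deformLast a 0 = a := by
  funext k
  simp [deformLast]

theorem deformLast_apply_zero (hμ : 1 ≤ μ) (a : Coefficients (μ + 1) n N) (t : ℂ) (k : ZMod N) :
    deformLast a t k 0 = a k 0 :=
  Function.update_of_ne (fun h => by simp [Fin.ext_iff] at h; omega) _ _

section

attribute [local instance] Matrix.normedAddCommGroup Matrix.normedSpace

theorem contDiff_deformLast (a : Coefficients (μ + 1) n N) : ContDiff ℂ 1 (deformLast a) := by
  refine contDiff_pi.2 fun k => contDiff_pi.2 fun i => ?_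
  by_cases h : i = Fin.last μ
  · subst h
    simp only [deformLast, Function.update_self]
    exact ((contDiff_const.sub contDiff_id).smul contDiff_const).add
      (contDiff_id.smul contDiff_const)
  · simp only [deformLast, Function.update_of_ne h]
    exact contDiff_const

/-- The line `deformLast` joins the coefficients, at `0`, to explicit generic ones, at `1`. The
certificate of the latter is entire along the line and non-zero at `1`, so by the identity theorem
it cannot vanish near `0`. -/
theorem UnimodularCoefficients.mem_closure_of_isDiag (hμ : 1 ≤ μ)
    (u : UnimodularCoefficients μ n N) (hd : ∀ k, (u.1 k 0).IsDiag)
    (he : ∀ p q, p ≠ q →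
      cycleEigenvalue u.1 p ^ ((μ + 1) * n) ≠ cycleEigenvalue u.1 q ^ ((μ + 1) * n)) :
    u.toModuli ∈ closure (genericLocus μ n N) := by
  have h0 : ∀ t k, deformLast u.1 t k 0 = u.1 k 0 := deformLast_apply_zero hμ u.1
  have h1 : IsGeneric (deformLast u.1 1) := by
    refine isGeneric_of_lastCoeff_eq (fun k => h0 1 k ▸ hd k) (fun k => h0 1 k ▸ u.2 k) ?_
      fun k => ?_
    · simpa only [cycleEigenvalue, h0] using he
    · simp [deformLast]
  obtain ⟨D, hD1, hD2, hD3⟩ := h1.exists_certificate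
  have hdiff : Differentiable ℂ fun t => D (deformLast u.1 t) :=
    (hD1.comp (contDiff_deformLast u.1)).differentiable one_ne_zero
  have hf : ∃ᶠ t in 𝓝 (0 : ℂ), D (deformLast u.1 t) ≠ 0 := by
    intro h2
    have h3 : (fun t => D (deformLast u.1 t)) =ᶠ[𝓝 0] 0 := h2.mono fun t ht => not_not.1 ht
    have hA : AnalyticOnNhd ℂ (fun t => D (deformLast u.1 t)) Set.univ :=
      fun t _ => hdiff.analyticAt t
    exact hD2 (hA.eqOn_zero_of_preconnected_of_eventuallyEq_zero isPreconnected_univ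
      (Set.mem_univ 0) h3 (Set.mem_univ 1))
  have hc : Tendsto (deformLast u.1) (𝓝 0) (𝓝 u.1) := by
    have := (contDiff_deformLast u.1).continuous.tendsto 0
    rwa [deformLast_zero] at this
  refine mem_closure_of_frequently hc (hf.mono fun t ht => ?_)
  have hdet : ∀ k, (deformLast u.1 t k 0).det = (-1) ^ (n * μ) := fun k => h0 t k ▸ u.2 k
  have hdiag : ∀ k, (deformLast u.1 t k 0).IsDiag := fun k => h0 t k ▸ hd k
  exact ⟨⟨deformLast u.1 t, hdet⟩, rfl, subset_closure
    (IsGeneric.mem_genericLocus (hD3 _ hdiag hdet ht))⟩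

end

/-- The constant change of bases `P` diagonalizes `a_0^0` and leaves the other, scalar, `a_k^0`
unchanged. -/
theorem UnimodularCoefficients.mem_closure_of_diagonalizable (hμ : 1 ≤ μ)
    (u : UnimodularCoefficients μ n N) {r : ℂ} (hr : r ≠ 0) (hu : ∀ k, k ≠ 0 → u.1 k 0 = r • 1)
    (P : (Matrix (Fin n) (Fin n) ℂ)ˣ) {e : Fin n → ℂ}
    (hP : u.1 0 0 * (P : Matrix (Fin n) (Fin n) ℂ) =
      (P : Matrix (Fin n) (Fin n) ℂ) * Matrix.diagonal e)
    (he : ∀ p q, p ≠ q → e p ^ ((μ + 1) * n) ≠ e q ^ ((μ + 1) * n)) :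
    u.toModuli ∈ closure (genericLocus μ n N) := by
  set a := gaugeCoeff (fun _ => (P : Matrix (Fin n) (Fin n) ℂ)) u.1 with ha
  have hI : Intertwines (fun _ => P) u.1 a :=
    intertwines_gaugeCoeff one_ne_zero (fun k => by simp) u.1
  have ha0 : ∀ k, a k 0 = ((P⁻¹ : (Matrix (Fin n) (Fin n) ℂ)ˣ) : Matrix (Fin n) (Fin n) ℂ) *
      u.1 k 0 * P := fun k => by
    rw [Matrix.coe_units_inv]
    rfl
  have h00 : a 0 0 = Matrix.diagonal e := by
    rw [ha0, mul_assoc, hP, Units.inv_mul_cancel_left]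
  have hk0 : ∀ k, k ≠ 0 → a k 0 = r • 1 := fun k hk => by
    rw [ha0, hu k hk, Matrix.mul_smul, mul_one, Matrix.smul_mul, Units.inv_mul]
  have hdet : ∀ k, (a k 0).det = (-1) ^ (n * μ) := fun k => by
    refine Eq.trans ?_ (u.2 k)
    rw [ha0, Matrix.det_mul, Matrix.det_mul, mul_right_comm, ← Matrix.det_mul,
      Units.inv_mul, Matrix.det_one, one_mul]
  let v : UnimodularCoefficients μ n N := ⟨a, hdet⟩
  have huv : u.toModuli = v.toModuli :=
    toModuli_eq_of_intertwines (p := u.toLift) (h := fun _ => P) (by rwa [u.coeff_toLift])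
  rw [huv]
  have hev : ∀ p, cycleEigenvalue a p = e p * ∏ k ∈ Finset.univ.erase (0 : ZMod N), r := by
    intro p
    rw [cycleEigenvalue, ← Finset.mul_prod_erase _ _ (Finset.mem_univ 0), h00,
      Matrix.diagonal_apply_eq]
    congr 1
    refine Finset.prod_congr rfl fun k hk => ?_
    rw [hk0 k (Finset.ne_of_mem_erase hk)]
    simp
  have hC : ∏ k ∈ Finset.univ.erase (0 : ZMod N), r ≠ 0 := Finset.prod_ne_zero_iff.2 fun _ _ => hr
  refine v.mem_closure_of_isDiag hμ (fun k => ?_) fun p q hpq h => he p q hpq ?_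
  · change (a k 0).IsDiag
    by_cases hk : k = 0
    · rw [hk, h00]
      exact Matrix.isDiag_diagonal e
    · rw [hk0 k hk]
      exact Matrix.isDiag_one.smul r
  · change cycleEigenvalue a p ^ _ = cycleEigenvalue a q ^ _ at h
    rw [hev, hev, mul_pow, mul_pow] at h
    exact mul_right_cancel₀ (pow_ne_zero _ hC) h

theorem Matrix.BlockTriangular.exists_mul_diagonal {B : Matrix (Fin n) (Fin n) ℂ}
    (hB : B.BlockTriangular id) (hd : Function.Injective fun p => B p p) :
    ∃ P : (Matrix (Fin n) (Fin n) ℂ)ˣ, B * (P : Matrix (Fin n) (Fin n) ℂ) =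
      (P : Matrix (Fin n) (Fin n) ℂ) * Matrix.diagonal fun p => B p p := by
  have hv : ∀ p, ∃ v : Fin n → ℂ, v ≠ 0 ∧ (B - Matrix.diagonal fun _ => B p p) *ᵥ v = 0 := by
    intro p
    rw [Matrix.exists_mulVec_eq_zero_iff,
      Matrix.det_of_isUpperTriangular (hB.sub (Matrix.blockTriangular_diagonal _))]
    exact Finset.prod_eq_zero (Finset.mem_univ p) (by simp)
  choose v hv0 hv using hv
  have hBv : ∀ p, B *ᵥ v p = B p p • v p := by
    intro p
    have h1 := hv p
    rw [Matrix.sub_mulVec, sub_eq_zero] at h1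
    rw [h1]
    ext q
    simp [Matrix.mulVec_diagonal]
  have hli : LinearIndependent ℂ v :=
    Module.End.eigenvectors_linearIndependent' (Matrix.toLin' B) (fun p => B p p) hd v fun p =>
      ⟨Module.End.mem_eigenspace_iff.2 (by rw [Matrix.toLin'_apply, hBv]), hv0 p⟩
  have hu : IsUnit (Matrix.of v)ᵀ := Matrix.linearIndependent_cols_iff_isUnit.1 hli
  refine ⟨hu.unit, ?_⟩
  rw [hu.unit_spec]
  ext p q
  rw [Matrix.mul_diagonal]
  have h1 := congr_fun (hBv q) p
  rw [Pi.smul_apply, smul_eq_mul, mul_comm] at h1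
  exact h1

theorem IsBlockToeplitz.blockTriangular {c : Composition n} {A : Matrix (Fin n) (Fin n) ℂ}
    (h : IsBlockToeplitz c A) : A.BlockTriangular id := by
  obtain ⟨r, hr, rfl⟩ := h
  intro p q hpq
  obtain ⟨⟨i, p⟩, rfl⟩ := c.blocksFinEquiv.surjective p
  obtain ⟨⟨j, q⟩, rfl⟩ := c.blocksFinEquiv.surjective q
  rw [Matrix.reindex_apply, Matrix.submatrix_apply, Equiv.symm_apply_apply,
    Equiv.symm_apply_apply]
  by_cases hij : i = j
  · subst hij
    rw [Matrix.blockDiagonal'_apply_eq]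
    obtain ⟨t, ht⟩ := hr i
    rw [ht, if_neg]
    intro hle
    have h1 : (c.embedding i q : Fin n) < c.embedding i p := hpq
    exact absurd ((c.embedding i).lt_iff_lt.1 h1) (not_lt.2 hle)
  · exact Matrix.blockDiagonal'_apply_ne _ _ _ hij

/-- A diagonal matrix of determinant one. -/
noncomputable def spread (n : ℕ) (z : ℂ) : Matrix (Fin n) (Fin n) ℂ :=
  Matrix.diagonal fun p => z ^ (2 * (p : ℕ)) * z⁻¹ ^ (n - 1)

theorem det_spread {z : ℂ} (hz : z ≠ 0) : (spread n z).det = 1 := by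
  have h1 : ∏ p : Fin n, z ^ (2 * (p : ℕ)) = z ^ (n * (n - 1)) := by
    rw [Finset.prod_pow_eq_pow_sum, ← Finset.mul_sum, Fin.sum_univ_eq_sum_range (fun i => i) n,
      mul_comm 2, Finset.sum_range_id_mul_two]
  rw [spread, Matrix.det_diagonal, Finset.prod_mul_distrib, h1, Finset.prod_const, Finset.card_univ,
    Fintype.card_fin, ← pow_mul, mul_comm (n - 1), ← mul_pow, mul_inv_cancel₀ hz, one_pow]

theorem spread_one : spread n 1 = 1 := by simp [spread]

theorem eventually_pow_mul_ne {i j : ℕ} (hij : i ≠ j) {x y : ℂ} (hx : x ≠ 0) (z₀ : ℂ) :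
    ∀ᶠ z in 𝓝[≠] z₀, z ^ i * x ≠ z ^ j * y := by
  set f : Polynomial ℂ := Polynomial.monomial i x - Polynomial.monomial j y with hf
  have hf0 : f ≠ 0 := by
    intro h
    have h1 := congr_arg (fun g : Polynomial ℂ => g.coeff i) h
    simp only [hf, Polynomial.coeff_sub, Polynomial.coeff_monomial, if_true, if_neg hij.symm,
      sub_zero, Polynomial.coeff_zero] at h1
    exact hx h1
  have h1 : ∀ᶠ z in cofinite, ¬ f.IsRoot z := (Polynomial.finite_setOfPred_isRoot hf0).compl_mem_cofinite
  refine (h1.filter_mono (nhdsNE_le_cofinite _)).mono fun z hz h => hz ?_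
  simp only [hf, Polynomial.IsRoot, Polynomial.eval_sub, Polynomial.eval_monomial]
  linear_combination h

/-- Up to a common factor the two sides are monomials in `z` of different degrees with non-zero
coefficients, and agree only for finitely many `z`. -/
theorem eventually_spread (hK : 0 < (μ + 1) * n) {d : Fin n → ℂ} (hd : ∀ p, d p ≠ 0) :
    ∀ᶠ z in 𝓝[≠] (1 : ℂ), z ≠ 0 ∧ ∀ p q : Fin n, p ≠ q →
      (z ^ (2 * (p : ℕ)) * z⁻¹ ^ (n - 1) * d p) ^ ((μ + 1) * n) ≠
        (z ^ (2 * (q : ℕ)) * z⁻¹ ^ (n - 1) * d q) ^ ((μ + 1) * n) := by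
  have h1 : ∀ᶠ z in 𝓝[≠] (1 : ℂ), ∀ p q : Fin n, p ≠ q →
      z ^ (2 * (p : ℕ) * ((μ + 1) * n)) * d p ^ ((μ + 1) * n) ≠
        z ^ (2 * (q : ℕ) * ((μ + 1) * n)) * d q ^ ((μ + 1) * n) := by
    refine eventually_all.2 fun p => eventually_all.2 fun q => eventually_imp_distrib_left.2
      fun hpq => eventually_pow_mul_ne (fun h => hpq (Fin.ext ?_)) (pow_ne_zero _ (hd p)) 1
    have h2 := Nat.eq_of_mul_eq_mul_right hK h
    omega
  have h2 : ∀ᶠ z in 𝓝[≠] (1 : ℂ), z ≠ 0 :=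
    (eventually_ne_nhds one_ne_zero).filter_mono nhdsWithin_le_nhds
  filter_upwards [h1, h2] with z hz hz0
  refine ⟨hz0, fun p q hpq h => hz p q hpq ?_⟩
  have h3 : (z⁻¹ ^ (n - 1)) ^ ((μ + 1) * n) ≠ 0 := pow_ne_zero _ (pow_ne_zero _ (inv_ne_zero hz0))
  refine mul_right_cancel₀ h3 ?_
  rw [pow_mul _ (2 * (p : ℕ)), pow_mul _ (2 * (q : ℕ)), mul_right_comm, mul_right_comm _ (d q ^ _), ← mul_pow, ← mul_pow, ← mul_pow,
    ← mul_pow]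
  exact h

/-- Multiplying `a_0^0` by `spread n z` keeps it triangular with the same determinant. For `z ≠ 1`
near `1` its eigenvalues, the diagonal entries, have distinct powers, so it is diagonalizable. -/
theorem UnimodularCoefficients.mem_closure_of_blockTriangular (hμ : 1 ≤ μ)
    (u : UnimodularCoefficients μ n N) {r : ℂ} (hr : r ≠ 0) (hu : ∀ k, k ≠ 0 → u.1 k 0 = r • 1)
    (hB : (u.1 0 0).BlockTriangular id) : u.toModuli ∈ closure (genericLocus μ n N) := by
  let γ : ℂ → Coefficients (μ + 1) n N := fun z =>
    Function.update u.1 0 (Function.update (u.1 0) 0 (spread n z * u.1 0 0))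
  have hγ0 : ∀ z, γ z 0 0 = spread n z * u.1 0 0 := fun z => by simp [γ]
  have hγk : ∀ z k, k ≠ 0 → γ z k = u.1 k := fun z k hk => by simp [γ, hk]
  have hγ1 : γ 1 = u.1 := by simp [γ, spread_one]
  have hs : ContinuousAt (spread n) 1 := by
    refine continuousAt_pi.2 fun p => continuousAt_pi.2 fun q => ?_
    by_cases hpq : p = q
    · subst hpq
      simp only [spread, Matrix.diagonal_apply_eq]
      exact (continuousAt_id.pow _).mul ((continuousAt_id.inv₀ one_ne_zero).pow _)
    · simp only [spread, Matrix.diagonal_apply_ne _ hpq]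
      exact continuousAt_const
  have hγ : Tendsto γ (𝓝[≠] 1) (𝓝 u.1) := by
    have h1 : ContinuousAt γ 1 := by
      refine (continuousAt_const (y := u.1)).update 0
        ((continuousAt_const (y := u.1 0)).update 0 ?_)
      exact (continuous_id.matrix_mul continuous_const).continuousAt.comp hs
    have h2 := h1.tendsto
    rw [hγ1] at h2
    exact h2.mono_left nhdsWithin_le_nhds
  have hd0 : ∀ p, u.1 0 0 p p ≠ 0 := by
    have h1 := u.2 0
    rw [Matrix.det_of_isUpperTriangular hB] at h1
    have h2 : ∏ p, u.1 0 0 p p ≠ 0 := by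
      rw [h1]
      exact pow_ne_zero _ (by norm_num)
    exact fun p => Finset.prod_ne_zero_iff.1 h2 p (Finset.mem_univ p)
  have hK : 0 < (μ + 1) * n := Nat.mul_pos (Nat.succ_pos μ) (NeZero.pos n)
  refine mem_closure_of_frequently hγ ((eventually_spread (μ := μ) hK hd0).mono fun z hz => ?_).frequently
  have hdet : ∀ k, (γ z k 0).det = (-1) ^ (n * μ) := by
    intro k
    by_cases hk : k = 0
    · rw [hk, hγ0, Matrix.det_mul, det_spread hz.1, one_mul]
      exact u.2 0
    · rw [hγk z k hk]
      exact u.2 k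
  refine ⟨⟨γ z, hdet⟩, rfl, ?_⟩
  have hB' : (γ z 0 0).BlockTriangular id := by
    rw [hγ0]
    exact (Matrix.blockTriangular_diagonal _).mul hB
  have hdz : ∀ p, γ z 0 0 p p = z ^ (2 * (p : ℕ)) * z⁻¹ ^ (n - 1) * u.1 0 0 p p := fun p => by
    rw [hγ0, spread, Matrix.diagonal_mul]
  have he : ∀ p q, p ≠ q → γ z 0 0 p p ^ ((μ + 1) * n) ≠ γ z 0 0 q q ^ ((μ + 1) * n) := by
    simpa only [hdz] using hz.2
  obtain ⟨P, hP⟩ := hB'.exists_mul_diagonal fun p q h => by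
    by_contra hpq
    exact he p q hpq (congr_arg (· ^ _) h)
  exact mem_closure_of_diagonalizable hμ ⟨γ z, hdet⟩ hr
    (fun k hk => by rw [← hu k hk]; exact congr_fun (hγk z k hk) 0) P hP he

/-- Every regular twisted polygon has a lift in block Toeplitz normal form. -/
theorem exists_blockToeplitz_lift (hmN : Nat.Coprime (μ + 1) N) (φ : RegularPolygon (μ + 1) n N)
    {M : SLmn (μ + 1) n} (hM : φ.1.IsMonodromy M) :
    ∃ p : TwistedLiftSpace (μ + 1) n N, p.toPolygon = φ ∧ p.1.2 = M ∧
      (∀ k, (frame p.1.1 k).det = 1) ∧ ∃ (c : Composition n) (r : ℂ), r ≠ 0 ∧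
        IsBlockToeplitz c (p.coeff 0 0) ∧ ∀ k, k ≠ 0 → p.coeff k 0 = r • 1 := by
  obtain ⟨V, hV⟩ := hM.exists_lift
  obtain ⟨p, hpV, rfl⟩ := hV.exists_toPolygon
  obtain ⟨x, hx⟩ := p.exists_normalized hmN
  set p' := p.gauge fun k => x k • 1 with hp'
  obtain ⟨r, hr, hrn⟩ := exists_root_sign n μ
  obtain ⟨P, c, J, hJ, hP⟩ := exists_jordan_form
    ((List.range N).map fun j => p'.coeff ((j * (μ + 1) : ℕ) : ZMod N) 0).prod
  obtain ⟨q, hq1, hq2, hq3, hq4, hq5⟩ := TwistedLiftSpace.exists_gauge_conj hmN hx hr hrn P J hP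
  refine ⟨q, hq1.trans (p.toPolygon_gauge _), ?_, hq3, c, r, hr, ?_, hq5⟩
  · rw [hq2]
    exact congr_arg Prod.snd hpV
  · rw [hq4]
    exact hJ.smul _

theorem dense_genericLocus (hμ : 1 ≤ μ) (hmN : Nat.Coprime (μ + 1) N) :
    Dense (genericLocus μ n N) := by
  intro x
  obtain ⟨φ, rfl⟩ := Quotient.exists_rep x
  obtain ⟨M, hM⟩ := φ.1.exists_monodromy
  obtain ⟨p, rfl, -, hp, c, r, hr, hc, hpr⟩ := exists_blockToeplitz_lift hmN φ hM
  let u : UnimodularCoefficients μ n N := ⟨p.coeff, fun k => TwistedLiftSpace.det_coeff_zero hp k⟩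
  have h1 : p.toModuli = u.toModuli :=
    UnimodularCoefficients.toModuli_eq_of_intertwines (Intertwines.refl _)
  change p.toModuli ∈ _
  rw [h1]
  exact u.mem_closure_of_blockTriangular hμ hr hpr hc.blockTriangular

end Density

theorem mainTheorem1 (m n N : ℕ) [NeZero N] (hm : 2 ≤ m) (hn : 1 ≤ n) (hmN : Nat.Coprime m N) :
    (∀ φ : RegularPolygon m n N, ∀ M : SLmn m n, φ.1.IsMonodromy M →
      ∃ (V : ℤ → Matrix (Fin m × Fin n) (Fin n) ℂ) (a : Coefficients m n N),
        φ.1.IsTwistedLift M V ∧ (∀ k, (frame V k).det = 1) ∧ SatisfiesRecursion V a ∧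
        ∃ c : Composition n, ∀ (k : ZMod N) (i : Fin m), (i : ℕ) = 0 →
          IsBlockToeplitz c (a k i) ∧ (a k i).det = (-1) ^ (n * (m - 1))) ∧
    (∃ U : Set (ModuliSpace m n N), IsOpen U ∧ Dense U ∧
      ∀ φ : RegularPolygon m n N, ModuliSpace.mk φ ∈ U →
        ∀ M : SLmn m n, φ.1.IsMonodromy M →
          ∃ (V : ℤ → Matrix (Fin m × Fin n) (Fin n) ℂ) (a : Coefficients m n N),
            φ.1.IsTwistedLift M V ∧ (∀ k, (frame V k).det = 1) ∧ SatisfiesRecursion V a ∧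
            IsGenericNormalForm a ∧
            ∃ (T : Finset (ZMod N × Fin m × Fin n × Fin n))
              (e : OpenPartialHomeomorph (ModuliSpace m n N) (T → ℂ))
              (α : (T → ℂ) → Coefficients m n N),
              IsCoordinateSelection T ∧ IsCoefficientChart T e α ∧
              ModuliSpace.mk φ ∈ e.source ∧ α (e (ModuliSpace.mk φ)) = a) := by
  obtain ⟨μ, rfl⟩ : ∃ μ, m = μ + 1 := ⟨m - 1, by omega⟩
  have hμ : 1 ≤ μ := by omega
  have : NeZero n := ⟨by omega⟩
  refine ⟨fun φ M hM => ?_, genericLocus μ n N, isOpen_genericLocus hμ hmN,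
    dense_genericLocus hμ hmN, fun φ hφ M hM => ?_⟩
  · obtain ⟨p, rfl, rfl, hp, c, r, -, hc, hpr⟩ := exists_blockToeplitz_lift hmN φ hM
    refine ⟨p.1.1, p.coeff, p.isTwistedLift, hp, p.recursion, c, fun k i hi => ?_⟩
    obtain rfl : i = 0 := Fin.ext hi
    refine ⟨?_, TwistedLiftSpace.det_coeff_zero hp k⟩
    by_cases hk : k = 0
    · rwa [hk]
    · rw [hpr k hk]
      exact (isBlockToeplitz_one c).smul r
  · obtain ⟨p, rfl, rfl, hp, hgen, hs⟩ := exists_generic_lift hmN hφ hM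
    obtain ⟨T, e, α, hT, hα, hpe, hαe, -⟩ := hgen.exists_chart hμ hmN hs
    exact ⟨p.1.1, p.coeff, p.isTwistedLift, hp, p.recursion, hgen.isGenericNormalForm hs, T, e, α,
      hT, hα, hpe, hαe⟩
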